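/- **Proposition (Brezis–Merle alternative).** Let $\Omega\subset\mathbb R^2$ be a bounded domain (a nonempty connected bounded open set) and let $\mathcal P$ be a Borel probability measure on $\mathbb R$ with $\operatorname{supp}\mathcal P\subseteq[0,1]$ and $\mathcal P(\{1\})>0$. For $n\in\mathbb N$ let $V_{\alpha,n}(x)$ be measurable in $(\alpha,x)\in[0,1]\times\Omega$, let $\varphi_n\in L^\infty(\Omega)$, and let $u_n\in L^1_{\rm loc}(\Omega)$ satisfy, in the sense of distributions, $$-\Delta u_n=\int_{[0,1]}V_{\alpha,n}(x)\,e^{\alpha u_n}\,\mathcal P(d\alpha)+\varphi_n\qquad\text{in }\Omega .$$ Suppose that for some constant $C$ and all $n$: 1. $0\le V_{\alpha,n}\le C$ almost everywhere, and $\|\varphi_n\|_{L^\infty(\Omega)}\le C$; 2. $\iint_{[0,1]\times\Omega}V_{\alpha,n}(x)\,e^{\alpha u_n}\,\mathcal P(d\alpha)\,dx\le C$; 3. $\|u_n^+\|_{L^1(\Omega)}\le C$, where $t^+=\max\{0,t\}$. Then there is a subsequence, still denoted $u_n$ (with the corresponding $V_{\alpha,n}$), for which exactly one of the following alternatives holds: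 (i) $u_n$ converges locally uniformly in $\Omega$ to a locally bounded function $u_0$; (ii) $u_n\to-\infty$ locally uniformly in $\Omega$; (iii) the blow-up set $\mathcal S=\{x\in\Omega:\ \operatorname{ess\,sup}_{B_\rho(x)\cap\Omega}u_n\to+\infty\text{ for every }\rho>0\}$ is finite and nonempty, $\mathcal S=\{p_1,\dots,p_m\}$, and there are numbers $n_i\ge4\pi$ $(i=1,\dots,m)$ and $r\in L^1(\Omega)$ such that $$\int_{[0,1]}V_{\alpha,n}(x)\,e^{\alpha u_n}\,\mathcal P(d\alpha)\,dx\ \stackrel{*}{\rightharpoonup}\ \sum_{i=1}^m n_i\,\delta_{p_i}+r(x)\,dx$$ weakly in the sense of measures on $\Omega$ (tested against continuous functions with compact support in $\Omega$); moreover $u_n^+$ is locally uniformly bounded in $\Omega\setminus\mathcal S$; and if $u_n$ is also locally uniformly bounded from below in $\Omega\setminus\mathcal S$, then $\int_{B_\rho(p_j)}e^{u_n}\,dx\to+\infty$ for every $j$ and every ball $B_\rho(p_j)\subset\Omega$, and in particular $\iint_{[0,1]\times\Omega}e^{\alpha u_n}\,\mathcal P(d\alpha)\,dx\to+\infty$.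 Here "locally uniformly" means uniformly on every compact subset, up to null sets (that is, in $L^\infty_{\rm loc}$); for continuous $u_n$ this is the usual notion, and $\mathcal S$ is then the set of $x\in\Omega$ for which there are $x_n\to x$ with $u_n(x_n)\to+\infty$. The integrals in the last assertions take values in $[0,+\infty]$. -/

import Mathlib

open MeasureTheory Filter Topology Set

noncomputable section

namespace BrezisMerle

/-- The Euclidean plane. -/
abbrev Plane : Type := EuclideanSpace ℝ (Fin 2)

/-- The exponential part `x ↦ ∫_{[0,1]} V_α(x) e^{α u(x)} P(dα)` of the right-hand side. -/
def expTerm (P : Measure ℝ) (V : ℝ → Plane → ℝ) (u : Plane → ℝ) (x : Plane) : ℝ :=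
  ∫ α in Icc (0 : ℝ) 1, V α x * Real.exp (α * u x) ∂P

/-- `-Δ u = f` in the sense of distributions in the open set `Ω`. -/
def IsDistribSolution (Ω : Set Plane) (u f : Plane → ℝ) : Prop :=
  LocallyIntegrableOn u Ω volume ∧ LocallyIntegrableOn f Ω volume ∧
    ∀ η : Plane → ℝ, ContDiff ℝ (⊤ : ℕ∞) η → HasCompactSupport η → tsupport η ⊆ Ω →
      -∫ x in Ω, u x * Laplacian.laplacian η x = ∫ x in Ω, f x * η x

/-! The functions `u n` are only determined up to null sets, so that the following notions of
local uniformity are in the sense of `L^∞_loc`; for continuous functions they are the usual ones,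
because nonempty open sets have positive measure. -/

/-- `u n → u₀` locally uniformly in `Ω`. -/
def TendstoLocUniform (Ω : Set Plane) (u : ℕ → Plane → ℝ) (u₀ : Plane → ℝ) : Prop :=
  ∀ K : Set Plane, IsCompact K → K ⊆ Ω → ∀ ε : ℝ, 0 < ε →
    ∀ᶠ n in atTop, ∀ᵐ x ∂(volume.restrict K), |u n x - u₀ x| < ε

/-- `u n → -∞` locally uniformly in `Ω`. -/
def TendstoLocUniformNegInfty (Ω : Set Plane) (u : ℕ → Plane → ℝ) : Prop :=
  ∀ K : Set Plane, IsCompact K → K ⊆ Ω → ∀ M : ℝ,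
    ∀ᶠ n in atTop, ∀ᵐ x ∂(volume.restrict K), u n x < M

/-- The sequence `u n` is locally uniformly bounded from above in `U`. -/
def LocUniformBddAbove (U : Set Plane) (u : ℕ → Plane → ℝ) : Prop :=
  ∀ K : Set Plane, IsCompact K → K ⊆ U →
    ∃ M : ℝ, ∀ n, ∀ᵐ x ∂(volume.restrict K), u n x ≤ M

/-- The sequence `u n` is locally uniformly bounded from below in `U`. -/
def LocUniformBddBelow (U : Set Plane) (u : ℕ → Plane → ℝ) : Prop :=
  ∀ K : Set Plane, IsCompact K → K ⊆ U →
    ∃ M : ℝ, ∀ n, ∀ᵐ x ∂(volume.restrict K), M ≤ u n x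

/-- The blow-up set of `u n` in `Ω`: the points `x ∈ Ω` such that, for every `ρ > 0`, the
essential supremum of `u n` on `B_ρ(x) ∩ Ω` tends to `+∞`. For continuous `u n` and open `Ω` this
says that `u n (x n) → +∞` for some sequence `x n → x`. -/
def blowUpSet (Ω : Set Plane) (u : ℕ → Plane → ℝ) : Set Plane :=
  {x | x ∈ Ω ∧ ∀ ρ : ℝ, 0 < ρ → ∀ M : ℝ, ∀ᶠ n in atTop,
    ∃ᶠ y in ae (volume.restrict (Metric.ball x ρ ∩ Ω)), M < u n y}

/-- `f n dx ⇀ ∑_{p ∈ S} m p δ_p + r dx` weakly in the sense of measures on `Ω`, that is, tested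
against continuous functions with compact support in `Ω`. -/
def WeakMeasureLimit (Ω : Set Plane) (f : ℕ → Plane → ℝ) (S : Finset Plane) (m : Plane → ℝ)
    (r : Plane → ℝ) : Prop :=
  ∀ η : Plane → ℝ, Continuous η → HasCompactSupport η → tsupport η ⊆ Ω →
    Tendsto (fun n => ∫ x in Ω, f n x * η x) atTop
      (𝓝 (∑ p ∈ S, m p * η p + ∫ x in Ω, r x * η x))

/-- Compactness: local uniform convergence to a locally bounded function. -/
def Converges (Ω : Set Plane) (u : ℕ → Plane → ℝ) : Prop :=
  ∃ u₀ : Plane → ℝ,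
    (∀ K : Set Plane, IsCompact K → K ⊆ Ω → ∃ M : ℝ, ∀ x ∈ K, |u₀ x| ≤ M) ∧
    TendstoLocUniform Ω u u₀

/-- Concentration: blow-up on a finite nonempty set with point masses at least `4π`, and
divergence of the exponential integrals if in addition `u n` is locally uniformly bounded from
below off the blow-up set. -/
def Concentrates (Ω : Set Plane) (P : Measure ℝ) (V : ℕ → ℝ → Plane → ℝ)
    (u : ℕ → Plane → ℝ) : Prop :=
  ∃ (S : Finset Plane) (m : Plane → ℝ) (r : Plane → ℝ),
    S.Nonempty ∧ (S : Set Plane) ⊆ Ω ∧ (S : Set Plane) = blowUpSet Ω u ∧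
    (∀ p ∈ S, 4 * Real.pi ≤ m p) ∧ IntegrableOn r Ω volume ∧
    WeakMeasureLimit Ω (fun n => expTerm P (V n) (u n)) S m r ∧
    LocUniformBddAbove (Ω \ S) (fun n x => max (u n x) 0) ∧
    (LocUniformBddBelow (Ω \ S) u →
      (∀ p ∈ S, ∀ ρ : ℝ, 0 < ρ → Metric.ball p ρ ⊆ Ω →
        Tendsto (fun n => ∫⁻ x in Metric.ball p ρ, ENNReal.ofReal (Real.exp (u n x)))
          atTop (𝓝 ⊤)) ∧
      Tendsto (fun n => ∫⁻ x in Ω, ∫⁻ α in Icc (0 : ℝ) 1,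
          ENNReal.ofReal (Real.exp (α * u n x)) ∂P) atTop (𝓝 ⊤))

/-- Exactly one of three propositions holds. -/
def ExactlyOne (a b c : Prop) : Prop :=
  (a ∧ ¬b ∧ ¬c) ∨ (¬a ∧ b ∧ ¬c) ∨ (¬a ∧ ¬b ∧ c)

end BrezisMerle

end

/-!
The proof runs on a representation formula that needs neither a Green function nor boundary data. Let
`b` be a smooth radial profile of total mass one. The difference of the smoothed logarithmic
potentials at two scales is a compactly supported test function whose Laplacian is the difference of
the corresponding mollifiers. Testing `-Δ u = f` with it and letting the smaller scale tend to `0`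
gives, at almost every point,

  `u x = ∫ mollifier δ (x - y) * u y + ∫ kernel δ (x - y) * f y`,

where `kernel δ` is `(2π)⁻¹ log (1 / ‖·‖)` made to vanish for `‖·‖ ≥ δ`
(`RadialProfile.ae_eq_integral_add_integral`). The first term is bounded above by means of the `L¹`
norm of `u⁺`, so that `u` is bounded above by the logarithmic potential of the exponential term `F`.

If the mass of `F` on a ball is at most `m < 4π`, Jensen's inequality bounds the integral of
`exp (q u)` for some `q > 1`, and since `F ≤ C exp u⁺`, the potential and hence `u` are bounded above
near the centre (`IsAdmissible.exists_ae_le`). Along a subsequence the `F n` converge weakly to a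
finite measure `μ` (`exists_weak_limit`), and the blow-up set is the set of atoms of `μ` of mass at
least `4π` (`blowUpSet_eq`); in particular it is finite.

If there are no such atoms, the `u n` are locally bounded above. The representation formula at two
scales is then a Harnack inequality for `M - u n` (`exists_harnack`), which by connectedness
controls the `u n` near all points by one numerical sequence: either `u n → -∞` locally uniformly, or
a subsequence is locally bounded (`tendsto_negInfty_or_exists_bddBelow`). In the second case the
right-hand side of the formula is equicontinuous, and the Arzelà–Ascoli theorem applies
(`exists_converges`).

If there are such atoms, `μ` is absolutely continuous elsewhere, which gives the weak limit. Suppose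
that the `u n` are locally bounded below off the atoms. With a profile supported in an annulus, the
mollification of `u n` near an atom `p` only involves values away from `p`; hence `u n` is at least the
potential of `F n` up to a constant, and the limit of these potentials is at least
`2 log (1 / ‖x - p‖)` up to a constant. By Fatou's lemma the integrals of `exp (u n)` diverge
(`tendsto_setLIntegral_exp`).
-/

noncomputable section

namespace BrezisMerle

/-! ### Radial mollifiers and truncated logarithmic kernels -/

/-- A smooth nonnegative density `b` of the variable `t = ‖x‖²`, of total mass one on `[0, 1]`,
vanishing for `t ≥ 1` and constant for `t ≤ 1/8`. It is the profile of a radial mollifier of the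
plane; constancy near `0` makes `(∫₀ˢ b) / s` smooth at `0`. -/
structure RadialProfile where
  toFun : ℝ → ℝ
  contDiff : ContDiff ℝ (⊤ : ℕ∞) toFun
  nonneg : ∀ t, 0 ≤ toFun t
  eq_zero : ∀ t, 1 ≤ t → toFun t = 0
  flat : ∀ t, t ≤ 1 / 8 → toFun t = toFun 0
  integral_eq : ∫ t in (0 : ℝ)..1, toFun t = 1

namespace RadialProfile

variable (b : RadialProfile)

lemma continuous : Continuous b.toFun := b.contDiff.continuous

lemma exists_bound : ∃ B : ℝ, 0 < B ∧ ∀ t, b.toFun t ≤ B := by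
  obtain ⟨B, hB⟩ := (isCompact_Icc (a := (0 : ℝ)) (b := 1)).exists_bound_of_continuousOn
    b.continuous.continuousOn
  refine ⟨max B 1, by positivity, fun t => ?_⟩
  rcases le_total t 0 with ht | ht
  · rw [b.flat t (by linarith)]
    exact (le_abs_self _).trans ((hB 0 (by simp)).trans (le_max_left _ _))
  rcases le_total t 1 with ht1 | ht1
  · exact (le_abs_self _).trans ((hB t ⟨ht, ht1⟩).trans (le_max_left _ _))
  · rw [b.eq_zero t ht1]; positivity

/-- An upper bound of the profile. -/
def bound : ℝ := b.exists_bound.choose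

lemma bound_pos : 0 < b.bound := b.exists_bound.choose_spec.1

lemma le_bound (t : ℝ) : b.toFun t ≤ b.bound := b.exists_bound.choose_spec.2 t

/-- The mass `∫₀ˢ b` of the profile. -/
def cumul (s : ℝ) : ℝ := ∫ t in (0 : ℝ)..s, b.toFun t

lemma hasDerivAt_cumul (s : ℝ) : HasDerivAt b.cumul (b.toFun s) s :=
  intervalIntegral.integral_hasDerivAt_right (b.continuous.intervalIntegrable _ _)
    (b.continuous.stronglyMeasurableAtFilter _ _) b.continuous.continuousAt

lemma contDiff_cumul : ContDiff ℝ (⊤ : ℕ∞) b.cumul := by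
  rw [contDiff_infty_iff_deriv]
  refine ⟨fun s => (b.hasDerivAt_cumul s).differentiableAt, ?_⟩
  have : deriv b.cumul = b.toFun := funext fun s => (b.hasDerivAt_cumul s).deriv
  rw [this]; exact b.contDiff

lemma cumul_one : b.cumul 1 = 1 := b.integral_eq

lemma monotone_cumul : Monotone b.cumul :=
  monotone_of_hasDerivAt_nonneg b.hasDerivAt_cumul b.nonneg

lemma cumul_of_one_le {s : ℝ} (hs : 1 ≤ s) : b.cumul s = 1 := by
  have h1 := intervalIntegral.integral_add_adjacent_intervals
    (b.continuous.intervalIntegrable (μ := volume) 0 1)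
    (b.continuous.intervalIntegrable (μ := volume) 1 s)
  have h2 : ∫ t in (1 : ℝ)..s, b.toFun t = 0 := by
    rw [intervalIntegral.integral_congr (g := fun _ => (0 : ℝ))]
    · simp
    · intro t ht
      rw [uIcc_of_le hs] at ht
      exact b.eq_zero t ht.1
  rw [cumul, ← h1, h2, b.integral_eq, add_zero]

lemma cumul_le_one (s : ℝ) : b.cumul s ≤ 1 := by
  rcases le_total s 1 with h | h
  · exact b.cumul_one ▸ b.monotone_cumul h
  · exact (b.cumul_of_one_le h).le

lemma cumul_of_le {s : ℝ} (hs : s ≤ 1 / 8) : b.cumul s = b.toFun 0 * s := by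
  rw [cumul, intervalIntegral.integral_congr (g := fun _ => b.toFun 0)]
  · simp [mul_comm]
  · intro t ht
    refine b.flat t (ht.2.trans ?_)
    exact max_le (by norm_num) hs

/-- The smooth function `s ↦ (∫₀ˢ b) / s`. -/
def slope (s : ℝ) : ℝ := if s < 1 / 16 then b.toFun 0 else b.cumul s / s

lemma mul_slope (s : ℝ) : s * b.slope s = b.cumul s := by
  unfold slope
  split_ifs with h
  · rw [b.cumul_of_le (by linarith), mul_comm]
  · field_simp [show s ≠ 0 by linarith]

lemma contDiff_slope : ContDiff ℝ (⊤ : ℕ∞) b.slope := by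
  rw [contDiff_iff_contDiffAt]
  intro s
  rcases lt_or_ge s (1 / 8) with h | h
  · have : b.slope =ᶠ[𝓝 s] fun _ => b.toFun 0 := by
      filter_upwards [Iio_mem_nhds h] with t ht
      unfold slope
      split_ifs with h'
      · rfl
      · rw [b.cumul_of_le (le_of_lt ht)]
        field_simp [show t ≠ 0 by linarith]
    exact contDiffAt_const.congr_of_eventuallyEq this
  · have : b.slope =ᶠ[𝓝 s] fun t => b.cumul t / t := by
      filter_upwards [Ioi_mem_nhds (show (1 : ℝ) / 16 < s by linarith)] with t ht
      unfold slope
      rw [if_neg (not_lt.2 (le_of_lt ht))]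
    exact (b.contDiff_cumul.contDiffAt.div contDiffAt_id (by simp; linarith)).congr_of_eventuallyEq
      this

lemma slope_nonneg {s : ℝ} (hs : 0 ≤ s) : 0 ≤ b.slope s := by
  unfold slope
  split_ifs with h
  · exact b.nonneg 0
  · refine div_nonneg ?_ hs
    have := b.monotone_cumul hs
    simpa [cumul] using this

/-- The smooth regularization of the logarithm attached to the profile: it equals `log s` for
`s ≥ 1`, and `s` times its derivative is the cumulative mass of the profile. -/
def smoothLog (s : ℝ) : ℝ := ∫ t in (1 : ℝ)..s, b.slope t

lemma hasDerivAt_smoothLog (s : ℝ) : HasDerivAt b.smoothLog (b.slope s) s :=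
  intervalIntegral.integral_hasDerivAt_right (b.contDiff_slope.continuous.intervalIntegrable _ _)
    (b.contDiff_slope.continuous.stronglyMeasurableAtFilter _ _)
    b.contDiff_slope.continuous.continuousAt

lemma contDiff_smoothLog : ContDiff ℝ (⊤ : ℕ∞) b.smoothLog := by
  rw [contDiff_infty_iff_deriv]
  refine ⟨fun s => (b.hasDerivAt_smoothLog s).differentiableAt, ?_⟩
  have : deriv b.smoothLog = b.slope := funext fun s => (b.hasDerivAt_smoothLog s).deriv
  rw [this]; exact b.contDiff_slope

lemma smoothLog_one : b.smoothLog 1 = 0 := by simp [smoothLog]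

lemma smoothLog_of_one_le {s : ℝ} (hs : 1 ≤ s) : b.smoothLog s = Real.log s := by
  rw [smoothLog, intervalIntegral.integral_congr (g := fun t => t⁻¹)]
  · rw [integral_inv (by rw [uIcc_of_le hs]; intro h; linarith [h.1])]; simp
  · intro t ht
    rw [uIcc_of_le hs] at ht
    have h0 : t ≠ 0 := by linarith [ht.1]
    have h := b.mul_slope t
    rw [b.cumul_of_one_le ht.1] at h
    exact eq_inv_of_mul_eq_one_right h

lemma antitoneOn_smoothLog_sub_log :
    AntitoneOn (fun s => b.smoothLog s - Real.log s) (Ioi 0) := by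
  refine antitoneOn_of_deriv_nonpos (convex_Ioi 0) ?_ ?_ ?_
  · intro s hs
    exact ((b.hasDerivAt_smoothLog s).sub
      (Real.hasDerivAt_log (ne_of_gt hs))).continuousAt.continuousWithinAt
  · intro s hs
    rw [interior_Ioi] at hs
    exact ((b.hasDerivAt_smoothLog s).sub
      (Real.hasDerivAt_log (ne_of_gt hs))).differentiableAt.differentiableWithinAt
  · intro s hs
    rw [interior_Ioi] at hs
    have hd : HasDerivAt (fun s => b.smoothLog s - Real.log s) (b.slope s - s⁻¹) s :=
      (b.hasDerivAt_smoothLog s).sub (Real.hasDerivAt_log (ne_of_gt hs))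
    rw [hd.deriv]
    have h0 : 0 < s := hs
    have h := b.cumul_le_one s
    rw [← b.mul_slope s] at h
    have : b.slope s ≤ s⁻¹ := by
      rw [← one_div, le_div_iff₀ h0, mul_comm]; exact h
    linarith

lemma log_le_smoothLog {s : ℝ} (hs : 0 < s) : Real.log s ≤ b.smoothLog s := by
  rcases le_total s 1 with h | h
  · have := b.antitoneOn_smoothLog_sub_log hs (show (1 : ℝ) ∈ Ioi 0 by simp) h
    simp only [smoothLog_one, Real.log_one] at this
    linarith
  · exact (b.smoothLog_of_one_le h).ge

lemma monotoneOn_smoothLog : MonotoneOn b.smoothLog (Ici 0) := by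
  refine monotoneOn_of_deriv_nonneg (convex_Ici 0) b.contDiff_smoothLog.continuous.continuousOn
    (fun s _ => (b.hasDerivAt_smoothLog s).differentiableAt.differentiableWithinAt) ?_
  intro s hs
  rw [interior_Ici] at hs
  rw [(b.hasDerivAt_smoothLog s).deriv]
  exact b.slope_nonneg (le_of_lt hs)

lemma smoothLog_nonpos {s : ℝ} (hs : 0 ≤ s) (h1 : s ≤ 1) : b.smoothLog s ≤ 0 :=
  b.smoothLog_one ▸ b.monotoneOn_smoothLog hs (show (0 : ℝ) ≤ 1 by norm_num) h1

lemma smoothLog_zero_le {s : ℝ} (hs : 0 ≤ s) : b.smoothLog 0 ≤ b.smoothLog s :=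
  b.monotoneOn_smoothLog (show (0 : ℝ) ∈ Ici 0 by simp) hs hs

/-- Normalization of a profile to unit mass. -/
def ofPos (f : ℝ → ℝ) (hf : ContDiff ℝ (⊤ : ℕ∞) f) (h0 : ∀ t, 0 ≤ f t)
    (h1 : ∀ t, 1 ≤ t → f t = 0) (h2 : ∀ t, t ≤ 1 / 8 → f t = f 0)
    (h3 : 0 < ∫ t in (0 : ℝ)..1, f t) : RadialProfile where
  toFun t := (∫ t in (0 : ℝ)..1, f t)⁻¹ * f t
  contDiff := contDiff_const.mul hf
  nonneg t := mul_nonneg (inv_nonneg.2 h3.le) (h0 t)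
  eq_zero t ht := by simp [h1 t ht]
  flat t ht := by rw [h2 t ht]
  integral_eq := by
    rw [intervalIntegral.integral_const_mul, inv_mul_cancel₀ h3.ne']

/-- There is a profile that is positive on a neighbourhood of the origin. -/
lemma exists_ball_profile :
    ∃ (b : RadialProfile) (β : ℝ), 0 < β ∧ ∀ t, t ≤ 1 / 4 → β ≤ b.toFun t := by
  let f : ℝ → ℝ := fun t => Real.smoothTransition (2 - 2 * t)
  have hf : ContDiff ℝ (⊤ : ℕ∞) f :=
    Real.smoothTransition.contDiff.comp (contDiff_const.sub (contDiff_const.mul contDiff_id))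
  have hone : ∀ t, t ≤ 1 / 2 → f t = 1 := fun t ht =>
    Real.smoothTransition.one_of_one_le (by linarith)
  have h3 : 0 < ∫ t in (0 : ℝ)..1, f t := by
    refine intervalIntegral.integral_pos (by norm_num) hf.continuous.continuousOn
      (fun t _ => Real.smoothTransition.nonneg _) ⟨0, by simp, ?_⟩
    rw [hone 0 (by norm_num)]; norm_num
  refine ⟨ofPos f hf (fun t => Real.smoothTransition.nonneg _)
    (fun t ht => Real.smoothTransition.zero_of_nonpos (by linarith))
    (fun t ht => by rw [hone t (by linarith), hone 0 (by norm_num)]) h3,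
    (∫ t in (0 : ℝ)..1, f t)⁻¹, inv_pos.2 h3, fun t ht => ?_⟩
  change _ ≤ _ * f t
  rw [hone t (by linarith), mul_one]

/-- There is a profile whose mollifier is supported in an annulus. -/
lemma exists_annular_profile : ∃ b : RadialProfile, ∀ t, t ≤ 1 / 4 → b.toFun t = 0 := by
  let f : ℝ → ℝ := fun t => Real.smoothTransition (4 * t - 1) * Real.smoothTransition (2 - 2 * t)
  have hf : ContDiff ℝ (⊤ : ℕ∞) f :=
    (Real.smoothTransition.contDiff.comp ((contDiff_const.mul contDiff_id).sub contDiff_const)).mul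
    (Real.smoothTransition.contDiff.comp (contDiff_const.sub (contDiff_const.mul contDiff_id)))
  have hzero : ∀ t, t ≤ 1 / 4 → f t = 0 := fun t ht => by
    simp only [f]
    rw [Real.smoothTransition.zero_of_nonpos (by linarith), zero_mul]
  have h0 : ∀ t, 0 ≤ f t := fun t =>
    mul_nonneg (Real.smoothTransition.nonneg _) (Real.smoothTransition.nonneg _)
  have h3 : 0 < ∫ t in (0 : ℝ)..1, f t := by
    refine intervalIntegral.integral_pos (by norm_num) hf.continuous.continuousOn
      (fun t _ => h0 t) ⟨1 / 2, by norm_num, ?_⟩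
    exact mul_pos (Real.smoothTransition.pos_of_pos (by norm_num))
      (Real.smoothTransition.pos_of_pos (by norm_num))
  refine ⟨ofPos f hf h0 (fun t ht => ?_)
    (fun t ht => by rw [hzero t (by linarith), hzero 0 (by norm_num)]) h3, fun t ht => ?_⟩
  · simp only [f]
    rw [Real.smoothTransition.zero_of_nonpos (x := 2 - 2 * t) (by linarith), mul_zero]
  · change _ * f t = 0
    rw [hzero t ht, mul_zero]

end RadialProfile

/-- The Laplacian of a radial function of the plane, in terms of the variable `s = ‖x - y‖²`. -/
lemma laplacian_comp_norm_sq {g g' g'' : ℝ → ℝ} (hg : ∀ s, HasDerivAt g (g' s) s)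
    (hg' : ∀ s, HasDerivAt g' (g'' s) s) (x y : Plane) :
    Laplacian.laplacian (fun y : Plane => g (‖x - y‖ ^ 2)) y =
      4 * (g' (‖x - y‖ ^ 2) + ‖x - y‖ ^ 2 * g'' (‖x - y‖ ^ 2)) := by
  -- the real inner product as a bilinear map, written in coordinates
  let A : Plane →L[ℝ] Plane →L[ℝ] ℝ := ∑ i : Fin 2,
    (EuclideanSpace.proj (𝕜 := ℝ) i).smulRight (EuclideanSpace.proj (𝕜 := ℝ) i)
  have hA : ∀ v w : Plane, A v w = inner ℝ v w := by
    intro v w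
    simp [A, Fin.sum_univ_two, PiLp.inner_apply, mul_comm]
  have hn : ∀ y : Plane, HasFDerivAt (fun y : Plane => ‖x - y‖ ^ 2) (-(2 : ℝ) • A (x - y)) y := by
    intro y
    have h : HasFDerivAt (fun y : Plane => ‖x - y‖ ^ 2) _ y :=
      ((hasFDerivAt_id y).const_sub x).norm_sq
    refine h.congr_fderiv ?_
    ext v
    simp [hA]
    ring
  have h1 : ∀ y : Plane, HasFDerivAt (fun y : Plane => g (‖x - y‖ ^ 2))
      (g' (‖x - y‖ ^ 2) • (-(2 : ℝ) • A (x - y))) y := fun y =>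
    (hg _).comp_hasFDerivAt y (hn y)
  have hf : fderiv ℝ (fun y : Plane => g (‖x - y‖ ^ 2)) =
      fun y => g' (‖x - y‖ ^ 2) • (-(2 : ℝ) • A (x - y)) := funext fun y => (h1 y).fderiv
  have h2 : HasFDerivAt (fun y : Plane => g' (‖x - y‖ ^ 2) • (-(2 : ℝ) • A (x - y)))
      (g' (‖x - y‖ ^ 2) • ((-(2 : ℝ)) • A.comp (-ContinuousLinearMap.id ℝ Plane)) +
        (g'' (‖x - y‖ ^ 2) • (-(2 : ℝ) • A (x - y))).smulRight
          (-(2 : ℝ) • A (x - y))) y := by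
    have h3 : HasFDerivAt (fun y : Plane => -(2 : ℝ) • A (x - y))
        ((-(2 : ℝ)) • A.comp (-ContinuousLinearMap.id ℝ Plane)) y :=
      (A.hasFDerivAt.comp y ((hasFDerivAt_id y).const_sub x)).fun_const_smul (-(2 : ℝ))
    have h4 : HasFDerivAt (fun y : Plane => g' (‖x - y‖ ^ 2)) _ y :=
      (hg' _).comp_hasFDerivAt y (hn y)
    exact h4.fun_smul h3
  rw [InnerProductSpace.laplacian_eq_iteratedFDeriv_orthonormalBasis _
    (EuclideanSpace.basisFun (Fin 2) ℝ)]
  simp only [iteratedFDeriv_two_apply]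
  rw [hf, h2.fderiv]
  have hns : ‖x - y‖ ^ 2 = (x 0 - y 0) ^ 2 + (x 1 - y 1) ^ 2 := by
    rw [EuclideanSpace.norm_sq_eq]; simp
  simp [Fin.sum_univ_two, EuclideanSpace.basisFun_apply, hns, hA, EuclideanSpace.inner_single_right]
  ring

namespace RadialProfile

variable (b : RadialProfile)

/-- The radial mollifier of mass one at scale `δ` attached to a profile. -/
def mollifier (δ : ℝ) (x : Plane) : ℝ := (Real.pi * δ ^ 2)⁻¹ * b.toFun (‖x‖ ^ 2 / δ ^ 2)

/-- The smooth regularization at scale `δ` of `(2π)⁻¹ log ‖x‖`, whose Laplacian is the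
mollifier. -/
def smoothPotential (δ : ℝ) (x : Plane) : ℝ :=
  (4 * Real.pi)⁻¹ * (b.smoothLog (‖x‖ ^ 2 / δ ^ 2) + Real.log (δ ^ 2))

/-- The truncated logarithmic kernel `(2π)⁻¹ log (1 / ‖x‖)` plus the smooth potential at scale `δ`.
It is nonnegative and supported in the ball of radius `δ`; its value at the singularity `0` is
the junk value `0`. -/
def kernel (δ : ℝ) (x : Plane) : ℝ :=
  max 0 ((4 * Real.pi)⁻¹ * (b.smoothLog (‖x‖ ^ 2 / δ ^ 2) - Real.log (‖x‖ ^ 2 / δ ^ 2)))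

lemma contDiff_smoothPotential (δ : ℝ) : ContDiff ℝ (⊤ : ℕ∞) (b.smoothPotential δ) :=
  contDiff_const.mul ((b.contDiff_smoothLog.comp ((contDiff_norm_sq ℝ).div_const _)).add
    contDiff_const)

/-- In the variable `s = ‖x‖²` the Laplacian is `4 (s g')'`, and `s` times the derivative of the
smoothed logarithm is the cumulative mass, whose derivative is the profile. -/
lemma laplacian_smoothPotential {δ : ℝ} (hδ : 0 < δ) (x y : Plane) :
    Laplacian.laplacian (fun y : Plane => b.smoothPotential δ (x - y)) y =
      b.mollifier δ (x - y) := by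
  have hs : ∀ s, HasDerivAt (fun s : ℝ => s / δ ^ 2) (1 / δ ^ 2) s := fun s =>
    (hasDerivAt_id s).div_const _
  have hd : ∀ t, HasDerivAt b.slope (deriv b.slope t) t := fun t =>
    ((b.contDiff_slope.differentiable (by simp)) t).hasDerivAt
  have key := laplacian_comp_norm_sq
    (g := fun s => (4 * Real.pi)⁻¹ * (b.smoothLog (s / δ ^ 2) + Real.log (δ ^ 2)))
    (g' := fun s => (4 * Real.pi)⁻¹ * (b.slope (s / δ ^ 2) * (1 / δ ^ 2)))
    (g'' := fun s => (4 * Real.pi)⁻¹ * (deriv b.slope (s / δ ^ 2) * (1 / δ ^ 2) * (1 / δ ^ 2)))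
    (fun s => (((b.hasDerivAt_smoothLog _).comp s (hs s)).add_const _).const_mul _)
    (fun s => (((hd _).comp s (hs s)).mul_const _).const_mul _) x y
  have hb : ∀ t, b.slope t + t * deriv b.slope t = b.toFun t := by
    intro t
    have h1 := (hasDerivAt_id t).mul (hd t)
    have h2 : (id * b.slope : ℝ → ℝ) = b.cumul := funext fun t => b.mul_slope t
    rw [h2] at h1
    have := h1.unique (b.hasDerivAt_cumul t)
    simpa using this
  unfold smoothPotential mollifier
  rw [key, ← hb]
  have := Real.pi_pos
  field_simp

lemma smoothPotential_of_le {δ : ℝ} (hδ : 0 < δ) {x : Plane} (hx : δ ≤ ‖x‖) :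
    b.smoothPotential δ x = (4 * Real.pi)⁻¹ * Real.log (‖x‖ ^ 2) := by
  have h : 1 ≤ ‖x‖ ^ 2 / δ ^ 2 := by
    rw [one_le_div (by positivity)]; gcongr
  have hx0 : 0 < ‖x‖ := hδ.trans_le hx
  rw [smoothPotential, b.smoothLog_of_one_le h, Real.log_div (by positivity) (by positivity)]
  ring

lemma kernel_of_ne {δ : ℝ} (hδ : 0 < δ) {x : Plane} (hx : x ≠ 0) :
    b.kernel δ x = b.smoothPotential δ x - (4 * Real.pi)⁻¹ * Real.log (‖x‖ ^ 2) := by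
  have hx0 : 0 < ‖x‖ := norm_pos_iff.2 hx
  rw [kernel, max_eq_right, smoothPotential, Real.log_div (by positivity) (by positivity)]
  · ring
  · have := b.log_le_smoothLog (s := ‖x‖ ^ 2 / δ ^ 2) (by positivity)
    have := Real.pi_pos
    apply mul_nonneg (by positivity); linarith

lemma kernel_nonneg (δ : ℝ) (x : Plane) : 0 ≤ b.kernel δ x := le_max_left _ _

lemma kernel_of_le {δ : ℝ} (hδ : 0 < δ) {x : Plane} (hx : δ ≤ ‖x‖) : b.kernel δ x = 0 := by
  have hx0 : x ≠ 0 := norm_pos_iff.1 (hδ.trans_le hx)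
  rw [b.kernel_of_ne hδ hx0, b.smoothPotential_of_le hδ hx, sub_self]

lemma measurable_kernel (δ : ℝ) : Measurable (b.kernel δ) := by
  have := b.contDiff_smoothLog.continuous.measurable
  unfold kernel
  fun_prop

lemma mollifier_nonneg (δ : ℝ) (x : Plane) : 0 ≤ b.mollifier δ x :=
  mul_nonneg (by positivity) (b.nonneg _)

lemma mollifier_le (δ : ℝ) (x : Plane) : b.mollifier δ x ≤ (Real.pi * δ ^ 2)⁻¹ * b.bound :=
  mul_le_mul_of_nonneg_left (b.le_bound _) (by positivity)

lemma mollifier_of_le {δ : ℝ} (hδ : 0 < δ) {x : Plane} (hx : δ ≤ ‖x‖) : b.mollifier δ x = 0 := by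
  rw [mollifier, b.eq_zero, mul_zero]
  rw [one_le_div (by positivity)]; gcongr

lemma continuous_mollifier (δ : ℝ) : Continuous (b.mollifier δ) := by
  have := b.continuous
  unfold mollifier
  fun_prop

lemma integral_mollifier {δ : ℝ} (hδ : 0 < δ) : ∫ x, b.mollifier δ x = 1 := by
  have h := integral_fun_norm_addHaar (volume : Measure Plane)
    (fun r => (Real.pi * δ ^ 2)⁻¹ * b.toFun (r ^ 2 / δ ^ 2))
  have hpi := Real.pi_pos
  have hball : (volume : Measure Plane).real (Metric.ball 0 1) = Real.pi := by
    rw [measureReal_def, EuclideanSpace.volume_ball_fin_two]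
    simp [hpi.le]
  have hint : ∫ y in Ioi (0 : ℝ), y * ((Real.pi * δ ^ 2)⁻¹ * b.toFun (y ^ 2 / δ ^ 2)) =
      (2 * Real.pi)⁻¹ * 1 - (2 * Real.pi)⁻¹ * b.cumul (0 ^ 2 / δ ^ 2) := by
    have hder : ∀ y : ℝ, HasDerivAt (fun y => (2 * Real.pi)⁻¹ * b.cumul (y ^ 2 / δ ^ 2))
        (y * ((Real.pi * δ ^ 2)⁻¹ * b.toFun (y ^ 2 / δ ^ 2))) y := by
      intro y
      have h1 : HasDerivAt (fun y : ℝ => y ^ 2 / δ ^ 2) (2 * y / δ ^ 2) y := by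
        simpa using (hasDerivAt_pow 2 y).div_const (δ ^ 2)
      have h2 : HasDerivAt (fun y : ℝ => b.cumul (y ^ 2 / δ ^ 2)) _ y :=
        (b.hasDerivAt_cumul _).comp y h1
      refine (h2.const_mul (2 * Real.pi)⁻¹).congr_deriv ?_
      field_simp
    refine integral_Ioi_of_hasDerivAt_of_nonneg (hder 0).continuousAt.continuousWithinAt
      (fun y _ => hder y) (fun y hy => ?_) ?_
    · exact mul_nonneg (le_of_lt hy) (mul_nonneg (by positivity) (b.nonneg _))
    · refine tendsto_const_nhds.congr' ?_
      filter_upwards [eventually_ge_atTop δ] with y hy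
      rw [b.cumul_of_one_le]
      rw [one_le_div (by positivity)]; gcongr
  have hc : b.cumul (0 ^ 2 / δ ^ 2) = 0 := by simp [cumul]
  unfold mollifier
  rw [h, hball]
  simp only [finrank_euclideanSpace, Fintype.card_fin, Nat.add_one_sub_one, pow_one, smul_eq_mul,
    nsmul_eq_mul]
  rw [hint, hc]
  push_cast
  field_simp
  norm_num

end RadialProfile

/-- The positive part of `(2π)⁻¹ log (δ / ‖x‖)`. -/
def logKernel (δ : ℝ) (x : Plane) : ℝ := (2 * Real.pi)⁻¹ * Real.posLog (δ / ‖x‖)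

lemma logKernel_nonneg (δ : ℝ) (x : Plane) : 0 ≤ logKernel δ x :=
  mul_nonneg (by have := Real.pi_pos; positivity) Real.posLog_nonneg

lemma measurable_logKernel (δ : ℝ) : Measurable (logKernel δ) := by
  unfold logKernel
  have : Measurable Real.posLog := by
    unfold Real.posLog; fun_prop
  fun_prop

lemma logKernel_of_le {δ : ℝ} (hδ : 0 < δ) {x : Plane} (hx : δ ≤ ‖x‖) : logKernel δ x = 0 := by
  have hx0 : 0 < ‖x‖ := hδ.trans_le hx
  rw [logKernel, (Real.posLog_eq_zero_iff _).2, mul_zero]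
  rw [abs_of_pos (by positivity)]
  exact (div_le_one hx0).2 hx

lemma logKernel_mono {δ ε : ℝ} (hε : 0 < ε) (h : ε ≤ δ) (x : Plane) :
    logKernel ε x ≤ logKernel δ x := by
  unfold logKernel
  have := Real.pi_pos
  gcongr

lemma RadialProfile.kernel_le (b : RadialProfile) {δ : ℝ} (hδ : 0 < δ) (x : Plane) :
    b.kernel δ x ≤ logKernel δ x := by
  rcases le_total δ ‖x‖ with hx | hx
  · rw [b.kernel_of_le hδ hx]; exact logKernel_nonneg _ _
  rcases eq_or_ne x 0 with rfl | hx0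
  · simp only [kernel, logKernel, norm_zero]
    have h0 := b.smoothLog_nonpos le_rfl zero_le_one
    have := Real.pi_pos
    simp only [ne_eq, OfNat.ofNat_ne_zero, not_false_eq_true, zero_pow, zero_div, Real.log_zero,
      sub_zero, div_zero, Real.posLog_zero, mul_zero]
    exact max_le le_rfl (mul_nonpos_of_nonneg_of_nonpos (by positivity) h0)
  · have hx1 : 0 < ‖x‖ := norm_pos_iff.2 hx0
    refine max_le (logKernel_nonneg _ _) ?_
    have h1 := b.smoothLog_nonpos (s := ‖x‖ ^ 2 / δ ^ 2) (by positivity)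
      ((div_le_one (by positivity)).2 (by gcongr))
    have h2 : Real.log (‖x‖ ^ 2 / δ ^ 2) = - (2 * Real.log (δ / ‖x‖)) := by
      rw [Real.log_div (by positivity) (by positivity), Real.log_div (by positivity)
        (by positivity), Real.log_pow, Real.log_pow]
      push_cast; ring
    have h3 : Real.log (δ / ‖x‖) ≤ Real.posLog (δ / ‖x‖) := le_max_right _ _
    have := Real.pi_pos
    rw [logKernel, h2]
    calc (4 * Real.pi)⁻¹ * (b.smoothLog (‖x‖ ^ 2 / δ ^ 2) - -(2 * Real.log (δ / ‖x‖)))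
        ≤ (4 * Real.pi)⁻¹ * (2 * Real.posLog (δ / ‖x‖)) := by gcongr; linarith
      _ = (2 * Real.pi)⁻¹ * Real.posLog (δ / ‖x‖) := by field_simp; ring

/-- Exponential integrability of the logarithmic kernel below the critical exponent `4π`. -/
lemma integrableOn_exp_logKernel {δ a : ℝ} (hδ : 0 < δ) (ha : 0 ≤ a) (ha' : a < 4 * Real.pi)
    (R : ℝ) : IntegrableOn (fun x => Real.exp (a * logKernel δ x)) (Metric.ball (0 : Plane) R) := by
  have hpi := Real.pi_pos
  set γ : ℝ := a * (2 * Real.pi)⁻¹ with hγ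
  have hγ0 : 0 ≤ γ := by positivity
  have hγ2 : γ < 2 := by
    rw [hγ, ← div_eq_mul_inv, div_lt_iff₀ (by positivity)]; linarith
  have h := integrableOn_fun_norm_addHaar (volume : Measure Plane)
    (f := fun r => Real.exp (γ * Real.posLog (δ / r))) (r := R)
  have hfun : (fun x : Plane => Real.exp (a * logKernel δ x)) =
      fun x => Real.exp (γ * Real.posLog (δ / ‖x‖)) := by
    funext x; rw [logKernel, hγ, mul_assoc]
  rw [hfun, h]
  simp only [finrank_euclideanSpace, Fintype.card_fin, Nat.add_one_sub_one, pow_one, smul_eq_mul]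
  rcases le_or_gt R 0 with hR | hR
  · rw [Ioo_eq_empty (by linarith)]; exact integrableOn_empty
  have hm : Measurable Real.posLog := by unfold Real.posLog; fun_prop
  have hI : IntegrableOn (fun y : ℝ => y + δ ^ γ * y ^ (1 - γ)) (Ioo 0 R) := by
    refine Integrable.add ?_ (Integrable.const_mul ?_ _)
    · exact (continuous_id.integrableOn_Icc (a := 0) (b := R)).mono_set Ioo_subset_Icc_self
    · exact (intervalIntegral.integrableOn_Ioo_rpow_iff hR).2 (by linarith)
  refine hI.mono' (by fun_prop) ?_
  filter_upwards [ae_restrict_mem measurableSet_Ioo] with y hy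
  have hy0 : 0 < y := hy.1
  rw [Real.norm_of_nonneg (by positivity)]
  have h1 : Real.exp (γ * Real.posLog (δ / y)) ≤ 1 + (δ / y) ^ γ := by
    rcases le_total (Real.log (δ / y)) 0 with hl | hl
    · rw [Real.posLog, max_eq_left hl, mul_zero, Real.exp_zero]
      have : 0 ≤ (δ / y) ^ γ := by positivity
      linarith
    · rw [Real.posLog, max_eq_right hl, Real.rpow_def_of_pos (by positivity), mul_comm]
      linarith
  calc y * Real.exp (γ * Real.posLog (δ / y)) ≤ y * (1 + (δ / y) ^ γ) := by gcongr
    _ = y + δ ^ γ * y ^ (1 - γ) := by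
      rw [Real.div_rpow hδ.le hy0.le, Real.rpow_sub hy0, Real.rpow_one]
      ring

lemma integrable_logKernel {δ : ℝ} (hδ : 0 < δ) : Integrable (logKernel δ) := by
  have h := integrableOn_exp_logKernel hδ (a := 1) (by norm_num)
    (by linarith [Real.pi_gt_three]) δ
  have h2 : IntegrableOn (logKernel δ) (Metric.ball 0 δ) := by
    refine Integrable.mono' h (measurable_logKernel δ).aestronglyMeasurable
      (Eventually.of_forall fun x => ?_)
    rw [Real.norm_of_nonneg (logKernel_nonneg _ _), one_mul]
    linarith [Real.add_one_le_exp (logKernel δ x)]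
  rw [← integrable_indicator_iff measurableSet_ball] at h2
  refine h2.congr (Eventually.of_forall fun x => ?_)
  by_cases hx : x ∈ Metric.ball (0 : Plane) δ
  · simp [hx]
  · simp only [indicator_of_notMem hx]
    rw [logKernel_of_le hδ]
    simpa using hx

/-! ### The representation formula -/

lemma integrable_mul_of_support_subset {Ω K : Set Plane} {u g : Plane → ℝ}
    (hu : LocallyIntegrableOn u Ω) (hg : Continuous g) (hK : IsCompact K) (hKΩ : K ⊆ Ω)
    (hgK : ∀ y, y ∉ K → g y = 0) : Integrable (fun y => g y * u y) := by
  have h1 : IntegrableOn u K := hu.integrableOn_compact_subset hKΩ hK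
  have h2 : IntegrableOn (fun y => g y * u y) K := h1.continuousOn_mul hg.continuousOn hK
  refine (integrableOn_iff_integrable_of_support_subset (fun y hy => ?_)).1 h2
  by_contra hyK
  exact hy (by simp [hgK y hyK])

namespace RadialProfile

variable (b : RadialProfile)

lemma mollifier_eq_zero_of_notMem {δ : ℝ} (hδ : 0 < δ) {x y : Plane}
    (hy : y ∉ Metric.closedBall x δ) : b.mollifier δ (x - y) = 0 :=
  b.mollifier_of_le hδ (by
    rw [Metric.mem_closedBall, not_le, dist_comm, dist_eq_norm] at hy; exact hy.le)

lemma kernel_eq_zero_of_notMem {δ : ℝ} (hδ : 0 < δ) {x y : Plane}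
    (hy : y ∉ Metric.closedBall x δ) : b.kernel δ (x - y) = 0 :=
  b.kernel_of_le hδ (by
    rw [Metric.mem_closedBall, not_le, dist_comm, dist_eq_norm] at hy; exact hy.le)

lemma smoothPotential_sub_eq_zero_of_notMem {δ ε : ℝ} (hε : 0 < ε) (hεδ : ε ≤ δ) {x y : Plane}
    (hy : y ∉ Metric.closedBall x δ) :
    b.smoothPotential δ (x - y) - b.smoothPotential ε (x - y) = 0 := by
  rw [Metric.mem_closedBall, not_le, dist_comm, dist_eq_norm] at hy
  rw [b.smoothPotential_of_le (hε.trans_le hεδ) hy.le,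
    b.smoothPotential_of_le hε (hεδ.trans hy.le), sub_self]

lemma continuous_smoothPotential_sub (δ ε : ℝ) (x : Plane) :
    Continuous fun y => b.smoothPotential δ (x - y) - b.smoothPotential ε (x - y) :=
  ((b.contDiff_smoothPotential δ).continuous.comp (continuous_const.sub continuous_id)).sub
    ((b.contDiff_smoothPotential ε).continuous.comp (continuous_const.sub continuous_id))

lemma kernel_sub_kernel {δ ε : ℝ} (hδ : 0 < δ) (hε : 0 < ε) {z : Plane} (hz : z ≠ 0) :
    b.kernel δ z - b.kernel ε z = b.smoothPotential δ z - b.smoothPotential ε z := by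
  rw [b.kernel_of_ne hδ hz, b.kernel_of_ne hε hz]; ring

/-- The mollifications of a distributional solution at two scales differ by the convolution of the
right-hand side with the difference of the two smooth potentials: this difference is an admissible
test function, whose Laplacian is the difference of the mollifiers. -/
lemma integral_mollifier_sub {Ω : Set Plane} {u f : Plane → ℝ} (h : IsDistribSolution Ω u f)
    {x : Plane} {δ ε : ℝ} (hε : 0 < ε) (hεδ : ε ≤ δ) (hx : Metric.closedBall x δ ⊆ Ω) :
    (∫ y in Ω, b.mollifier ε (x - y) * u y) - ∫ y in Ω, b.mollifier δ (x - y) * u y =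
      ∫ y in Ω, (b.smoothPotential δ (x - y) - b.smoothPotential ε (x - y)) * f y := by
  have hδ : 0 < δ := hε.trans_le hεδ
  set η : Plane → ℝ := fun y => b.smoothPotential δ (x - y) - b.smoothPotential ε (x - y) with hη
  have hsm : ∀ δ : ℝ, ContDiff ℝ (⊤ : ℕ∞) fun y => b.smoothPotential δ (x - y) := fun δ =>
    (b.contDiff_smoothPotential δ).comp (contDiff_const.sub contDiff_id)
  have hsupp : tsupport η ⊆ Metric.closedBall x δ := by
    refine closure_minimal (fun y hy => ?_) Metric.isClosed_closedBall
    by_contra hy'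
    exact hy (b.smoothPotential_sub_eq_zero_of_notMem hε hεδ hy')
  have key := h.2.2 η ((hsm δ).sub (hsm ε))
    (HasCompactSupport.of_support_subset_isCompact (isCompact_closedBall x δ)
      ((subset_tsupport η).trans hsupp)) (hsupp.trans hx)
  have hlap : ∀ y, Laplacian.laplacian η y = b.mollifier δ (x - y) - b.mollifier ε (x - y) := by
    intro y
    have h1 : ContDiffAt ℝ 2 (fun y => b.smoothPotential δ (x - y)) y :=
      ((contDiff_infty.1 (hsm δ)) 2).contDiffAt
    have h2 : ContDiffAt ℝ 2 (fun y => b.smoothPotential ε (x - y)) y :=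
      ((contDiff_infty.1 (hsm ε)) 2).contDiffAt
    have := h1.laplacian_sub h2
    rw [b.laplacian_smoothPotential hδ, b.laplacian_smoothPotential hε] at this
    exact this
  have hint : ∀ {ε : ℝ}, 0 < ε → ε ≤ δ →
      IntegrableOn (fun y => b.mollifier ε (x - y) * u y) Ω := fun {ε} hε hεδ =>
    (integrable_mul_of_support_subset h.1
      ((b.continuous_mollifier ε).comp (continuous_const.sub continuous_id))
      (isCompact_closedBall x ε) ((Metric.closedBall_subset_closedBall hεδ).trans hx)
      (fun y hy => b.mollifier_eq_zero_of_notMem hε hy)).integrableOn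
  rw [← integral_sub (hint hε hεδ) (hint hδ le_rfl)]
  calc _ = - ∫ y in Ω, u y * Laplacian.laplacian η y := by
        rw [← integral_neg]
        congr 1; funext y; rw [hlap]; ring
    _ = _ := by rw [key]; congr 1; funext y; ring

/-- Representation formula: a distributional solution of `-Δ u = f` equals almost everywhere its
mollification at scale `δ` plus the convolution of `f` with the truncated logarithmic kernel. -/
theorem ae_eq_integral_add_integral {Ω : Set Plane} {u f : Plane → ℝ}
    (h : IsDistribSolution Ω u f) {p : Plane} {R : ℝ}
    (hp : Metric.closedBall p (2 * R) ⊆ Ω) :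
    ∀ᵐ x ∂(volume.restrict (Metric.ball p R)), ∀ δ : ℝ, 0 < δ → δ ≤ R →
      Integrable (fun y => logKernel δ (x - y) * f y) ∧
      u x = (∫ y in Ω, b.mollifier δ (x - y) * u y) + ∫ y in Ω, b.kernel δ (x - y) * f y := by
  set K := Metric.closedBall p (2 * R) with hK
  have hKc : IsCompact K := isCompact_closedBall _ _
  have hui : Integrable (K.indicator u) := (integrable_indicator_iff hKc.measurableSet).2
    (h.1.integrableOn_compact_subset hp hKc)
  have hfi : Integrable (K.indicator f) := (integrable_indicator_iff hKc.measurableSet).2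
    (h.2.1.integrableOn_compact_subset hp hKc)
  rw [ae_restrict_iff' measurableSet_ball]
  rcases le_or_gt R 0 with hR | hR
  · rw [Metric.ball_eq_empty.2 hR]; simp
  have hleb := (Besicovitch.vitaliFamily (volume : Measure Plane)).ae_tendsto_average_norm_sub
    hui.locallyIntegrable
  have hconv := hfi.ae_convolution_exists (ContinuousLinearMap.lsmul ℝ ℝ) (integrable_logKernel hR)
  filter_upwards [hleb, hconv] with x hx1 hx2 hxp δ hδ hδR
  have hsub : Metric.closedBall x δ ⊆ K := by
    refine Metric.closedBall_subset_closedBall' ?_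
    have := Metric.mem_ball.1 hxp; linarith
  -- outside the closed ball of radius `δ` all kernels vanish, so that `u`, `f` may be cut off
  have hcut : ∀ (g v : Plane → ℝ), (∀ y, y ∉ Metric.closedBall x δ → g y = 0) →
      ∀ y, g y * v y = g y * K.indicator v y := by
    intro g v hg y
    by_cases hy : y ∈ Metric.closedBall x δ
    · rw [indicator_of_mem (hsub hy)]
    · rw [hg y hy, zero_mul, zero_mul]
  have hset : ∀ (g v : Plane → ℝ), (∀ y, y ∉ Metric.closedBall x δ → g y = 0) →
      ∫ y in Ω, g y * v y = ∫ y, g y * K.indicator v y := by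
    intro g v hg
    rw [setIntegral_eq_integral_of_forall_compl_eq_zero]
    · exact integral_congr_ae (Eventually.of_forall (hcut g v hg))
    · intro y hy
      rw [hg y fun hy' => hy (hp (hsub hy')), zero_mul]
  have hLR : Integrable fun y => logKernel R (x - y) * K.indicator f y := by
    refine hx2.congr (Eventually.of_forall fun y => ?_)
    simp [mul_comm]
  have hker : ∀ {g : Plane → ℝ}, Measurable g → (∀ z, ‖g z‖ ≤ logKernel R z) →
      Integrable fun y => g (x - y) * K.indicator f y := by
    intro g hgm hg
    refine hLR.mono ?_ (Eventually.of_forall fun y => ?_)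
    · exact (hgm.comp (measurable_const.sub measurable_id)).aestronglyMeasurable.mul
        hfi.aestronglyMeasurable
    · rw [norm_mul, norm_mul]
      gcongr
      exact (hg _).trans (le_abs_self _)
  have hkle : ∀ {ε : ℝ}, 0 < ε → ε ≤ R → ∀ z, ‖b.kernel ε z‖ ≤ logKernel R z := by
    intro ε hε hεR z
    rw [Real.norm_of_nonneg (b.kernel_nonneg _ _)]
    exact (b.kernel_le hε z).trans (logKernel_mono hε hεR z)
  constructor
  · refine (hker (measurable_logKernel δ) (fun z => ?_)).congr
      (Eventually.of_forall fun y => (hcut (fun y => logKernel δ (x - y)) f (fun y hy => ?_) y).symm)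
    · rw [Real.norm_of_nonneg (logKernel_nonneg _ _)]
      exact logKernel_mono hδ hδR z
    · refine logKernel_of_le hδ ?_
      rw [Metric.mem_closedBall, not_le, dist_comm, dist_eq_norm] at hy; exact hy.le
  let ε : ℕ → ℝ := fun k => δ / (k + 1)
  have hε0 : ∀ k, 0 < ε k := fun k => by positivity
  have hεδ : ∀ k, ε k ≤ δ := fun k => div_le_self hδ.le (by
    have : (0 : ℝ) ≤ k := k.cast_nonneg
    linarith)
  have hεlim : Tendsto ε atTop (𝓝 0) := by
    simpa [ε, div_eq_mul_inv] using tendsto_one_div_add_atTop_nhds_zero_nat.const_mul δ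
  have hεlim' : Tendsto ε atTop (𝓝[>] 0) :=
    tendsto_nhdsWithin_iff.2 ⟨hεlim, Eventually.of_forall hε0⟩
  have hmoll : ∀ k, ∀ y, y ∉ Metric.closedBall x (ε k) → b.mollifier (ε k) (x - y) = 0 :=
    fun k y hy => b.mollifier_eq_zero_of_notMem (hε0 k) hy
  have hmollδ : ∀ k, ∀ y, y ∉ Metric.closedBall x δ → b.mollifier (ε k) (x - y) = 0 :=
    fun k y hy => hmoll k y fun h => hy (Metric.closedBall_subset_closedBall (hεδ k) h)
  have hT1 : Tendsto (fun k => ∫ y, b.mollifier (ε k) (x - y) * K.indicator u y) atTop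
      (𝓝 (K.indicator u x)) := by
    have h1 := (hx1.comp (Besicovitch.tendsto_filterAt volume x)).comp hεlim'
    refine tendsto_integral_smul_of_tendsto_average_norm_sub b.bound h1 ?_ ?_ ?_ ?_
    · exact Eventually.of_forall fun k => hui.integrableOn
    · refine tendsto_const_nhds.congr fun k => ?_
      rw [integral_sub_left_eq_self (b.mollifier (ε k)) volume x, b.integral_mollifier (hε0 k)]
    · refine Eventually.of_forall fun k y hy => ?_
      by_contra hy'
      exact hy (hmoll k y hy')
    · refine Eventually.of_forall fun k y => ?_
      rw [abs_of_nonneg (b.mollifier_nonneg _ _)]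
      refine (b.mollifier_le _ _).trans_eq ?_
      have hv : volume.real (Metric.closedBall x (ε k)) = Real.pi * ε k ^ 2 := by
        rw [measureReal_def, EuclideanSpace.volume_closedBall_fin_two, ENNReal.toReal_mul,
          ENNReal.toReal_pow, ENNReal.toReal_ofReal (hε0 k).le,
          ENNReal.toReal_ofReal Real.pi_pos.le, mul_comm]
      rw [hv, div_eq_mul_inv, mul_comm]
  have hT2 : Tendsto (fun k => ∫ y, b.kernel (ε k) (x - y) * K.indicator f y) atTop (𝓝 0) := by
    have : (0 : ℝ) = ∫ y : Plane, (0 : ℝ) := by simp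
    rw [this]
    refine tendsto_integral_of_dominated_convergence
      (fun y => ‖logKernel R (x - y) * K.indicator f y‖) (fun k => ?_) hLR.norm (fun k => ?_) ?_
    · exact (hker (b.measurable_kernel _) (hkle (hε0 k) ((hεδ k).trans hδR))).aestronglyMeasurable
    · refine Eventually.of_forall fun y => ?_
      rw [norm_mul, norm_mul]
      gcongr
      exact (hkle (hε0 k) ((hεδ k).trans hδR) _).trans (le_abs_self _)
    · have hne : ∀ᵐ y : Plane, y ≠ x := by
        simp [ae_iff, measure_singleton]
      filter_upwards [hne] with y hy
      have hd : 0 < ‖x - y‖ := norm_pos_iff.2 (sub_ne_zero.2 hy.symm)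
      refine tendsto_const_nhds.congr' ?_
      filter_upwards [hεlim.eventually (Iio_mem_nhds hd)] with k hk
      rw [b.kernel_of_le (hε0 k) (le_of_lt hk), zero_mul]
  have hxK : x ∈ K := hsub (Metric.mem_closedBall_self hδ.le)
  rw [indicator_of_mem hxK] at hT1
  rw [hset _ u (fun y hy => b.mollifier_eq_zero_of_notMem hδ hy),
    hset _ f (fun y hy => b.kernel_eq_zero_of_notMem hδ hy)]
  have hid : ∀ k, ∫ y, b.mollifier (ε k) (x - y) * K.indicator u y =
      (∫ y, b.mollifier δ (x - y) * K.indicator u y) +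
        (∫ y, b.kernel δ (x - y) * K.indicator f y) -
        ∫ y, b.kernel (ε k) (x - y) * K.indicator f y := by
    intro k
    have h0 := b.integral_mollifier_sub h (hε0 k) (hεδ k) (hsub.trans hp)
    rw [hset _ u (hmollδ k), hset _ u (fun y hy => b.mollifier_eq_zero_of_notMem hδ hy),
      hset _ f (fun y hy => b.smoothPotential_sub_eq_zero_of_notMem (hε0 k) (hεδ k) hy)] at h0
    rw [add_sub_assoc, ← integral_sub (hker (b.measurable_kernel _) (hkle hδ hδR))
      (hker (b.measurable_kernel _) (hkle (hε0 k) ((hεδ k).trans hδR))), ← sub_eq_iff_eq_add', h0]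
    refine integral_congr_ae ?_
    have hne : ∀ᵐ y : Plane, y ≠ x := by
      simp [ae_iff, measure_singleton]
    filter_upwards [hne] with y hy
    rw [← sub_mul, b.kernel_sub_kernel hδ (hε0 k) (sub_ne_zero.2 hy.symm)]
  refine tendsto_nhds_unique hT1 ?_
  simp_rw [hid]
  simpa using tendsto_const_nhds.sub hT2

end RadialProfile

/-! ### Exponential integrability and local upper bounds -/

/-- The bounds on a single solution `u` of `-Δ u = F + φ` that are used in the local analysis: `F` is
the exponential term, of which only the growth `0 ≤ F ≤ C exp u⁺` and the mass matter. -/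
structure IsAdmissible (Ω : Set Plane) (C : ℝ) (u F φ : Plane → ℝ) : Prop where
  sol : IsDistribSolution Ω u (fun x => F x + φ x)
  nonneg : ∀ᵐ x ∂(volume.restrict Ω), 0 ≤ F x
  le_exp : ∀ᵐ x ∂(volume.restrict Ω), F x ≤ C * Real.exp (max (u x) 0)
  integrableOn : IntegrableOn F Ω
  mass_le : ∫ x in Ω, F x ≤ C
  integrableOn_phi : IntegrableOn φ Ω
  abs_phi_le : ∀ᵐ x ∂(volume.restrict Ω), |φ x| ≤ C
  integrableOn_pos : IntegrableOn (fun x => max (u x) 0) Ω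
  integral_pos_le : ∫ x in Ω, max (u x) 0 ≤ C

lemma IsAdmissible.const_nonneg {Ω : Set Plane} {C : ℝ} {u F φ : Plane → ℝ}
    (h : IsAdmissible Ω C u F φ) : 0 ≤ C :=
  (integral_nonneg_of_ae h.nonneg).trans h.mass_le

/-- The integral of the truncated logarithmic kernel. -/
def logMass (δ : ℝ) : ℝ := ∫ x, logKernel δ x

lemma integrable_logKernel_sub {δ : ℝ} (hδ : 0 < δ) (x : Plane) :
    Integrable fun y => logKernel δ (x - y) := (integrable_logKernel hδ).comp_sub_left x

lemma setIntegral_logKernel_sub_le {δ : ℝ} (hδ : 0 < δ) (x : Plane) (s : Set Plane) :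
    ∫ y in s, logKernel δ (x - y) ≤ logMass δ := by
  refine (setIntegral_le_integral (integrable_logKernel_sub hδ x)
    (Eventually.of_forall fun y => logKernel_nonneg _ _)).trans_eq ?_
  exact integral_sub_left_eq_self (logKernel δ) volume x

/-- Convolving a bounded function with the kernel of scale `δ` gives a bounded function. -/
lemma RadialProfile.abs_setIntegral_kernel_mul_le (b : RadialProfile) {Ω : Set Plane} {D δ : ℝ}
    {f : Plane → ℝ} (hδ : 0 < δ) (x : Plane) (hD : 0 ≤ D)
    (hf : ∀ᵐ y ∂(volume.restrict Ω), y ∈ Metric.closedBall x δ → |f y| ≤ D) :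
    |∫ y in Ω, b.kernel δ (x - y) * f y| ≤ D * logMass δ := by
  have h1 : ‖∫ y in Ω, b.kernel δ (x - y) * f y‖ ≤ ∫ y in Ω, D * logKernel δ (x - y) := by
    refine norm_integral_le_of_norm_le ((integrable_logKernel_sub hδ x).integrableOn.const_mul D) ?_
    filter_upwards [hf] with y hy
    by_cases hyx : y ∈ Metric.closedBall x δ
    · rw [norm_mul, Real.norm_of_nonneg (b.kernel_nonneg _ _), mul_comm]
      exact mul_le_mul (hy hyx) (b.kernel_le hδ _) (b.kernel_nonneg _ _) hD
    · rw [b.kernel_eq_zero_of_notMem hδ hyx, zero_mul, norm_zero]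
      exact mul_nonneg hD (logKernel_nonneg _ _)
  refine h1.trans ?_
  rw [integral_const_mul]
  exact mul_le_mul_of_nonneg_left (setIntegral_logKernel_sub_le hδ x Ω) hD

/-- The representation formula with the contribution of the bounded term estimated. -/
lemma IsAdmissible.ae_abs_sub_le {Ω : Set Plane} {C : ℝ} {u F φ : Plane → ℝ}
    (h : IsAdmissible Ω C u F φ) (b : RadialProfile) {p : Plane} {R : ℝ}
    (hp : Metric.closedBall p (2 * R) ⊆ Ω) :
    ∀ᵐ x ∂(volume.restrict (Metric.ball p R)), ∀ δ : ℝ, 0 < δ → δ ≤ R →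
      IntegrableOn (fun y => logKernel δ (x - y) * F y) Ω ∧
      |u x - (∫ y in Ω, b.mollifier δ (x - y) * u y) - ∫ y in Ω, b.kernel δ (x - y) * F y| ≤
        C * logMass δ := by
  filter_upwards [b.ae_eq_integral_add_integral h.sol hp] with x hx δ hδ hδR
  obtain ⟨h1, h2⟩ := hx δ hδ hδR
  have hmeas : ∀ {g v : Plane → ℝ}, Measurable g → IntegrableOn v Ω →
      AEStronglyMeasurable (fun y => g (x - y) * v y) (volume.restrict Ω) := fun hg hv =>
    (hg.comp (measurable_const.sub measurable_id)).aestronglyMeasurable.mul hv.aestronglyMeasurable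
  have hφ : IntegrableOn (fun y => logKernel δ (x - y) * φ y) Ω := by
    refine Integrable.mono' ((integrable_logKernel_sub hδ x).integrableOn.const_mul C)
      (hmeas (measurable_logKernel δ) h.integrableOn_phi) ?_
    filter_upwards [h.abs_phi_le] with y hy
    rw [norm_mul, Real.norm_of_nonneg (logKernel_nonneg _ _), mul_comm]
    exact mul_le_mul_of_nonneg_right hy (logKernel_nonneg _ _)
  have hF : IntegrableOn (fun y => logKernel δ (x - y) * F y) Ω := by
    refine (h1.integrableOn.sub hφ).congr (Eventually.of_forall fun y => ?_)
    simp only [Pi.sub_apply]; ring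
  have hk : ∀ {v : Plane → ℝ}, IntegrableOn v Ω →
      IntegrableOn (fun y => logKernel δ (x - y) * v y) Ω →
      IntegrableOn (fun y => b.kernel δ (x - y) * v y) Ω := fun hv hlv =>
    Integrable.mono hlv (hmeas (b.measurable_kernel δ) hv) (Eventually.of_forall fun y => by
      rw [norm_mul, norm_mul, Real.norm_of_nonneg (b.kernel_nonneg _ _),
        Real.norm_of_nonneg (logKernel_nonneg _ _)]
      exact mul_le_mul_of_nonneg_right (b.kernel_le hδ _) (norm_nonneg _))
  refine ⟨hF, ?_⟩
  have h3 : ∫ y in Ω, b.kernel δ (x - y) * (F y + φ y) =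
      (∫ y in Ω, b.kernel δ (x - y) * F y) + ∫ y in Ω, b.kernel δ (x - y) * φ y := by
    rw [← integral_add (hk h.integrableOn hF) (hk h.integrableOn_phi hφ)]
    simp only [mul_add]
  rw [h2, h3, add_sub_cancel_left, add_sub_cancel_left]
  exact b.abs_setIntegral_kernel_mul_le hδ x h.const_nonneg
    (h.abs_phi_le.mono fun y hy _ => hy)

/-- The mollification of `u` is bounded above by means of the integral of `u⁺`. -/
lemma IsAdmissible.integral_mollifier_le {Ω : Set Plane} {C : ℝ} {u F φ : Plane → ℝ}
    (h : IsAdmissible Ω C u F φ) (b : RadialProfile) {δ : ℝ} (x : Plane) :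
    ∫ y in Ω, b.mollifier δ (x - y) * u y ≤ (Real.pi * δ ^ 2)⁻¹ * b.bound * C := by
  have hc : 0 ≤ (Real.pi * δ ^ 2)⁻¹ * b.bound :=
    mul_nonneg (by have := Real.pi_pos; positivity) b.bound_pos.le
  by_cases hi : IntegrableOn (fun y => b.mollifier δ (x - y) * u y) Ω
  · refine (integral_mono hi (h.integrableOn_pos.const_mul ((Real.pi * δ ^ 2)⁻¹ * b.bound))
      fun y => ?_).trans ?_
    · calc b.mollifier δ (x - y) * u y ≤ b.mollifier δ (x - y) * max (u y) 0 :=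
            mul_le_mul_of_nonneg_left (le_max_left _ _) (b.mollifier_nonneg _ _)
        _ ≤ _ := mul_le_mul_of_nonneg_right (b.mollifier_le _ _) (le_max_right _ _)
    · rw [integral_const_mul]
      exact mul_le_mul_of_nonneg_left h.integral_pos_le hc
  · rw [integral_undef hi]
    exact mul_nonneg hc h.const_nonneg

/-- Up to a constant depending only on the scale, `u` is bounded above by the logarithmic potential
of `F`. -/
lemma IsAdmissible.ae_le_logKernel {Ω : Set Plane} (hΩ : IsOpen Ω) {C : ℝ} {p : Plane} {r : ℝ}
    (hr : 0 < r) (hp : Metric.closedBall p (2 * r) ⊆ Ω) :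
    ∃ A : ℝ, ∀ u F φ : Plane → ℝ, IsAdmissible Ω C u F φ →
      ∀ᵐ x ∂(volume.restrict (Metric.ball p r)),
        IntegrableOn (fun y => logKernel r (x - y) * F y) (Metric.ball p (2 * r)) ∧
        u x ≤ A + ∫ y in Metric.ball p (2 * r), logKernel r (x - y) * F y := by
  -- any profile would do
  obtain ⟨b, -⟩ := RadialProfile.exists_annular_profile
  refine ⟨(Real.pi * r ^ 2)⁻¹ * b.bound * C + C * logMass r, fun u F φ h => ?_⟩
  have hsub : Metric.ball p (2 * r) ⊆ Ω := Metric.ball_subset_closedBall.trans hp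
  filter_upwards [h.ae_abs_sub_le b hp, ae_restrict_mem measurableSet_ball] with x hx hxp
  obtain ⟨h1, h2⟩ := hx r hr le_rfl
  refine ⟨h1.mono_set hsub, ?_⟩
  have h3 := (abs_le.1 h2).2
  have h4 := h.integral_mollifier_le b (δ := r) x
  have h5 : ∫ y in Ω, b.kernel r (x - y) * F y ≤
      ∫ y in Metric.ball p (2 * r), logKernel r (x - y) * F y := by
    have hzero : ∀ y, y ∉ Metric.ball p (2 * r) → b.kernel r (x - y) = 0 := by
      intro y hy
      refine b.kernel_of_le hr ?_
      rw [Metric.mem_ball, not_lt] at hy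
      have := dist_triangle y x p
      rw [← dist_eq_norm, dist_comm x y]
      linarith [Metric.mem_ball.1 hxp]
    rw [setIntegral_eq_of_subset_of_forall_sdiff_eq_zero hΩ.measurableSet hsub
      (fun y hy => by rw [hzero y hy.2, zero_mul])]
    refine integral_mono_of_nonneg ?_ (h1.mono_set hsub) ?_
    · filter_upwards [ae_restrict_of_ae_restrict_of_subset hsub h.nonneg] with y hy
      exact mul_nonneg (b.kernel_nonneg _ _) hy
    · filter_upwards [ae_restrict_of_ae_restrict_of_subset hsub h.nonneg] with y hy
      exact mul_le_mul_of_nonneg_right (b.kernel_le hr _) hy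
  linarith

/-- Jensen's inequality for the exponential and a measure `F dμ` of total mass at most `m`; the
missing mass is accounted for by the summand `1`. -/
lemma ofReal_exp_integral_le {α : Type*} [MeasurableSpace α] {μ : Measure α} {g F : α → ℝ} {m : ℝ}
    (hm : 0 < m) (hg : AEMeasurable g μ) (hF0 : ∀ᵐ y ∂μ, 0 ≤ F y) (hF : Integrable F μ)
    (hgF : Integrable (fun y => g y * F y) μ) (hmass : ∫ y, F y ∂μ ≤ m) :
    ENNReal.ofReal (Real.exp (∫ y, g y * F y ∂μ)) ≤
      1 + ENNReal.ofReal m⁻¹ * ∫⁻ y, ENNReal.ofReal (Real.exp (m * g y) * F y) ∂μ := by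
  by_cases htop : ∫⁻ y, ENNReal.ofReal (Real.exp (m * g y) * F y) ∂μ = ⊤
  · rw [htop, ENNReal.mul_top (by simpa using hm)]
    simp
  have hnn : ∀ᵐ y ∂μ, 0 ≤ Real.exp (m * g y) * F y := by
    filter_upwards [hF0] with y hy
    positivity
  have hint : Integrable (fun y => Real.exp (m * g y) * F y) μ := by
    refine ⟨?_, ?_⟩
    · exact ((hg.const_mul m).exp.mul hF.aemeasurable).aestronglyMeasurable
    · rw [hasFiniteIntegral_iff_ofReal hnn]
      exact lt_top_iff_ne_top.2 htop
  rw [← ofReal_integral_eq_lintegral_ofReal hint hnn, ← ENNReal.ofReal_mul (by positivity),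
    ← ENNReal.ofReal_one, ← ENNReal.ofReal_add (by norm_num)
      (mul_nonneg (by positivity) (integral_nonneg_of_ae hnn))]
  refine ENNReal.ofReal_le_ofReal ?_
  set A := ∫ y, g y * F y ∂μ with hA
  set θ := ∫ y, F y ∂μ with hθ
  have hθ0 : 0 ≤ θ := integral_nonneg_of_ae hF0
  -- integrate the tangent line inequality for the exponential at the point `A`
  have h1 : Real.exp A * ((1 - A) * θ + m * A) ≤ ∫ y, Real.exp (m * g y) * F y ∂μ := by
    have : ∫ y, Real.exp A * ((1 - A) * F y + m * (g y * F y)) ∂μ =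
        Real.exp A * ((1 - A) * θ + m * A) := by
      rw [integral_const_mul, integral_add (hF.const_mul _) (hgF.const_mul _), integral_const_mul,
        integral_const_mul]
    rw [← this]
    refine integral_mono_ae (((hF.const_mul _).add (hgF.const_mul _)).const_mul _) hint ?_
    filter_upwards [hF0] with y hy
    have h2 : Real.exp A * (1 + (m * g y - A)) ≤ Real.exp (m * g y) := by
      have h3 := Real.add_one_le_exp (m * g y - A)
      have h4 : Real.exp (m * g y) = Real.exp A * Real.exp (m * g y - A) := by
        rw [← Real.exp_add]; congr 1; ring
      rw [h4]
      have := Real.exp_pos A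
      gcongr
      linarith
    nlinarith [mul_le_mul_of_nonneg_right h2 hy]
  have h2 : Real.exp A * (1 - A) ≤ 1 := by
    have h3 := Real.add_one_le_exp (-A)
    have h4 : Real.exp A * Real.exp (-A) = 1 := by rw [← Real.exp_add]; simp
    nlinarith [Real.exp_pos A]
  have h5 : Real.exp A * ((1 - A) * (m⁻¹ * θ) + A) ≤
      m⁻¹ * ∫ y, Real.exp (m * g y) * F y ∂μ := by
    have := mul_le_mul_of_nonneg_left h1 (inv_nonneg.2 hm.le)
    refine le_trans (le_of_eq ?_) this
    field_simp
  have h6 : m⁻¹ * θ ≤ 1 := by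
    rw [inv_mul_le_iff₀ hm]; linarith
  have h7 : 0 ≤ m⁻¹ * θ := by positivity
  nlinarith [mul_le_mul_of_nonneg_left h2 (sub_nonneg.2 h6)]

lemma setLIntegral_comp_sub_le {f : Plane → ENNReal} {x p : Plane}
    {r s t : ℝ} (hx : x ∈ Metric.ball p s) (hst : r + s ≤ t) :
    ∫⁻ y in Metric.ball p r, f (x - y) ≤ ∫⁻ z in Metric.ball 0 t, f z := by
  calc ∫⁻ y in Metric.ball p r, f (x - y)
      ≤ ∫⁻ y, (Metric.ball 0 t).indicator f (x - y) := by
        rw [← lintegral_indicator measurableSet_ball]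
        refine lintegral_mono fun y => ?_
        by_cases hy : y ∈ Metric.ball p r
        · rw [indicator_of_mem hy, indicator_of_mem]
          rw [mem_ball_zero_iff, ← dist_eq_norm]
          have := dist_triangle x p y
          rw [dist_comm p y] at this
          linarith [Metric.mem_ball.1 hx, Metric.mem_ball.1 hy]
        · rw [indicator_of_notMem hy]; exact zero_le
    _ = ∫⁻ z in Metric.ball 0 t, f z := by
        rw [lintegral_sub_left_eq_self (fun z => (Metric.ball 0 t).indicator f z) x,
          lintegral_indicator measurableSet_ball]

lemma setLIntegral_exp_logKernel_lt_top {δ a : ℝ} (hδ : 0 < δ) (ha : 0 ≤ a)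
    (ha' : a < 4 * Real.pi) (R : ℝ) :
    ∫⁻ z in Metric.ball (0 : Plane) R, ENNReal.ofReal (Real.exp (a * logKernel δ z)) < ⊤ :=
  (hasFiniteIntegral_iff_ofReal (Eventually.of_forall fun _ => (Real.exp_pos _).le)).1
    (integrableOn_exp_logKernel hδ ha ha' R).2

/-- The Brezis–Merle inequality: if the mass of `F` on a ball is at most `m` and `q m < 4π`, then
`exp (q u)` is integrable on the concentric ball of half the radius, with a uniform bound. -/
lemma IsAdmissible.exists_setLIntegral_exp_le {Ω : Set Plane} (hΩ : IsOpen Ω) {C : ℝ} {p : Plane}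
    {r m q : ℝ} (hr : 0 < r) (hp : Metric.closedBall p (2 * r) ⊆ Ω) (hm : 0 < m) (hq : 0 < q)
    (hqm : q * m < 4 * Real.pi) :
    ∃ E : ENNReal, E < ⊤ ∧ ∀ u F φ : Plane → ℝ, IsAdmissible Ω C u F φ →
      ∫ y in Metric.ball p (2 * r), F y ≤ m →
      ∫⁻ x in Metric.ball p r, ENNReal.ofReal (Real.exp (q * u x)) ≤ E := by
  obtain ⟨A, hA⟩ := IsAdmissible.ae_le_logKernel (C := C) hΩ hr hp
  set J : ENNReal := ∫⁻ z in Metric.ball (0 : Plane) (3 * r),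
    ENNReal.ofReal (Real.exp (q * m * logKernel r z)) with hJ
  have hJtop : J < ⊤ := setLIntegral_exp_logKernel_lt_top hr (by positivity) hqm _
  refine ⟨ENNReal.ofReal (Real.exp (q * A)) *
    (volume (Metric.ball p r) + ENNReal.ofReal m⁻¹ * (J * ENNReal.ofReal m)), ?_, ?_⟩
  · refine ENNReal.mul_lt_top ENNReal.ofReal_lt_top (ENNReal.add_lt_top.2 ⟨measure_ball_lt_top, ?_⟩)
    exact ENNReal.mul_lt_top ENNReal.ofReal_lt_top (ENNReal.mul_lt_top hJtop ENNReal.ofReal_lt_top)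
  intro u F φ h hmass
  have hsub : Metric.ball p (2 * r) ⊆ Ω := Metric.ball_subset_closedBall.trans hp
  have hF0 : ∀ᵐ y ∂(volume.restrict (Metric.ball p (2 * r))), 0 ≤ F y :=
    ae_restrict_of_ae_restrict_of_subset hsub h.nonneg
  have hFi : IntegrableOn F (Metric.ball p (2 * r)) := h.integrableOn.mono_set hsub
  have hLm : Measurable (logKernel r) := measurable_logKernel r
  have hkey : ∀ᵐ x ∂(volume.restrict (Metric.ball p r)), ENNReal.ofReal (Real.exp (q * u x)) ≤
      ENNReal.ofReal (Real.exp (q * A)) * (1 + ENNReal.ofReal m⁻¹ *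
        ∫⁻ y in Metric.ball p (2 * r),
          ENNReal.ofReal (Real.exp (m * (q * logKernel r (x - y))) * F y)) := by
    filter_upwards [hA u F φ h] with x hx
    have h1 := ofReal_exp_integral_le (μ := volume.restrict (Metric.ball p (2 * r)))
      (g := fun y => q * logKernel r (x - y)) hm
      ((hLm.comp (measurable_const.sub measurable_id)).const_mul q).aemeasurable hF0 hFi
      (by simpa only [mul_assoc] using hx.1.const_mul q) hmass
    refine le_trans ?_ (mul_le_mul_right h1 _)
    rw [← ENNReal.ofReal_mul (Real.exp_pos _).le, ← Real.exp_add]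
    refine ENNReal.ofReal_le_ofReal (Real.exp_le_exp.2 ?_)
    simp only [mul_assoc]
    rw [integral_const_mul, ← mul_add]
    exact mul_le_mul_of_nonneg_left hx.2 hq.le
  refine (lintegral_mono_ae hkey).trans ?_
  rw [lintegral_const_mul' _ _ ENNReal.ofReal_ne_top]
  refine mul_le_mul_right ?_ _
  rw [lintegral_add_left measurable_const, lintegral_const_mul' _ _ ENNReal.ofReal_ne_top]
  simp only [lintegral_const, Measure.restrict_apply_univ, one_mul]
  refine add_le_add le_rfl (mul_le_mul_right ?_ _)
  rw [lintegral_lintegral_swap]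
  · calc ∫⁻ y in Metric.ball p (2 * r), ∫⁻ x in Metric.ball p r,
          ENNReal.ofReal (Real.exp (m * (q * logKernel r (x - y))) * F y)
        ≤ ∫⁻ y in Metric.ball p (2 * r), J * ENNReal.ofReal (F y) := by
          refine setLIntegral_mono_ae' measurableSet_ball (Eventually.of_forall fun y hy => ?_)
          simp only [ENNReal.ofReal_mul (Real.exp_pos _).le]
          rw [lintegral_mul_const']
          · refine mul_le_mul_left ?_ _
            have h2 : ∀ x, logKernel r (x - y) = logKernel r (y - x) := fun x => by
              rw [logKernel, logKernel, norm_sub_rev]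
            simp only [h2]
            refine le_trans (le_of_eq ?_) (setLIntegral_comp_sub_le
              (f := fun z => ENNReal.ofReal (Real.exp (q * m * logKernel r z)))
              hy (show r + 2 * r ≤ 3 * r by linarith))
            refine lintegral_congr fun x => ?_
            congr 2; ring
          · exact ENNReal.ofReal_ne_top
      _ = J * ∫⁻ y in Metric.ball p (2 * r), ENNReal.ofReal (F y) := by
          rw [lintegral_const_mul' _ _ hJtop.ne]
      _ ≤ J * ENNReal.ofReal m := by
          rw [← ofReal_integral_eq_lintegral_ofReal hFi hF0]
          exact mul_le_mul_right (ENNReal.ofReal_le_ofReal hmass) _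
  · have h1 : Measurable fun z : Plane × Plane => Real.exp (m * (q * logKernel r (z.1 - z.2))) := by
      fun_prop
    have h2 : AEMeasurable (fun z : Plane × Plane => F z.2)
        ((volume.restrict (Metric.ball p r)).prod (volume.restrict (Metric.ball p (2 * r)))) :=
      hFi.aemeasurable.comp_snd
    exact (h1.aemeasurable.mul h2).ennreal_ofReal

/-- A Young type inequality, proved by comparing `a` with `exp (u / k)`. -/
lemma mul_exp_le {a u : ℝ} (ha : 0 ≤ a) {k : ℕ} (hk : 0 < k) :
    a * Real.exp u ≤ Real.exp ((1 + 1 / (k : ℝ)) * u) + (k + 1).factorial * Real.exp a := by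
  have hk' : (0 : ℝ) < k := by exact_mod_cast hk
  rcases le_or_gt a (Real.exp (1 / (k : ℝ) * u)) with h | h
  · have : a * Real.exp u ≤ Real.exp ((1 + 1 / (k : ℝ)) * u) := by
      rw [add_mul, Real.exp_add, one_mul, mul_comm]
      gcongr
    have : 0 ≤ ((k + 1).factorial : ℝ) * Real.exp a := by positivity
    linarith
  · have h1 : Real.exp u ≤ a ^ k := by
      have : Real.exp u = Real.exp (1 / (k : ℝ) * u) ^ k := by
        rw [← Real.exp_nat_mul]; congr 1; field_simp
      rw [this]
      gcongr
    have h2 : a ^ (k + 1) ≤ (k + 1).factorial * Real.exp a := by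
      have := Real.pow_div_factorial_le_exp a ha (k + 1)
      rwa [div_le_iff₀ (by positivity), mul_comm] at this
    have h3 : a * Real.exp u ≤ a ^ (k + 1) := by
      rw [pow_succ, mul_comm]
      gcongr
    have := Real.exp_pos ((1 + 1 / (k : ℝ)) * u)
    linarith

/-- If the mass of `F` on a ball is at most `m < 4π`, then `u` is bounded above near the centre: by
the Brezis–Merle inequality `exp (q u)` is integrable for some `q > 1`, and `F` grows at most like
`exp u`, so that its logarithmic potential is bounded. -/
theorem IsAdmissible.exists_ae_le {Ω : Set Plane} (hΩ : IsOpen Ω) {C : ℝ} {p : Plane}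
    {r m : ℝ} (hr : 0 < r) (hp : Metric.closedBall p (2 * r) ⊆ Ω) (hm : 0 < m)
    (hm' : m < 4 * Real.pi) :
    ∃ M : ℝ, ∀ u F φ : Plane → ℝ, IsAdmissible Ω C u F φ →
      ∫ y in Metric.ball p (2 * r), F y ≤ m →
      ∀ᵐ x ∂(volume.restrict (Metric.ball p (r / 2))), u x ≤ M := by
  -- the exponent `q = 1 + 1 / k` is subcritical for the mass `m`
  obtain ⟨k, hk⟩ := exists_nat_gt (m / (4 * Real.pi - m))
  have hk' : (0 : ℝ) < k := lt_of_le_of_lt (div_nonneg hm.le (by linarith)) hk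
  have hk0 : 0 < k := by exact_mod_cast hk'
  have hq : (1 + 1 / (k : ℝ)) * m < 4 * Real.pi := by
    rw [div_lt_iff₀ (by linarith)] at hk
    have : 1 / (k : ℝ) * m < 4 * Real.pi - m := by
      rw [one_div, inv_mul_lt_iff₀ hk']; exact hk
    linarith
  obtain ⟨E, hE, hEb⟩ := IsAdmissible.exists_setLIntegral_exp_le (C := C) hΩ hr hp hm
    (by positivity : 0 < 1 + 1 / (k : ℝ)) hq
  have hr2 : 0 < r / 2 := by positivity
  have hp2 : Metric.closedBall p (2 * (r / 2)) ⊆ Ω :=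
    (Metric.closedBall_subset_closedBall (by linarith)).trans hp
  obtain ⟨A, hA⟩ := IsAdmissible.ae_le_logKernel (C := C) hΩ hr2 hp2
  set J : ENNReal := ∫⁻ z in Metric.ball (0 : Plane) (2 * r),
    ENNReal.ofReal (Real.exp (1 * logKernel (r / 2) z)) with hJ
  have hJtop : J < ⊤ := setLIntegral_exp_logKernel_lt_top hr2 zero_le_one
    (by linarith [Real.pi_gt_three]) _
  set c : ℝ := (k + 1).factorial + 1 with hc
  have hc0 : 0 ≤ c := by positivity
  set T : ENNReal := ENNReal.ofReal C * (ENNReal.ofReal c * J + E) with hT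
  have hTtop : T < ⊤ := ENNReal.mul_lt_top ENNReal.ofReal_lt_top
    (ENNReal.add_lt_top.2 ⟨ENNReal.mul_lt_top ENNReal.ofReal_lt_top hJtop, hE⟩)
  refine ⟨A + T.toReal, fun u F φ h hmass => ?_⟩
  have hC := h.const_nonneg
  have hsub : Metric.ball p r ⊆ Ω :=
    (Metric.ball_subset_closedBall.trans (Metric.closedBall_subset_closedBall (by linarith))).trans
      hp
  have hA' := hA u F φ h
  rw [show 2 * (r / 2) = r by ring] at hA'
  filter_upwards [hA', ae_restrict_mem measurableSet_ball] with x hx hxp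
  refine hx.2.trans (add_le_add le_rfl ?_)
  refine ENNReal.ofReal_le_iff_le_toReal hTtop.ne |>.1 ?_
  have hF0 := ae_restrict_of_ae_restrict_of_subset hsub h.nonneg
  have hFe := ae_restrict_of_ae_restrict_of_subset hsub h.le_exp
  rw [ofReal_integral_eq_lintegral_ofReal hx.1
    (hF0.mono fun y hy => mul_nonneg (logKernel_nonneg _ _) hy)]
  calc ∫⁻ y in Metric.ball p r, ENNReal.ofReal (logKernel (r / 2) (x - y) * F y)
      ≤ ∫⁻ y in Metric.ball p r, ENNReal.ofReal C * (ENNReal.ofReal c *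
          ENNReal.ofReal (Real.exp (1 * logKernel (r / 2) (x - y))) +
          ENNReal.ofReal (Real.exp ((1 + 1 / (k : ℝ)) * u y))) := by
        refine lintegral_mono_ae ?_
        filter_upwards [hFe] with y hy
        rw [← ENNReal.ofReal_mul hc0, ← ENNReal.ofReal_add (by positivity) (by positivity),
          ← ENNReal.ofReal_mul hC]
        refine ENNReal.ofReal_le_ofReal ?_
        set a := logKernel (r / 2) (x - y) with ha
        have ha0 : 0 ≤ a := logKernel_nonneg _ _
        have h1 := mul_exp_le (u := u y) ha0 hk0
        have h2 : a ≤ Real.exp a := by linarith [Real.add_one_le_exp a]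
        have h3 : Real.exp (max (u y) 0) ≤ 1 + Real.exp (u y) := by
          rcases le_total (u y) 0 with h | h
          · rw [max_eq_right h, Real.exp_zero]; linarith [Real.exp_pos (u y)]
          · rw [max_eq_left h]; linarith
        calc a * F y ≤ a * (C * (1 + Real.exp (u y))) := by
              gcongr
              exact hy.trans (by gcongr)
          _ = C * (a + a * Real.exp (u y)) := by ring
          _ ≤ _ := by
              rw [one_mul, hc]
              refine mul_le_mul_of_nonneg_left ?_ hC
              linarith
    _ = ENNReal.ofReal C * ((ENNReal.ofReal c *
          ∫⁻ y in Metric.ball p r, ENNReal.ofReal (Real.exp (1 * logKernel (r / 2) (x - y)))) +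
          ∫⁻ y in Metric.ball p r, ENNReal.ofReal (Real.exp ((1 + 1 / (k : ℝ)) * u y))) := by
        have hm := (measurable_logKernel (r / 2))
        rw [lintegral_const_mul' _ _ ENNReal.ofReal_ne_top, lintegral_add_left (by fun_prop),
          lintegral_const_mul' _ _ ENNReal.ofReal_ne_top]
    _ ≤ T := by
        have hm := (measurable_logKernel (r / 2))
        refine mul_le_mul_right (add_le_add (mul_le_mul_right ?_ _) (hEb u F φ h hmass)) _
        exact setLIntegral_comp_sub_le
          (f := fun z => ENNReal.ofReal (Real.exp (1 * logKernel (r / 2) z))) hxp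
          (by linarith)

/-! ### Harnack inequality and the dichotomy in the absence of concentration -/

/-- If the integrands are bounded above on a compact set, so are the exponential terms. -/
lemma exists_ae_abs_rhs_le {Ω : Set Plane} {C : ℝ} {u F φ : ℕ → Plane → ℝ}
    (h : ∀ n, IsAdmissible Ω C (u n) (F n) (φ n)) (hub : LocUniformBddAbove Ω u)
    {K : Set Plane} (hK : IsCompact K) (hKΩ : K ⊆ Ω) :
    ∃ D : ℝ, 0 ≤ D ∧ ∀ n, ∀ᵐ x ∂(volume.restrict K), |F n x + φ n x| ≤ D := by
  obtain ⟨M, hM⟩ := hub K hK hKΩ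
  have hC := (h 0).const_nonneg
  refine ⟨C * Real.exp (max M 0) + C, by positivity, fun n => ?_⟩
  filter_upwards [hM n, ae_restrict_of_ae_restrict_of_subset hKΩ (h n).nonneg,
    ae_restrict_of_ae_restrict_of_subset hKΩ (h n).le_exp,
    ae_restrict_of_ae_restrict_of_subset hKΩ (h n).abs_phi_le] with x h1 h2 h3 h4
  refine (abs_add_le _ _).trans (add_le_add ?_ h4)
  rw [abs_of_nonneg h2]
  refine h3.trans ?_
  gcongr

lemma RadialProfile.setIntegral_mollifier_eq_one (b : RadialProfile) {Ω : Set Plane} {x : Plane}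
    {δ : ℝ} (hδ : 0 < δ) (hx : Metric.closedBall x δ ⊆ Ω) :
    ∫ y in Ω, b.mollifier δ (x - y) = 1 := by
  rw [setIntegral_eq_integral_of_forall_compl_eq_zero
    (fun y hy => b.mollifier_eq_zero_of_notMem hδ fun h => hy (hx h)),
    integral_sub_left_eq_self (b.mollifier δ) volume x, b.integral_mollifier hδ]

/-- Harnack inequality in integral form: near each point, `-u n` is comparable, up to additive
constants, with the integral `I n` of `M - u n ≥ 0` over a fixed ball. -/
lemma exists_harnack {Ω : Set Plane} (hΩ : IsOpen Ω) {C : ℝ} {u F φ : ℕ → Plane → ℝ}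
    (h : ∀ n, IsAdmissible Ω C (u n) (F n) (φ n)) (hub : LocUniformBddAbove Ω u)
    {p : Plane} (hp : p ∈ Ω) :
    ∃ ρ > 0, ∃ (I : ℕ → ℝ) (A B A' B' : ℝ), 0 < B ∧ 0 < B' ∧
      ∀ n, ∀ᵐ x ∂(volume.restrict (Metric.ball p ρ)),
        -u n x ≤ A + B * I n ∧ I n ≤ A' - B' * u n x := by
  obtain ⟨b, β, hβ, hb⟩ := RadialProfile.exists_ball_profile
  obtain ⟨s, hs, hsΩ⟩ := Metric.nhds_basis_closedBall.mem_iff.1 (hΩ.mem_nhds hp)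
  set δ := s / 12 with hδs
  have hδ : 0 < δ := by positivity
  have hball : Metric.closedBall p (2 * (6 * δ)) ⊆ Ω := by
    rwa [show 2 * (6 * δ) = s by rw [hδs]; ring]
  have hKc : IsCompact (Metric.closedBall p (2 * (6 * δ))) := isCompact_closedBall _ _
  obtain ⟨M, hM⟩ := hub _ hKc hball
  obtain ⟨D, hD, hDf⟩ := exists_ae_abs_rhs_le h hub hKc hball
  have hpi := Real.pi_pos
  set c₁ := (Real.pi * δ ^ 2)⁻¹ * b.bound with hc₁
  set c₂ := (Real.pi * (6 * δ) ^ 2)⁻¹ * β with hc₂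
  have hc₁0 : 0 < c₁ := mul_pos (by positivity) b.bound_pos
  have hc₂0 : 0 < c₂ := by positivity
  have hsub2 : Metric.ball p (2 * δ) ⊆ Ω := fun y hy => hball (by
    rw [Metric.mem_closedBall]; linarith [Metric.mem_ball.1 hy])
  refine ⟨δ, hδ, fun n => ∫ y in Metric.ball p (2 * δ), (M - u n y), D * logMass δ - M, c₁,
    (M + D * logMass (6 * δ)) / c₂, 1 / c₂, hc₁0, by positivity, fun n => ?_⟩
  have hrep := ae_restrict_of_ae_restrict_of_subset
    (Metric.ball_subset_ball (by linarith : δ ≤ 6 * δ))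
    (b.ae_eq_integral_add_integral (h n).sol hball)
  have hloc : LocallyIntegrableOn (fun y => M - u n y) Ω :=
    (locallyIntegrableOn_const M).sub (h n).sol.1
  have hf : ∀ᵐ y ∂(volume.restrict Ω), y ∈ Metric.closedBall p (2 * (6 * δ)) →
      |F n y + φ n y| ≤ D :=
    ae_restrict_of_ae ((ae_restrict_iff' hKc.measurableSet).1 (hDf n))
  have hMn : ∀ᵐ y ∂(volume.restrict Ω), y ∈ Metric.closedBall p (2 * (6 * δ)) → u n y ≤ M :=
    ae_restrict_of_ae ((ae_restrict_iff' hKc.measurableSet).1 (hM n))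
  filter_upwards [hrep, ae_restrict_mem measurableSet_ball] with x hx hxp
  have hxp' := Metric.mem_ball.1 hxp
  -- the representation formula for `M - u n` at the scales `δ` and `6 δ`
  have hmain : ∀ δ', 0 < δ' → δ' ≤ 6 * δ →
      IntegrableOn (fun y => b.mollifier δ' (x - y) * (M - u n y)) Ω ∧
      |M - u n x - ∫ y in Ω, b.mollifier δ' (x - y) * (M - u n y)| ≤ D * logMass δ' := by
    intro δ' h0 h6
    have hxsub : Metric.closedBall x δ' ⊆ Metric.closedBall p (2 * (6 * δ)) :=
      Metric.closedBall_subset_closedBall' (by linarith)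
    have hcont : Continuous fun y => b.mollifier δ' (x - y) :=
      (b.continuous_mollifier δ').comp (continuous_const.sub continuous_id)
    have hi : ∀ {v : Plane → ℝ}, LocallyIntegrableOn v Ω →
        IntegrableOn (fun y => b.mollifier δ' (x - y) * v y) Ω := fun hv =>
      (integrable_mul_of_support_subset hv hcont (isCompact_closedBall x δ')
        (hxsub.trans hball) fun y hy => b.mollifier_eq_zero_of_notMem h0 hy).integrableOn
    refine ⟨hi hloc, ?_⟩
    have h1 : ∫ y in Ω, b.mollifier δ' (x - y) * (M - u n y) =
        M - ∫ y in Ω, b.mollifier δ' (x - y) * u n y := by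
      simp only [mul_sub]
      rw [integral_sub (hi (locallyIntegrableOn_const M)) (hi (h n).sol.1), integral_mul_const,
        b.setIntegral_mollifier_eq_one h0 (hxsub.trans hball), one_mul]
    have h2 := b.abs_setIntegral_kernel_mul_le (Ω := Ω) (f := fun y => F n y + φ n y) h0 x hD
      (hf.mono fun y hy hyx => hy (hxsub hyx))
    rw [h1, (hx δ' h0 h6).2, ← abs_neg]
    convert h2 using 2
    ring
  have hw2 : ∀ᵐ y ∂(volume.restrict (Metric.ball p (2 * δ))), 0 ≤ M - u n y := by
    filter_upwards [ae_restrict_of_ae_restrict_of_subset hsub2 hMn,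
      ae_restrict_mem measurableSet_ball] with y hy hyp
    linarith [hy (by rw [Metric.mem_closedBall]; linarith [Metric.mem_ball.1 hyp])]
  have hIi : IntegrableOn (fun y => M - u n y) (Metric.ball p (2 * δ)) :=
    (hloc.integrableOn_compact_subset hball hKc).mono_set fun y hy => by
      rw [Metric.mem_closedBall]; linarith [Metric.mem_ball.1 hy]
  constructor
  · obtain ⟨h1, h2⟩ := hmain δ hδ (by linarith)
    have h3 : ∫ y in Ω, b.mollifier δ (x - y) * (M - u n y) ≤
        c₁ * ∫ y in Metric.ball p (2 * δ), (M - u n y) := by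
      rw [setIntegral_eq_of_subset_of_forall_sdiff_eq_zero hΩ.measurableSet hsub2, ←
        integral_const_mul]
      · refine integral_mono_ae (h1.mono_set hsub2) (hIi.const_mul _) ?_
        filter_upwards [hw2] with y hy
        exact mul_le_mul_of_nonneg_right (b.mollifier_le _ _) hy
      · intro y hy
        rw [b.mollifier_of_le hδ, zero_mul]
        have h4 := hy.2
        rw [Metric.mem_ball, not_lt] at h4
        have := dist_triangle y x p
        rw [← dist_eq_norm, dist_comm x y]
        linarith
    have := (abs_le.1 h2).2
    linarith
  -- at the scale `6 δ` the mollifier of `x` is bounded below on the whole ball of radius `2 δ`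
  · obtain ⟨h1, h2⟩ := hmain (6 * δ) (by positivity) le_rfl
    have h3 : c₂ * ∫ y in Metric.ball p (2 * δ), (M - u n y) ≤
        ∫ y in Ω, b.mollifier (6 * δ) (x - y) * (M - u n y) := by
      calc c₂ * ∫ y in Metric.ball p (2 * δ), (M - u n y)
          ≤ ∫ y in Metric.ball p (2 * δ), b.mollifier (6 * δ) (x - y) * (M - u n y) := by
            rw [← integral_const_mul]
            refine integral_mono_ae (hIi.const_mul _) (h1.mono_set hsub2) ?_
            filter_upwards [hw2, ae_restrict_mem measurableSet_ball] with y hy hyp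
            refine mul_le_mul_of_nonneg_right ?_ hy
            refine mul_le_mul_of_nonneg_left (hb _ ?_) (by positivity)
            have h4 : ‖x - y‖ ≤ 3 * δ := by
              rw [← dist_eq_norm]
              have := dist_triangle x p y
              rw [dist_comm p y] at this
              linarith [Metric.mem_ball.1 hyp]
            rw [div_le_iff₀ (by positivity)]
            calc ‖x - y‖ ^ 2 ≤ (3 * δ) ^ 2 := by gcongr
              _ = 1 / 4 * (6 * δ) ^ 2 := by ring
        _ ≤ _ := by
            refine setIntegral_mono_set h1 ?_ hsub2.eventuallyLE
            filter_upwards [hMn] with y hy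
            by_cases hyx : y ∈ Metric.closedBall x (6 * δ)
            · refine mul_nonneg (b.mollifier_nonneg _ _) ?_
              have := hy (Metric.closedBall_subset_closedBall' (by linarith) hyx)
              linarith
            · rw [b.mollifier_eq_zero_of_notMem (by positivity) hyx, zero_mul]; simp
    have h4 := (abs_le.1 h2).1
    have h5 : c₂ * ∫ y in Metric.ball p (2 * δ), (M - u n y) ≤
        M + D * logMass (6 * δ) - u n x := by linarith
    rw [← le_div_iff₀' hc₂0] at h5
    refine h5.trans_eq ?_
    ring

/-- By connectedness, the local Harnack inequalities compare `-u n` near every point with one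
numerical sequence. -/
lemma exists_comparison {Ω : Set Plane} (hΩ : IsOpen Ω) (hΩc : IsConnected Ω) {C : ℝ}
    {u F φ : ℕ → Plane → ℝ} (h : ∀ n, IsAdmissible Ω C (u n) (F n) (φ n))
    (hub : LocUniformBddAbove Ω u) :
    ∃ t : ℕ → ℝ, ∀ p ∈ Ω, ∃ ρ > 0, ∃ A B A' B' : ℝ, 0 < B ∧ 0 < B' ∧
      ∀ n, ∀ᵐ x ∂(volume.restrict (Metric.ball p ρ)),
        -u n x ≤ A + B * t n ∧ t n ≤ A' - B' * u n x := by
  obtain ⟨p₀, hp₀⟩ := hΩc.nonempty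
  obtain ⟨ρ₀, hρ₀, t, ht⟩ := exists_harnack hΩ h hub hp₀
  refine ⟨t, ?_⟩
  set E : Set Plane := {p | ∃ ρ > 0, ∃ A B A' B' : ℝ, 0 < B ∧ 0 < B' ∧
      ∀ n, ∀ᵐ x ∂(volume.restrict (Metric.ball p ρ)),
        -u n x ≤ A + B * t n ∧ t n ≤ A' - B' * u n x} with hE
  have hEo : IsOpen E := by
    rw [Metric.isOpen_iff]
    rintro p ⟨ρ, hρ, A, B, A', B', hB, hB', hp⟩
    refine ⟨ρ / 2, by positivity, fun q hq => ⟨ρ / 2, by positivity, A, B, A', B', hB, hB',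
      fun n => ae_restrict_of_ae_restrict_of_subset ?_ (hp n)⟩⟩
    exact Metric.ball_subset_ball' (by linarith [Metric.mem_ball.1 hq])
  refine hΩc.isPreconnected.subset_of_closure_inter_subset hEo ⟨p₀, hp₀, ρ₀, hρ₀, ht⟩ ?_
  rintro p ⟨hpE, hpΩ⟩
  obtain ⟨σ, hσ, I, a, c, a', c', hc, hc', hI⟩ := exists_harnack hΩ h hub hpΩ
  obtain ⟨q, ⟨ρ, hρ, A, B, A', B', hB, hB', hq⟩, hpq⟩ := Metric.mem_closure_iff.1 hpE σ hσ
  have hqσ : q ∈ Metric.ball p σ := by rwa [Metric.mem_ball, dist_comm]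
  -- a common point of the two balls transfers the comparison
  have hpt : ∀ n, ∃ x, (-u n x ≤ a + c * I n ∧ I n ≤ a' - c' * u n x) ∧
      (-u n x ≤ A + B * t n ∧ t n ≤ A' - B' * u n x) := by
    intro n
    have ho : IsOpen (Metric.ball p σ ∩ Metric.ball q ρ) := Metric.isOpen_ball.inter
      Metric.isOpen_ball
    have hne : (ae (volume.restrict (Metric.ball p σ ∩ Metric.ball q ρ))).NeBot := by
      rw [ae_neBot]
      intro h0
      rw [Measure.restrict_eq_zero] at h0
      exact (ho.measure_pos volume ⟨q, hqσ, Metric.mem_ball_self hρ⟩).ne' h0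
    exact ((ae_restrict_of_ae_restrict_of_subset inter_subset_left (hI n)).and
      (ae_restrict_of_ae_restrict_of_subset inter_subset_right (hq n))).exists
  refine ⟨σ, hσ, a + c * a' + c * c' * A, c * c' * B, A' + B' * a + B' * c * a', B' * c * c',
    by positivity, by positivity, fun n => ?_⟩
  obtain ⟨x, ⟨h1, h2⟩, h3, h4⟩ := hpt n
  filter_upwards [hI n] with y hy
  constructor
  · have h5 : I n ≤ a' + c' * (A + B * t n) := by nlinarith
    nlinarith [hy.1, mul_le_mul_of_nonneg_left h5 hc.le]
  · have h5 : t n ≤ A' + B' * (a + c * I n) := by nlinarith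
    have h6 := mul_le_mul_of_nonneg_left hy.2 (mul_pos hB' hc).le
    nlinarith

/-- If the `u n` are locally bounded above, then they tend to `-∞` locally uniformly, or a
subsequence is locally bounded. -/
lemma tendsto_negInfty_or_exists_bddBelow {Ω : Set Plane} (hΩ : IsOpen Ω) (hΩc : IsConnected Ω)
    {C : ℝ} {u F φ : ℕ → Plane → ℝ} (h : ∀ n, IsAdmissible Ω C (u n) (F n) (φ n))
    (hub : LocUniformBddAbove Ω u) :
    TendstoLocUniformNegInfty Ω u ∨
      ∃ k : ℕ → ℕ, StrictMono k ∧ LocUniformBddBelow Ω (fun j => u (k j)) := by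
  obtain ⟨t, ht⟩ := exists_comparison hΩ hΩc h hub
  by_cases hlim : Tendsto t atTop atTop
  · left
    intro K hK hKΩ M
    refine hK.induction_on (p := fun s => ∀ᶠ n in atTop, ∀ᵐ x ∂(volume.restrict s), u n x < M)
      (by simp) (fun s s' hs h' => h'.mono fun n hn => ae_restrict_of_ae_restrict_of_subset hs hn)
      (fun s s' h1 h2 => (h1.and h2).mono fun n hn => (ae_restrict_union_iff _ _ _).2 hn)
      fun p hp => ?_
    obtain ⟨ρ, hρ, A, B, A', B', hB, hB', hx⟩ := ht p (hKΩ hp)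
    refine ⟨Metric.ball p ρ, mem_nhdsWithin_of_mem_nhds (Metric.ball_mem_nhds p hρ), ?_⟩
    filter_upwards [hlim.eventually_gt_atTop (A' - B' * M)] with n hn
    filter_upwards [hx n] with x hxn
    nlinarith [hxn.2]
  · right
    rw [tendsto_atTop] at hlim
    push Not at hlim
    obtain ⟨c, hc⟩ := hlim
    obtain ⟨k, hk, hkc⟩ := extraction_of_frequently_atTop hc
    refine ⟨k, hk, fun K hK hKΩ => ?_⟩
    refine hK.induction_on
      (p := fun s => ∃ M : ℝ, ∀ n, ∀ᵐ x ∂(volume.restrict s), M ≤ u (k n) x)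
      ⟨0, by simp⟩
      (fun s s' hs ⟨M, hM⟩ => ⟨M, fun n => ae_restrict_of_ae_restrict_of_subset hs (hM n)⟩)
      (fun s s' ⟨M, hM⟩ ⟨M', hM'⟩ => ⟨min M M', fun n => (ae_restrict_union_iff _ _ _).2
        ⟨(hM n).mono fun x hx => (min_le_left _ _).trans hx,
          (hM' n).mono fun x hx => (min_le_right _ _).trans hx⟩⟩)
      fun p hp => ?_
    obtain ⟨ρ, hρ, A, B, A', B', hB, hB', hx⟩ := ht p (hKΩ hp)
    refine ⟨Metric.ball p ρ, mem_nhdsWithin_of_mem_nhds (Metric.ball_mem_nhds p hρ),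
      -(A + B * c), fun n => ?_⟩
    filter_upwards [hx (k n)] with x hxn
    nlinarith [hxn.1, hkc n]

/-! ### Compactness of locally bounded sequences -/

/-- The Arzelà–Ascoli theorem, in sequential form, on a locally compact space. -/
lemma exists_subseq_tendsto_of_equicontinuous {X : Type*} [TopologicalSpace X]
    [LocallyCompactSpace X] [SigmaCompactSpace X] (G : ℕ → C(X, ℝ))
    (heq : Equicontinuous fun n => (G n : X → ℝ)) (hbd : ∀ x, ∃ M : ℝ, ∀ n, |G n x| ≤ M) :
    ∃ (g : C(X, ℝ)) (k : ℕ → ℕ), StrictMono k ∧ Tendsto (fun j => G (k j)) atTop (𝓝 g) := by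
  have hcl : IsClosedEmbedding (ContinuousMap.toUniformOnFunIsCompact :
      C(X, ℝ) → UniformOnFun X ℝ {K | IsCompact K}) := by
    refine ⟨ContinuousMap.isUniformEmbedding_toUniformOnFunIsCompact.isEmbedding, ?_⟩
    rw [ContinuousMap.range_toUniformOnFunIsCompact]
    refine UniformOnFun.isClosed_setOfPred_continuous (IsCoherentWith.of_nhds fun x => ?_)
    obtain ⟨K, hK, hx⟩ := exists_compact_mem_nhds x
    exact ⟨K, hK, hx⟩
  have hcomp : IsCompact (closure (range G)) := by
    refine ArzelaAscoli.isCompact_closure_of_isClosedEmbedding (F := fun g : C(X, ℝ) => (g : X → ℝ))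
      (𝔖 := {K | IsCompact K}) (fun K hK => hK) hcl ?_ ?_
    · intro K _ x _ V hV
      filter_upwards [mem_nhdsWithin_of_mem_nhds (heq x V hV)] with y hy
      rintro ⟨_, n, rfl⟩
      exact hy n
    · intro K _ x _
      obtain ⟨M, hM⟩ := hbd x
      refine ⟨Icc (-M) M, isCompact_Icc, ?_⟩
      rintro _ ⟨n, rfl⟩
      exact abs_le.1 (hM n)
  obtain ⟨g, -, k, hk, hlim⟩ := hcomp.isSeqCompact fun n => subset_closure (mem_range_self n)
  exact ⟨g, k, hk, hlim⟩

/-- Continuity of translations in `L¹`. -/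
lemma tendsto_integral_abs_sub_translate {g : Plane → ℝ} (hg : Integrable g) (x₀ : Plane) :
    Tendsto (fun x => ∫ y, |g (x - y) - g (x₀ - y)|) (𝓝 x₀) (𝓝 0) := by
  rw [Metric.tendsto_nhds]
  intro ε hε
  obtain ⟨h, hsupp, hgh, hcont, hint⟩ :=
    hg.exists_hasCompactSupport_integral_sub_le (show 0 < ε / 4 by positivity)
  obtain ⟨R, hR⟩ := hsupp.isBounded.subset_closedBall 0
  have hz : ∀ x ∈ Metric.ball x₀ 1, ∀ y, y ∉ Metric.closedBall x₀ (R + 1) → h (x - y) = 0 := by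
    intro x hx y hy
    by_contra h0
    have h1 := hR (subset_tsupport h h0)
    rw [mem_closedBall_zero_iff, ← dist_eq_norm] at h1
    refine hy ?_
    rw [Metric.mem_closedBall]
    have := dist_triangle y x x₀
    rw [dist_comm y x] at this
    linarith [Metric.mem_ball.1 hx]
  have hcts : Continuous fun x => ∫ y in Metric.closedBall x₀ (R + 1), |h (x - y) - h (x₀ - y)| :=
    continuous_parametric_integral_of_continuous (by fun_prop) (isCompact_closedBall _ _)
  have h0 := hcts.tendsto x₀
  simp only [sub_self, abs_zero, integral_zero] at h0
  filter_upwards [(Metric.tendsto_nhds.1 h0) (ε / 4) (by positivity), Metric.ball_mem_nhds x₀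
    one_pos] with x hx hx1
  rw [setIntegral_eq_integral_of_forall_compl_eq_zero (fun y hy => by
    rw [hz x hx1 y hy, hz x₀ (Metric.mem_ball_self one_pos) y hy]; simp)] at hx
  rw [Real.dist_eq, sub_zero, abs_of_nonneg (integral_nonneg fun _ => abs_nonneg _)] at hx ⊢
  have hi : ∀ x, Integrable fun y => |g (x - y) - h (x - y)| := fun x =>
    ((hg.sub hint).comp_sub_left x).abs
  have hv : ∀ x, ∫ y, |g (x - y) - h (x - y)| ≤ ε / 4 := fun x => by
    rw [integral_sub_left_eq_self (fun z => |g z - h z|) volume x]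
    exact hgh
  have hi2 : Integrable fun y => |h (x - y) - h (x₀ - y)| :=
    ((hint.comp_sub_left x).sub (hint.comp_sub_left x₀)).abs
  calc ∫ y, |g (x - y) - g (x₀ - y)|
      ≤ ∫ y, (|g (x - y) - h (x - y)| + |h (x - y) - h (x₀ - y)| + |g (x₀ - y) - h (x₀ - y)|) := by
        refine integral_mono ((hg.comp_sub_left x).sub (hg.comp_sub_left x₀)).abs
          (((hi x).add hi2).add (hi x₀)) fun y => ?_
        have h1 := abs_add_three (g (x - y) - h (x - y)) (h (x - y) - h (x₀ - y))
          (h (x₀ - y) - g (x₀ - y))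
        rw [abs_sub_comm (h (x₀ - y))] at h1
        refine le_trans (le_of_eq ?_) h1
        congr 1; ring
    _ = (∫ y, |g (x - y) - h (x - y)|) + (∫ y, |h (x - y) - h (x₀ - y)|) +
          ∫ y, |g (x₀ - y) - h (x₀ - y)| := by
        rw [integral_add (f := fun y => |g (x - y) - h (x - y)| + |h (x - y) - h (x₀ - y)|)
          ((hi x).add hi2) (hi x₀), integral_add (hi x) hi2]
    _ < ε := by linarith [hv x, hv x₀]

namespace RadialProfile

variable (b : RadialProfile)

/-- The right-hand side of the representation formula at scale `δ`. -/
def localRep (Ω : Set Plane) (u f : Plane → ℝ) (δ : ℝ) (x : Plane) : ℝ :=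
  (∫ y in Ω, b.mollifier δ (x - y) * u y) + ∫ y in Ω, b.kernel δ (x - y) * f y

lemma integrable_kernel {δ : ℝ} (hδ : 0 < δ) : Integrable (b.kernel δ) :=
  (integrable_logKernel hδ).mono' (b.measurable_kernel δ).aestronglyMeasurable
    (Eventually.of_forall fun x => by
      rw [Real.norm_of_nonneg (b.kernel_nonneg _ _)]; exact b.kernel_le hδ x)

lemma integrable_mollifier {δ : ℝ} (hδ : 0 < δ) : Integrable (b.mollifier δ) := by
  by_contra h
  have := b.integral_mollifier hδ
  rw [integral_undef h] at this
  exact zero_ne_one this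

/-- An integrable function vanishing off the closed ball of radius `δ`, translated, may be
integrated against a function that is bounded on that ball. -/
lemma integrableOn_mul_of_ae_abs_le {Ω : Set Plane} (hΩ : IsOpen Ω) {g v : Plane → ℝ} {x : Plane}
    {δ D : ℝ} (hg : Integrable g) (hg0 : ∀ y, y ∉ Metric.closedBall x δ → g (x - y) = 0)
    (hx : Metric.closedBall x δ ⊆ Ω) (hv : LocallyIntegrableOn v Ω)
    (hvD : ∀ᵐ y ∂(volume.restrict (Metric.closedBall x δ)), |v y| ≤ D) :
    IntegrableOn (fun y => g (x - y) * v y) Ω := by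
  have h1 : IntegrableOn (fun y => g (x - y) * v y) (Metric.closedBall x δ) := by
    refine Integrable.mono' ((hg.comp_sub_left x).norm.integrableOn.mul_const D)
      ((hg.comp_sub_left x).integrableOn.aestronglyMeasurable.mul
        (hv.integrableOn_compact_subset hx (isCompact_closedBall x δ)).aestronglyMeasurable) ?_
    filter_upwards [hvD] with y hy
    rw [norm_mul]
    exact mul_le_mul_of_nonneg_left hy (norm_nonneg _)
  exact h1.of_forall_sdiff_eq_zero hΩ.measurableSet fun y hy => by rw [hg0 y hy.2, zero_mul]

/-- The representation does not depend on the scale. -/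
lemma localRep_eq_of_le {Ω : Set Plane} (hΩ : IsOpen Ω) {u f : Plane → ℝ}
    (h : IsDistribSolution Ω u f) {x : Plane} {δ ε D : ℝ} (hε : 0 < ε) (hεδ : ε ≤ δ)
    (hx : Metric.closedBall x δ ⊆ Ω)
    (hD : ∀ᵐ y ∂(volume.restrict (Metric.closedBall x δ)), |f y| ≤ D) :
    b.localRep Ω u f ε x = b.localRep Ω u f δ x := by
  have hδ := hε.trans_le hεδ
  have h1 := b.integral_mollifier_sub h hε hεδ hx
  have hk : ∀ {ε}, 0 < ε → ε ≤ δ → IntegrableOn (fun y => b.kernel ε (x - y) * f y) Ω :=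
    fun {ε} hε hεδ => integrableOn_mul_of_ae_abs_le hΩ (b.integrable_kernel hε)
      (fun y hy => b.kernel_eq_zero_of_notMem hε fun hy' =>
        hy (Metric.closedBall_subset_closedBall hεδ hy')) hx h.2.1 hD
  have h2 : ∫ y in Ω, (b.smoothPotential δ (x - y) - b.smoothPotential ε (x - y)) * f y =
      (∫ y in Ω, b.kernel δ (x - y) * f y) - ∫ y in Ω, b.kernel ε (x - y) * f y := by
    rw [← integral_sub (hk hδ le_rfl) (hk hε hεδ)]
    refine integral_congr_ae (ae_restrict_of_ae ?_)
    have hne : ∀ᵐ y : Plane, y ≠ x := by simp [ae_iff, measure_singleton]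
    filter_upwards [hne] with y hy
    rw [← sub_mul, b.kernel_sub_kernel hδ hε (sub_ne_zero.2 hy.symm)]
  rw [h2] at h1
  unfold localRep
  linarith

lemma abs_setIntegral_sub_le {Ω : Set Plane} (hΩ : IsOpen Ω) {g v : Plane → ℝ} {p x x' : Plane}
    {δ D : ℝ} (hg : Integrable g) (hg0 : ∀ z, δ ≤ ‖z‖ → g z = 0)
    (hp : Metric.closedBall p (2 * δ) ⊆ Ω) (hv : LocallyIntegrableOn v Ω)
    (hvD : ∀ᵐ y ∂(volume.restrict (Metric.closedBall p (2 * δ))), |v y| ≤ D)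
    (hx : x ∈ Metric.closedBall p δ) (hx' : x' ∈ Metric.closedBall p δ) :
    |(∫ y in Ω, g (x - y) * v y) - ∫ y in Ω, g (x' - y) * v y| ≤
      D * ∫ y, |g (x - y) - g (x' - y)| := by
  have hsub : ∀ {x}, x ∈ Metric.closedBall p δ →
      Metric.closedBall x δ ⊆ Metric.closedBall p (2 * δ) := fun hx =>
    Metric.closedBall_subset_closedBall' (by linarith [Metric.mem_closedBall.1 hx])
  have hg0' : ∀ {x y : Plane}, y ∉ Metric.closedBall x δ → g (x - y) = 0 := fun hy => hg0 _ (by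
    rw [Metric.mem_closedBall, not_le, dist_comm, dist_eq_norm] at hy; exact hy.le)
  have hi : ∀ {x}, x ∈ Metric.closedBall p δ → IntegrableOn (fun y => g (x - y) * v y) Ω :=
    fun hx => integrableOn_mul_of_ae_abs_le hΩ hg (fun y hy => hg0' hy) ((hsub hx).trans hp) hv
      (ae_restrict_of_ae_restrict_of_subset (hsub hx) hvD)
  rw [← integral_sub (hi hx) (hi hx')]
  have hdi : Integrable fun y => D * |g (x - y) - g (x' - y)| :=
    ((hg.comp_sub_left x).sub (hg.comp_sub_left x')).abs.const_mul D
  have hvD' : ∀ᵐ y, y ∈ Metric.closedBall p (2 * δ) → |v y| ≤ D :=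
    (ae_restrict_iff' Metric.isClosed_closedBall.measurableSet).1 hvD
  have hz : ∀ {y}, y ∉ Metric.closedBall p (2 * δ) → g (x - y) = 0 ∧ g (x' - y) = 0 := fun hy =>
    ⟨hg0' fun h => hy (hsub hx h), hg0' fun h => hy (hsub hx' h)⟩
  have key : ∀ᵐ y, ‖g (x - y) * v y - g (x' - y) * v y‖ ≤ D * |g (x - y) - g (x' - y)| := by
    filter_upwards [hvD'] with y hy
    by_cases hyp : y ∈ Metric.closedBall p (2 * δ)
    · rw [← sub_mul, norm_mul, mul_comm]
      exact mul_le_mul_of_nonneg_right (hy hyp) (abs_nonneg _)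
    · rw [(hz hyp).1, (hz hyp).2]; simp
  refine (norm_integral_le_of_norm_le hdi.integrableOn (ae_restrict_of_ae key)).trans ?_
  rw [← integral_const_mul]
  refine setIntegral_le_integral hdi ?_
  filter_upwards [key] with y hy
  exact (norm_nonneg _).trans hy

end RadialProfile

/-- A locally bounded sequence of solutions has a subsequence that converges locally uniformly: the
continuous representatives given by the representation formula are locally equicontinuous. -/
lemma exists_converges {Ω : Set Plane} (hΩ : IsOpen Ω) {C : ℝ} {u F φ : ℕ → Plane → ℝ}
    (h : ∀ n, IsAdmissible Ω C (u n) (F n) (φ n)) (hub : LocUniformBddAbove Ω u)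
    (hlb : LocUniformBddBelow Ω u) :
    ∃ k : ℕ → ℕ, StrictMono k ∧ Converges Ω (fun j => u (k j)) := by
  -- any profile would do
  obtain ⟨b, -⟩ := RadialProfile.exists_annular_profile
  have hbd : ∀ K, IsCompact K → K ⊆ Ω → ∃ D : ℝ, 0 ≤ D ∧ ∀ n,
      (∀ᵐ x ∂(volume.restrict K), |u n x| ≤ D) ∧
      ∀ᵐ x ∂(volume.restrict K), |F n x + φ n x| ≤ D := by
    intro K hK hKΩ
    obtain ⟨D, hD, hDf⟩ := exists_ae_abs_rhs_le h hub hK hKΩ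
    obtain ⟨M, hM⟩ := hub K hK hKΩ
    obtain ⟨m, hm⟩ := hlb K hK hKΩ
    refine ⟨max D (max M (-m)), hD.trans (le_max_left _ _), fun n => ⟨?_, ?_⟩⟩
    · filter_upwards [hM n, hm n] with x h1 h2
      rw [abs_le]
      have h3 : M ≤ max D (max M (-m)) := (le_max_left _ _).trans (le_max_right _ _)
      have h4 : -m ≤ max D (max M (-m)) := (le_max_right _ _).trans (le_max_right _ _)
      constructor <;> linarith
    · exact (hDf n).mono fun x hx => hx.trans (le_max_left _ _)
  have hd : ∀ x : Plane, ∃ d : ℝ, 0 < d ∧ (x ∈ Ω → Metric.closedBall x (2 * d) ⊆ Ω) := by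
    intro x
    by_cases hx : x ∈ Ω
    · obtain ⟨s, hs, hsΩ⟩ := Metric.nhds_basis_closedBall.mem_iff.1 (hΩ.mem_nhds hx)
      exact ⟨s / 2, by positivity, fun _ => by rwa [show 2 * (s / 2) = s by ring]⟩
    · exact ⟨1, one_pos, fun h => absurd h hx⟩
  choose d hd0 hdΩ using hd
  set f : ℕ → Plane → ℝ := fun n x => F n x + φ n x with hf
  -- the continuous representatives, with a scale depending on the point
  set U : ℕ → Plane → ℝ := fun n x => b.localRep Ω (u n) (f n) (d x) x with hU
  -- near a point the scale may be frozen
  have hUeq : ∀ p ∈ Ω, ∀ n, ∀ x ∈ Metric.closedBall p (d p), x ∈ Ω →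
      U n x = b.localRep Ω (u n) (f n) (d p) x := by
    intro p hp n x hx hxΩ
    have hs1 : Metric.closedBall x (d p) ⊆ Ω :=
      (Metric.closedBall_subset_closedBall' (by linarith [Metric.mem_closedBall.1 hx])).trans
        (hdΩ p hp)
    have hs2 : Metric.closedBall x (d x) ⊆ Ω :=
      (Metric.closedBall_subset_closedBall (by linarith [hd0 x])).trans (hdΩ x hxΩ)
    obtain ⟨D1, -, hD1⟩ := hbd _ (isCompact_closedBall _ _) hs1
    obtain ⟨D2, -, hD2⟩ := hbd _ (isCompact_closedBall _ _) hs2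
    rcases le_total (d x) (d p) with hle | hle
    · exact b.localRep_eq_of_le hΩ (h n).sol (hd0 x) hle hs1 (hD1 n).2
    · exact (b.localRep_eq_of_le hΩ (h n).sol (hd0 p) hle hs2 (hD2 n).2).symm
  have hUu : ∀ K, IsCompact K → K ⊆ Ω → ∀ n, ∀ᵐ x ∂(volume.restrict K), u n x = U n x := by
    intro K hK hKΩ n
    refine hK.induction_on (p := fun s => ∀ᵐ x ∂(volume.restrict s), u n x = U n x) (by simp)
      (fun s s' hs h' => ae_restrict_of_ae_restrict_of_subset hs h')
      (fun s s' h1 h2 => (ae_restrict_union_iff _ _ _).2 ⟨h1, h2⟩) fun p hp => ?_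
    refine ⟨Metric.ball p (d p), mem_nhdsWithin_of_mem_nhds (Metric.ball_mem_nhds p (hd0 p)), ?_⟩
    filter_upwards [b.ae_eq_integral_add_integral (h n).sol (hdΩ p (hKΩ hp)),
      ae_restrict_mem measurableSet_ball] with x hx hxp
    have hxΩ : x ∈ Ω := hdΩ p (hKΩ hp) (by
      rw [Metric.mem_closedBall]; linarith [Metric.mem_ball.1 hxp, hd0 p])
    rw [hUeq p (hKΩ hp) n x (Metric.ball_subset_closedBall hxp) hxΩ]
    exact (hx (d p) (hd0 p) le_rfl).2
  have heq : Equicontinuous fun n => fun x : Ω => U n x := by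
    rintro ⟨p, hp⟩
    rw [Metric.equicontinuousAt_iff_right]
    intro ε hε
    obtain ⟨D, hD, hDb⟩ := hbd _ (isCompact_closedBall _ _) (hdΩ p hp)
    have hlim : Tendsto (fun x => D * (∫ y, |b.mollifier (d p) (x - y) - b.mollifier (d p) (p - y)|) +
        D * ∫ y, |b.kernel (d p) (x - y) - b.kernel (d p) (p - y)|) (𝓝 p) (𝓝 (D * 0 + D * 0)) :=
      ((tendsto_integral_abs_sub_translate (b.integrable_mollifier (hd0 p)) p).const_mul D).add
        ((tendsto_integral_abs_sub_translate (b.integrable_kernel (hd0 p)) p).const_mul D)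
    rw [mul_zero, add_zero] at hlim
    have hev := (hlim.eventually (Iio_mem_nhds hε)).and
      (Metric.closedBall_mem_nhds p (hd0 p))
    filter_upwards [continuous_subtype_val.continuousAt.eventually hev] with x hx n
    have hpp : p ∈ Metric.closedBall p (d p) := Metric.mem_closedBall_self (hd0 p).le
    rw [dist_comm, Real.dist_eq, hUeq p hp n x hx.2 x.2, hUeq p hp n p hpp hp]
    refine lt_of_le_of_lt ?_ hx.1
    have h1 := RadialProfile.abs_setIntegral_sub_le hΩ (b.integrable_mollifier (hd0 p))
      (fun z hz => b.mollifier_of_le (hd0 p) hz) (hdΩ p hp) (h n).sol.1 (hDb n).1 hx.2 hpp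
    have h2 := RadialProfile.abs_setIntegral_sub_le hΩ (b.integrable_kernel (hd0 p))
      (fun z hz => b.kernel_of_le (hd0 p) hz) (hdΩ p hp) (h n).sol.2.1 (hDb n).2 hx.2 hpp
    unfold RadialProfile.localRep
    rw [add_sub_add_comm]
    exact (abs_add_le _ _).trans (add_le_add h1 h2)
  let G : ℕ → C(Ω, ℝ) := fun n => ⟨fun x => U n x, heq.continuous n⟩
  have hGb : ∀ x, ∃ M : ℝ, ∀ n, |G n x| ≤ M := by
    rintro ⟨p, hp⟩
    have hs : Metric.closedBall p (d p) ⊆ Ω :=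
      (Metric.closedBall_subset_closedBall (by linarith [hd0 p])).trans (hdΩ p hp)
    obtain ⟨D, hD, hDb⟩ := hbd _ (isCompact_closedBall _ _) hs
    refine ⟨D + D * logMass (d p), fun n => ?_⟩
    change |b.localRep Ω (u n) (f n) (d p) p| ≤ _
    have hDu : ∀ᵐ y ∂(volume.restrict Ω), y ∈ Metric.closedBall p (d p) → |u n y| ≤ D :=
      ae_restrict_of_ae ((ae_restrict_iff' Metric.isClosed_closedBall.measurableSet).1 (hDb n).1)
    have hDf : ∀ᵐ y ∂(volume.restrict Ω), y ∈ Metric.closedBall p (d p) → |f n y| ≤ D :=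
      ae_restrict_of_ae ((ae_restrict_iff' Metric.isClosed_closedBall.measurableSet).1 (hDb n).2)
    refine (abs_add_le _ _).trans (add_le_add ?_
      (b.abs_setIntegral_kernel_mul_le (hd0 p) p hD hDf))
    have h1 : ‖∫ y in Ω, b.mollifier (d p) (p - y) * u n y‖ ≤
        ∫ y in Ω, D * b.mollifier (d p) (p - y) := by
      refine norm_integral_le_of_norm_le
        (((b.integrable_mollifier (hd0 p)).comp_sub_left p).integrableOn.const_mul D) ?_
      filter_upwards [hDu] with y hy
      by_cases hyp : y ∈ Metric.closedBall p (d p)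
      · rw [norm_mul, Real.norm_of_nonneg (b.mollifier_nonneg _ _), mul_comm]
        exact mul_le_mul_of_nonneg_right (hy hyp) (b.mollifier_nonneg _ _)
      · rw [b.mollifier_eq_zero_of_notMem (hd0 p) hyp]; simp
    rw [integral_const_mul, b.setIntegral_mollifier_eq_one (hd0 p) hs, mul_one] at h1
    exact h1
  have : LocallyCompactSpace Ω := hΩ.locallyCompactSpace
  obtain ⟨g, k, hk, hlim⟩ := exists_subseq_tendsto_of_equicontinuous G heq hGb
  classical
  refine ⟨k, hk, fun x => if hx : x ∈ Ω then g ⟨x, hx⟩ else 0, fun K hK hKΩ => ?_,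
    fun K hK hKΩ ε hε => ?_⟩
  · have hK' : IsCompact (Subtype.val ⁻¹' K : Set Ω) :=
      IsInducing.subtypeVal.isCompact_preimage' hK (by simpa using hKΩ)
    obtain ⟨M, hM⟩ := hK'.exists_bound_of_continuousOn g.continuous.continuousOn
    refine ⟨M, fun x hx => ?_⟩
    simp only [dif_pos (hKΩ hx)]
    exact hM ⟨x, hKΩ hx⟩ hx
  · have hK' : IsCompact (Subtype.val ⁻¹' K : Set Ω) :=
      IsInducing.subtypeVal.isCompact_preimage' hK (by simpa using hKΩ)
    have hunif := ContinuousMap.tendsto_iff_forall_isCompact_tendstoUniformlyOn.1 hlim _ hK'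
    filter_upwards [Metric.tendstoUniformlyOn_iff.1 hunif ε hε] with j hj
    filter_upwards [hUu K hK hKΩ (k j), ae_restrict_mem hK.measurableSet] with x hx hxK
    rw [dif_pos (hKΩ hxK), hx, ← Real.dist_eq, dist_comm]
    exact hj ⟨x, hKΩ hxK⟩ hxK

/-! ### Weak limits of the exponential terms and the blow-up set -/

/-- Weak compactness of bounded sequences of nonnegative densities on a bounded open set. Prokhorov's
theorem is applied to probability measures, obtained by rescaling the densities and putting the
missing mass on a point outside `Ω`, which test functions supported in `Ω` do not see. -/
lemma exists_weak_limit {Ω : Set Plane} (hΩb : Bornology.IsBounded Ω) {C : ℝ}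
    {F : ℕ → Plane → ℝ} (hF0 : ∀ n, ∀ᵐ x ∂(volume.restrict Ω), 0 ≤ F n x)
    (hFi : ∀ n, IntegrableOn (F n) Ω) (hFC : ∀ n, ∫ x in Ω, F n x ≤ C) :
    ∃ (k : ℕ → ℕ) (μ : Measure Plane), StrictMono k ∧ IsFiniteMeasure μ ∧
      ∀ η : Plane → ℝ, Continuous η → HasCompactSupport η → tsupport η ⊆ Ω →
        Tendsto (fun j => ∫ x in Ω, F (k j) x * η x) atTop (𝓝 (∫ x, η x ∂μ)) := by
  have hC : 0 ≤ C := (integral_nonneg_of_ae (hF0 0)).trans (hFC 0)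
  have hC1 : 0 < C + 1 := by linarith
  obtain ⟨R, hR⟩ := hΩb.subset_closedBall (0 : Plane)
  set z : Plane := EuclideanSpace.single 0 (|R| + 1) with hz
  have hznorm : ‖z‖ = |R| + 1 := by
    rw [hz, PiLp.norm_single, Real.norm_of_nonneg (by positivity)]
  have hzΩ : z ∉ Ω := fun h => by
    have := mem_closedBall_zero_iff.1 (hR h)
    linarith [le_abs_self R]
  set ν : ℕ → Measure Plane := fun n =>
    (volume.restrict Ω).withDensity fun x => ENNReal.ofReal ((C + 1)⁻¹ * F n x) with hν
  have hν1 : ∀ n, ν n univ ≤ 1 := by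
    intro n
    rw [hν, withDensity_apply _ MeasurableSet.univ, Measure.restrict_univ,
      ← ofReal_integral_eq_lintegral_ofReal ((hFi n).const_mul _)
        ((hF0 n).mono fun x hx => mul_nonneg (inv_nonneg.2 hC1.le) hx), integral_const_mul,
      ENNReal.ofReal_le_one, inv_mul_le_iff₀ hC1]
    linarith [hFC n]
  have hνfin : ∀ n, IsFiniteMeasure (ν n) := fun n => ⟨(hν1 n).trans_lt ENNReal.one_lt_top⟩
  set κ : ℕ → Measure Plane := fun n => ν n + (1 - ν n univ) • Measure.dirac z with hκ
  have hκp : ∀ n, IsProbabilityMeasure (κ n) := fun n => ⟨by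
    simp only [hκ, Measure.add_apply, Measure.smul_apply, measure_univ, smul_eq_mul, mul_one]
    exact add_tsub_cancel_of_le (hν1 n)⟩
  have hκK : ∀ n, κ n (Metric.closedBall 0 (|R| + 1))ᶜ = 0 := by
    intro n
    have h1 : ν n (Metric.closedBall 0 (|R| + 1))ᶜ = 0 := by
      refine withDensity_absolutelyContinuous _ _ ?_
      rw [Measure.restrict_apply Metric.isClosed_closedBall.measurableSet.compl]
      convert measure_empty (μ := volume)
      rw [eq_empty_iff_forall_notMem]
      rintro x ⟨hx, hxΩ⟩
      exact hx (Metric.closedBall_subset_closedBall (by linarith [le_abs_self R]) (hR hxΩ))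
    simp only [hκ, Measure.add_apply, Measure.smul_apply, h1, smul_eq_mul, zero_add]
    rw [Measure.dirac_apply' _ Metric.isClosed_closedBall.measurableSet.compl, indicator_of_notMem,
      mul_zero]
    simp [hznorm]
  set κ' : ℕ → ProbabilityMeasure Plane := fun n => ⟨κ n, hκp n⟩ with hκ'
  have htight : IsTightMeasureSet {x | ∃ μ ∈ range κ', (μ : Measure Plane) = x} := by
    rw [isTightMeasureSet_iff_exists_isCompact_measure_compl_le]
    refine fun ε hε => ⟨Metric.closedBall 0 (|R| + 1), isCompact_closedBall _ _, ?_⟩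
    rintro _ ⟨_, ⟨n, rfl⟩, rfl⟩
    exact (hκK n).le.trans zero_le
  obtain ⟨κ₀, -, k, hk, hlim⟩ := (isCompact_closure_of_isTightMeasureSet htight).isSeqCompact
    fun n => subset_closure (mem_range_self n)
  refine ⟨k, ENNReal.ofReal (C + 1) • (κ₀ : Measure Plane), hk,
    Measure.smul_finite _ ENNReal.ofReal_ne_top,
    fun η hη hηc hηΩ => ?_⟩
  obtain ⟨B, hB⟩ := hη.bounded_above_of_compact_support hηc
  have h1 := ProbabilityMeasure.tendsto_iff_forall_integral_tendsto.1 hlim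
    (BoundedContinuousFunction.ofNormedAddCommGroup η hη B hB)
  have h2 : ∀ n, ∫ x, η x ∂(κ n) = (C + 1)⁻¹ * ∫ x in Ω, F n x * η x := by
    intro n
    have hηi : ∀ m : Measure Plane, IsFiniteMeasure m → Integrable η m := fun m _ =>
      hη.integrable_of_hasCompactSupport hηc
    have hzη : η z = 0 := image_eq_zero_of_notMem_tsupport fun h => hzΩ (hηΩ h)
    have hfin : 1 - ν n univ ≠ ⊤ := ENNReal.sub_ne_top ENNReal.one_ne_top
    rw [hκ, integral_add_measure (hηi _ (hνfin n)) ((hηi _ inferInstance).smul_measure hfin),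
      integral_smul_measure, integral_dirac, hzη, smul_zero, add_zero, hν,
      integral_withDensity_eq_integral_toReal_smul₀ _ (by simp), ← integral_const_mul]
    · refine integral_congr_ae ?_
      filter_upwards [hF0 n] with x hx
      rw [ENNReal.toReal_ofReal (mul_nonneg (inv_nonneg.2 hC1.le) hx), smul_eq_mul, mul_assoc]
    · exact ((hFi n).aemeasurable.const_mul _).ennreal_ofReal
  have h3 : Tendsto (fun j => ∫ x, η x ∂(κ (k j))) atTop (𝓝 (∫ x, η x ∂(κ₀ : Measure Plane))) := h1
  simp only [h2] at h3
  have h4 := h3.const_mul (C + 1)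
  simp only [mul_inv_cancel_left₀ hC1.ne'] at h4
  rwa [integral_smul_measure, ENNReal.toReal_ofReal hC1.le, smul_eq_mul]

/-- A continuous cutoff function between a compact set and an open neighbourhood. -/
lemma exists_cutoff {K U : Set Plane} (hK : IsCompact K) (hU : IsOpen U) (hKU : K ⊆ U) :
    ∃ η : Plane → ℝ, Continuous η ∧ HasCompactSupport η ∧ tsupport η ⊆ U ∧
      (∀ x, 0 ≤ η x ∧ η x ≤ 1) ∧ ∀ x ∈ K, η x = 1 := by
  obtain ⟨V, hV, hKV, hVU⟩ := hK.exists_isOpen_closure_subset (hU.mem_nhdsSet.2 hKU)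
  obtain ⟨η, h1, h0, hc, hr⟩ := exists_continuous_one_zero_of_isCompact hK hV.isClosed_compl
    (disjoint_compl_right_iff_subset.2 hKV)
  refine ⟨η, η.continuous, hc, (closure_mono fun x hx => ?_).trans hVU, fun x => hr x,
    fun x hx => h1 hx⟩
  by_contra hxV
  exact hx (h0 hxV)

/-- A uniform bound for infinitely many densities on an open set passes to the weak limit. -/
lemma measure_le_of_frequently_ae_le {Ω : Set Plane} (hΩb : Bornology.IsBounded Ω)
    {F : ℕ → Plane → ℝ} (hF0 : ∀ n, ∀ᵐ x ∂(volume.restrict Ω), 0 ≤ F n x)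
    {μ : Measure Plane} [IsFiniteMeasure μ]
    (hμ : ∀ η : Plane → ℝ, Continuous η → HasCompactSupport η → tsupport η ⊆ Ω →
      Tendsto (fun j => ∫ x in Ω, F j x * η x) atTop (𝓝 (∫ x, η x ∂μ)))
    {U : Set Plane} (hU : IsOpen U) (hUΩ : U ⊆ Ω) {D : ℝ} (hD : 0 ≤ D)
    (hFD : ∃ᶠ n in atTop, ∀ᵐ x ∂(volume.restrict U), F n x ≤ D) :
    μ U ≤ ENNReal.ofReal D * volume U := by
  have hUfin : volume U ≠ ⊤ := (hΩb.subset hUΩ).measure_lt_top.ne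
  rw [hU.measure_eq_iSup_isCompact]
  refine iSup_le fun K => iSup_le fun hKU => iSup_le fun hK => ?_
  obtain ⟨η, hη, hηc, hηU, hη01, hη1⟩ := exists_cutoff hK hU hKU
  have h1 : ∫ x, η x ∂μ ≤ D * volume.real U := by
    refine le_of_tendsto_of_frequently (hμ η hη hηc (hηU.trans hUΩ)) (hFD.mono fun n hn => ?_)
    have h2 : ∫ x in Ω, F n x * η x = ∫ x in U, F n x * η x := by
      have hz : ∀ x, x ∉ U → F n x * η x = 0 := fun x hx => by
        rw [image_eq_zero_of_notMem_tsupport fun h => hx (hηU h), mul_zero]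
      rw [setIntegral_eq_integral_of_forall_compl_eq_zero fun x hx => hz x fun h => hx (hUΩ h),
        setIntegral_eq_integral_of_forall_compl_eq_zero hz]
    rw [h2]
    have h3 : ‖∫ x in U, F n x * η x‖ ≤ D * volume.real U := by
      refine norm_setIntegral_le_of_norm_le_const_ae' hUfin.lt_top ?_
      have h4 := (ae_restrict_iff' hU.measurableSet).1
        (hn.and (ae_restrict_of_ae_restrict_of_subset hUΩ (hF0 n)))
      filter_upwards [h4] with x hx hxU
      rw [norm_mul, Real.norm_of_nonneg (hx hxU).2, Real.norm_of_nonneg (hη01 x).1]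
      exact (mul_le_of_le_one_right (hx hxU).2 (hη01 x).2).trans (hx hxU).1
    exact (le_abs_self _).trans h3
  have h5 : μ.real K ≤ ∫ x, η x ∂μ := by
    have hi : Integrable η μ := hη.integrable_of_hasCompactSupport hηc
    calc μ.real K = ∫ x in K, (1 : ℝ) ∂μ := by simp
      _ = ∫ x in K, η x ∂μ := setIntegral_congr_fun hK.measurableSet fun x hx => (hη1 x hx).symm
      _ ≤ ∫ x, η x ∂μ := setIntegral_le_integral hi (Eventually.of_forall fun x => (hη01 x).1)
  rw [← ENNReal.ofReal_toReal hUfin, ← ENNReal.ofReal_mul hD, ← ENNReal.ofReal_toReal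
    (measure_ne_top μ K)]
  exact ENNReal.ofReal_le_ofReal (h5.trans h1)

lemma locUniformBddAbove_of_forall {U : Set Plane} {u : ℕ → Plane → ℝ}
    (h : ∀ p ∈ U, ∃ ρ > 0, ∃ M : ℝ, ∀ n, ∀ᵐ x ∂(volume.restrict (Metric.ball p ρ)), u n x ≤ M) :
    LocUniformBddAbove U u := by
  intro K hK hKU
  refine hK.induction_on (p := fun s => ∃ M : ℝ, ∀ n, ∀ᵐ x ∂(volume.restrict s), u n x ≤ M)
    ⟨0, by simp⟩
    (fun s s' hs ⟨M, hM⟩ => ⟨M, fun n => ae_restrict_of_ae_restrict_of_subset hs (hM n)⟩)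
    (fun s s' ⟨M, hM⟩ ⟨M', hM'⟩ => ⟨max M M', fun n => (ae_restrict_union_iff _ _ _).2
      ⟨(hM n).mono fun x hx => hx.trans (le_max_left _ _),
        (hM' n).mono fun x hx => hx.trans (le_max_right _ _)⟩⟩) fun p hp => ?_
  obtain ⟨ρ, hρ, M, hM⟩ := h p (hKU hp)
  exact ⟨Metric.ball p ρ, mem_nhdsWithin_of_mem_nhds (Metric.ball_mem_nhds p hρ), M, hM⟩

/-- A single solution is locally bounded above: small balls carry little mass of `F`. -/
lemma IsAdmissible.locUniformBddAbove {Ω : Set Plane} (hΩ : IsOpen Ω) {C : ℝ} {u F φ : Plane → ℝ}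
    (h : IsAdmissible Ω C u F φ) : LocUniformBddAbove Ω (fun _ => u) := by
  refine locUniformBddAbove_of_forall fun p hp => ?_
  obtain ⟨s, hs, hsΩ⟩ := Metric.nhds_basis_closedBall.mem_iff.1 (hΩ.mem_nhds hp)
  have hlim : Tendsto (fun r : ℝ => ∫ y in Metric.ball p (2 * r), F y ∂(volume.restrict Ω))
      (𝓝[>] 0) (𝓝 0) := by
    refine h.integrableOn.tendsto_setIntegral_nhds_zero ?_
    have h1 : Tendsto (fun r : ℝ => ENNReal.ofReal (2 * r) ^ 2 * ENNReal.ofReal Real.pi)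
        (𝓝[>] 0) (𝓝 (ENNReal.ofReal (2 * 0) ^ 2 * ENNReal.ofReal Real.pi)) := by
      refine Tendsto.mono_left ?_ nhdsWithin_le_nhds
      refine ENNReal.Tendsto.mul_const ?_ (Or.inr ENNReal.ofReal_ne_top)
      exact ((ENNReal.continuous_pow 2).comp
        (ENNReal.continuous_ofReal.comp (continuous_const.mul continuous_id))).tendsto 0
    simp only [mul_zero, ENNReal.ofReal_zero, ne_eq, OfNat.ofNat_ne_zero, not_false_eq_true,
      zero_pow, zero_mul] at h1
    refine tendsto_of_tendsto_of_tendsto_of_le_of_le tendsto_const_nhds h1 (fun _ => zero_le)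
      fun r => ?_
    refine (Measure.restrict_apply_le _ _).trans_eq ?_
    exact EuclideanSpace.volume_ball_fin_two p _
  have hev := (hlim.eventually (Iio_mem_nhds (one_pos : (0 : ℝ) < 1))).and
    (Ioo_mem_nhdsGT (show (0 : ℝ) < s / 2 by positivity))
  obtain ⟨r, hr1, hr0, hrs⟩ := hev.exists
  have hball : Metric.closedBall p (2 * r) ⊆ Ω :=
    (Metric.closedBall_subset_closedBall (by linarith)).trans hsΩ
  obtain ⟨M, hM⟩ := IsAdmissible.exists_ae_le (C := C) hΩ hr0 hball one_pos
    (by linarith [Real.pi_gt_three])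
  rw [Measure.restrict_restrict measurableSet_ball,
    inter_eq_self_of_subset_left (Metric.ball_subset_closedBall.trans hball)] at hr1
  exact ⟨r / 2, by positivity, M, fun _ => hM u F φ h (le_of_lt hr1)⟩

/-- Near a point whose mass in the weak limit is below `4π`, the sequence is bounded above. -/
lemma exists_ae_le_of_measure_lt {Ω : Set Plane} (hΩ : IsOpen Ω) {C : ℝ} {u F φ : ℕ → Plane → ℝ}
    (h : ∀ n, IsAdmissible Ω C (u n) (F n) (φ n)) {μ : Measure Plane} [IsFiniteMeasure μ]
    (hμ : ∀ η : Plane → ℝ, Continuous η → HasCompactSupport η → tsupport η ⊆ Ω →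
      Tendsto (fun j => ∫ x in Ω, F j x * η x) atTop (𝓝 (∫ x, η x ∂μ)))
    {p : Plane} (hp : p ∈ Ω) (hpμ : μ.real {p} < 4 * Real.pi) :
    ∃ ρ > 0, ∃ M : ℝ, ∀ n, ∀ᵐ x ∂(volume.restrict (Metric.ball p ρ)), u n x ≤ M := by
  obtain ⟨m, hm1, hm2⟩ := exists_between hpμ
  have hm0 : 0 < m := measureReal_nonneg.trans_lt hm1
  have hpm : μ {p} < ENNReal.ofReal m := by
    rwa [ENNReal.lt_ofReal_iff_toReal_lt (measure_ne_top _ _)]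
  obtain ⟨U, hpU, hU, hUm⟩ := ({p} : Set Plane).exists_isOpen_lt_of_lt _ hpm
  obtain ⟨s, hs, hsU⟩ := Metric.nhds_basis_closedBall.mem_iff.1
    ((hU.inter hΩ).mem_nhds ⟨hpU rfl, hp⟩)
  set r := s / 2 with hr
  have hr0 : 0 < r := by positivity
  have hsr : Metric.closedBall p (2 * r) ⊆ U ∩ Ω := by rwa [show 2 * r = s by rw [hr]; ring]
  obtain ⟨η, hη, hηc, hηU, hη01, hη1⟩ :=
    exists_cutoff (isCompact_closedBall p (2 * r)) (hU.inter hΩ) hsr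
  have hηlim := hμ η hη hηc (hηU.trans inter_subset_right)
  have hηm : ∫ x, η x ∂μ < m := by
    have hi : Integrable η μ := hη.integrable_of_hasCompactSupport hηc
    have h1 : ∫ x, η x ∂μ ≤ μ.real U := by
      rw [← setIntegral_eq_integral_of_forall_compl_eq_zero (s := U) fun x hx =>
        image_eq_zero_of_notMem_tsupport fun h => hx (hηU h).1]
      calc ∫ x in U, η x ∂μ ≤ ∫ x in U, (1 : ℝ) ∂μ :=
            integral_mono hi.integrableOn (integrable_const _) fun x => (hη01 x).2
        _ = μ.real U := by simp
    refine h1.trans_lt ?_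
    rwa [measureReal_def, ← ENNReal.lt_ofReal_iff_toReal_lt (measure_ne_top _ _)]
  obtain ⟨M, hM⟩ := IsAdmissible.exists_ae_le (C := C) hΩ hr0 (hsr.trans inter_subset_right) hm0 hm2
  have hsub : Metric.ball p (2 * r) ⊆ Ω :=
    Metric.ball_subset_closedBall.trans (hsr.trans inter_subset_right)
  have hev : ∀ᶠ n in atTop, ∀ᵐ x ∂(volume.restrict (Metric.ball p (r / 2))), u n x ≤ M := by
    filter_upwards [hηlim.eventually (Iio_mem_nhds hηm)] with n hn
    refine hM _ _ _ (h n) (le_trans ?_ (le_of_lt hn))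
    have hFη : IntegrableOn (fun x => F n x * η x) Ω := by
      refine Integrable.mono (h n).integrableOn ((h n).integrableOn.aestronglyMeasurable.mul
        hη.aestronglyMeasurable) (Eventually.of_forall fun x => ?_)
      rw [norm_mul, Real.norm_of_nonneg (hη01 x).1]
      exact mul_le_of_le_one_right (norm_nonneg _) (hη01 x).2
    calc ∫ y in Metric.ball p (2 * r), F n y = ∫ y in Metric.ball p (2 * r), F n y * η y := by
          refine setIntegral_congr_fun measurableSet_ball fun x hx => ?_
          simp only [hη1 x (Metric.ball_subset_closedBall hx), mul_one]
      _ ≤ ∫ y in Ω, F n y * η y := by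
          refine setIntegral_mono_set hFη ?_ hsub.eventuallyLE
          filter_upwards [(h n).nonneg] with x hx
          exact mul_nonneg hx (hη01 x).1
  obtain ⟨N, hN⟩ := eventually_atTop.1 hev
  -- the finitely many remaining terms are bounded individually
  have hK : Metric.closedBall p (r / 2) ⊆ Ω :=
    (Metric.closedBall_subset_closedBall (by linarith)).trans (hsr.trans inter_subset_right)
  have hsingle : ∀ n, ∃ M : ℝ, ∀ᵐ x ∂(volume.restrict (Metric.closedBall p (r / 2))), u n x ≤ M :=
    fun n => by
      obtain ⟨M, hM⟩ := (h n).locUniformBddAbove hΩ _ (isCompact_closedBall p (r / 2)) hK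
      exact ⟨M, hM 0⟩
  choose B hB using hsingle
  refine ⟨r / 2, by positivity, |M| + ∑ n ∈ Finset.range N, |B n|, fun n => ?_⟩
  rcases lt_or_ge n N with hn | hn
  · filter_upwards [ae_restrict_of_ae_restrict_of_subset Metric.ball_subset_closedBall (hB n)] with
      x hx
    have h1 := Finset.single_le_sum (f := fun n => |B n|) (fun i _ => abs_nonneg _)
      (Finset.mem_range.2 hn)
    have h2 : |B n| ≤ ∑ n ∈ Finset.range N, |B n| := h1
    linarith [le_abs_self (B n), abs_nonneg M]
  · filter_upwards [hN n hn] with x hx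
    have : 0 ≤ ∑ n ∈ Finset.range N, |B n| := Finset.sum_nonneg fun i _ => abs_nonneg _
    linarith [le_abs_self M]

/-- The blow-up set consists of the atoms of mass at least `4π` of the weak limit. Conversely to the
local bound below `4π`, a bound for infinitely many `u n` near a point bounds the corresponding
`F n`, and then the weak limit has no atom there. -/
lemma blowUpSet_eq {Ω : Set Plane} (hΩ : IsOpen Ω) (hΩb : Bornology.IsBounded Ω) {C : ℝ}
    {u F φ : ℕ → Plane → ℝ}
    (h : ∀ n, IsAdmissible Ω C (u n) (F n) (φ n)) {μ : Measure Plane} [IsFiniteMeasure μ]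
    (hμ : ∀ η : Plane → ℝ, Continuous η → HasCompactSupport η → tsupport η ⊆ Ω →
      Tendsto (fun j => ∫ x in Ω, F j x * η x) atTop (𝓝 (∫ x, η x ∂μ))) :
    blowUpSet Ω u = {p | p ∈ Ω ∧ 4 * Real.pi ≤ μ.real {p}} := by
  ext p
  constructor
  · rintro ⟨hp, hblow⟩
    refine ⟨hp, ?_⟩
    by_contra! hlt
    obtain ⟨ρ, hρ, M, hM⟩ := exists_ae_le_of_measure_lt hΩ h hμ hp hlt
    obtain ⟨n, hn⟩ := (hblow ρ hρ M).exists
    refine hn ?_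
    filter_upwards [ae_restrict_of_ae_restrict_of_subset inter_subset_left (hM n)] with x hx
    exact not_lt.2 hx
  · rintro ⟨hp, hpμ⟩
    refine ⟨hp, fun ρ hρ M => ?_⟩
    by_contra hcon
    rw [not_eventually] at hcon
    have hC := (h 0).const_nonneg
    set D := C * Real.exp (max M 0) with hD
    have hD0 : 0 ≤ D := by positivity
    obtain ⟨s, hs, hsΩ⟩ := Metric.isOpen_iff.1 (Metric.isOpen_ball.inter hΩ) p
      ⟨Metric.mem_ball_self hρ, hp⟩
    -- a bound for `F` on balls of radius `t` caps the atom by `D π t²`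
    set t := min s (1 / (D + 1)) with ht
    have ht0 : 0 < t := by positivity
    have htD : D * t ≤ 1 := by
      calc D * t ≤ D * (1 / (D + 1)) := by gcongr; exact min_le_right _ _
        _ ≤ 1 := by rw [mul_one_div, div_le_one (by positivity)]; linarith
    have ht1 : t ≤ 1 := (min_le_right _ _).trans (by
      rw [div_le_one (by positivity)]; linarith)
    have hsub : Metric.ball p t ⊆ Metric.ball p ρ ∩ Ω :=
      (Metric.ball_subset_ball (min_le_left _ _)).trans hsΩ
    have hfreq : ∃ᶠ n in atTop, ∀ᵐ x ∂(volume.restrict (Metric.ball p t)), F n x ≤ D := by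
      refine hcon.mono fun n hn => ?_
      rw [not_frequently] at hn
      filter_upwards [ae_restrict_of_ae_restrict_of_subset hsub hn,
        ae_restrict_of_ae_restrict_of_subset (hsub.trans inter_subset_right) (h n).le_exp]
        with x h1 h2
      refine h2.trans ?_
      rw [not_lt] at h1
      rw [hD]
      gcongr
    have hle := measure_le_of_frequently_ae_le hΩb (fun n => (h n).nonneg) hμ Metric.isOpen_ball
      (hsub.trans inter_subset_right) hD0 hfreq
    rw [EuclideanSpace.volume_ball_fin_two, ← ENNReal.ofReal_pow ht0.le, ← ENNReal.ofReal_mul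
      (by positivity), ← ENNReal.ofReal_mul hD0] at hle
    have h1 : μ.real {p} ≤ D * (t ^ 2 * Real.pi) := by
      refine ENNReal.toReal_le_of_le_ofReal (by have := Real.pi_pos; positivity)
        ((measure_mono ?_).trans hle)
      rintro _ rfl
      exact Metric.mem_ball_self ht0
    have hpi := Real.pi_pos
    have h2 : D * (t ^ 2 * Real.pi) = (D * t) * t * Real.pi := by ring
    have h3 : (D * t) * t ≤ 1 := by nlinarith
    nlinarith

/-- Off a set away from which the sequence is locally bounded above, the weak limit is absolutely
continuous. -/
lemma restrict_absolutelyContinuous {Ω : Set Plane} (hΩb : Bornology.IsBounded Ω) {C : ℝ}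
    {u F φ : ℕ → Plane → ℝ}
    (h : ∀ n, IsAdmissible Ω C (u n) (F n) (φ n)) {μ : Measure Plane} [IsFiniteMeasure μ]
    (hμ : ∀ η : Plane → ℝ, Continuous η → HasCompactSupport η → tsupport η ⊆ Ω →
      Tendsto (fun j => ∫ x in Ω, F j x * η x) atTop (𝓝 (∫ x, η x ∂μ)))
    {W : Set Plane} (hW : IsOpen W) (hWΩ : W ⊆ Ω) (hub : LocUniformBddAbove W u) :
    μ.restrict W ≪ volume := by
  have hC := (h 0).const_nonneg
  refine Measure.AbsolutelyContinuous.mk fun N hN hN0 => ?_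
  rw [Measure.restrict_apply hN]
  refine measure_null_of_locally_null _ fun p hp => ?_
  obtain ⟨s, hs, hsW⟩ := Metric.nhds_basis_closedBall.mem_iff.1 (hW.mem_nhds hp.2)
  obtain ⟨M, hM⟩ := hub _ (isCompact_closedBall p s) hsW
  set D := C * Real.exp (max M 0) with hD
  have hD0 : 0 ≤ D := by positivity
  have hbW : Metric.ball p s ⊆ W := Metric.ball_subset_closedBall.trans hsW
  refine ⟨(N ∩ W) ∩ Metric.ball p s, inter_mem_nhdsWithin _ (Metric.ball_mem_nhds p hs), ?_⟩
  by_contra hne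
  have hpos : (ENNReal.ofReal D • volume) ((N ∩ W) ∩ Metric.ball p s) <
      μ ((N ∩ W) ∩ Metric.ball p s) := by
    rw [Measure.smul_apply, measure_mono_null (inter_subset_left.trans inter_subset_left) hN0,
      smul_zero]
    exact pos_iff_ne_zero.2 hne
  have : (ENNReal.ofReal D • (volume : Measure Plane)).OuterRegular :=
    Measure.OuterRegular.smul _ ENNReal.ofReal_ne_top
  obtain ⟨U, hNU, hU, hUlt⟩ := exists_isOpen_lt_of_lt _ _ hpos
  have hle := measure_le_of_frequently_ae_le hΩb (fun n => (h n).nonneg) hμ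
    (hU.inter Metric.isOpen_ball) ((inter_subset_right.trans hbW).trans hWΩ) hD0
    (U := U ∩ Metric.ball p s) (D := D) (Eventually.frequently (Eventually.of_forall fun n => by
      filter_upwards [ae_restrict_of_ae_restrict_of_subset
          (inter_subset_right.trans Metric.ball_subset_closedBall) (hM n),
        ae_restrict_of_ae_restrict_of_subset
          ((inter_subset_right.trans hbW).trans hWΩ) (h n).le_exp] with x h1 h2
      refine h2.trans ?_
      rw [hD]
      gcongr))
  have h1 : μ ((N ∩ W) ∩ Metric.ball p s) ≤ (ENNReal.ofReal D • volume) U :=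
    (measure_mono (subset_inter hNU inter_subset_right)).trans
      (hle.trans (mul_le_mul_right (measure_mono inter_subset_left) _))
  exact absurd hUlt (not_lt.2 h1)

/-- Decomposition of the weak limit into point masses on a finite set and a density. -/
lemma weakMeasureLimit_of_absolutelyContinuous {Ω : Set Plane} (hΩ : IsOpen Ω)
    {F : ℕ → Plane → ℝ} {μ : Measure Plane} [IsFiniteMeasure μ]
    (hμ : ∀ η : Plane → ℝ, Continuous η → HasCompactSupport η → tsupport η ⊆ Ω →
      Tendsto (fun j => ∫ x in Ω, F j x * η x) atTop (𝓝 (∫ x, η x ∂μ)))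
    {S : Finset Plane} (hS : (S : Set Plane) ⊆ Ω) (hac : μ.restrict (Ω \ S) ≪ volume) :
    WeakMeasureLimit Ω F S (fun p => μ.real {p})
      (fun x => ((μ.restrict (Ω \ S)).rnDeriv volume x).toReal) := by
  intro η hη hηc hηΩ
  convert hμ η hη hηc hηΩ using 2
  have hi : Integrable η μ := hη.integrable_of_hasCompactSupport hηc
  have hz : ∀ x, x ∉ Ω → η x = 0 := fun x hx =>
    image_eq_zero_of_notMem_tsupport fun h => hx (hηΩ h)
  rw [setIntegral_eq_integral_of_forall_compl_eq_zero fun x hx => by rw [hz x hx, mul_zero]]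
  have h1 := integral_rnDeriv_smul (f := η) hac
  simp only [smul_eq_mul] at h1
  rw [h1, ← setIntegral_eq_integral_of_forall_compl_eq_zero (μ := μ) hz]
  have h2 : ∑ p ∈ S, μ.real {p} * η p = ∫ x in (S : Set Plane), η x ∂μ := by
    rw [setIntegral_finset S hi.integrableOn]; simp
  rw [h2, ← setIntegral_union disjoint_sdiff_right (hΩ.measurableSet.diff S.measurableSet)
    hi.integrableOn hi.integrableOn, union_sdiff_cancel hS]

/-! ### Divergence of the exponential integrals at blow-up points -/

lemma setLIntegral_ball_norm_sub_rpow_eq_top {c σ : ℝ} (hc : 0 < c) (hσ : 0 < σ) (p : Plane) :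
    ∫⁻ x in Metric.ball p σ, ENNReal.ofReal (c * ‖x - p‖ ^ (-2 : ℝ)) = ⊤ := by
  have h1 : ∫⁻ x in Metric.ball p σ, ENNReal.ofReal (c * ‖x - p‖ ^ (-2 : ℝ)) =
      ∫⁻ x in Metric.ball (0 : Plane) σ, ENNReal.ofReal (c * ‖x‖ ^ (-2 : ℝ)) := by
    rw [← lintegral_indicator measurableSet_ball, ← lintegral_indicator measurableSet_ball,
      ← lintegral_sub_right_eq_self (fun x => (Metric.ball (0 : Plane) σ).indicator
        (fun x => ENNReal.ofReal (c * ‖x‖ ^ (-2 : ℝ))) x) p]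
    refine lintegral_congr fun x => ?_
    by_cases hx : x ∈ Metric.ball p σ
    · rw [indicator_of_mem hx, indicator_of_mem (by simpa [dist_eq_norm] using hx)]
    · rw [indicator_of_notMem hx, indicator_of_notMem (by simpa [dist_eq_norm] using hx)]
  rw [h1]
  by_contra hne
  have hint : IntegrableOn (fun x : Plane => c * ‖x‖ ^ (-2 : ℝ)) (Metric.ball (0 : Plane) σ) := by
    refine ⟨((measurable_norm.pow_const _).const_mul c).aestronglyMeasurable, ?_⟩
    rw [hasFiniteIntegral_iff_ofReal (Eventually.of_forall fun x => by positivity)]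
    exact lt_top_iff_ne_top.2 hne
  rw [integrableOn_fun_norm_addHaar (volume : Measure Plane) (f := fun r => c * r ^ (-2 : ℝ))] at hint
  simp only [finrank_euclideanSpace, Fintype.card_fin, Nat.add_one_sub_one, pow_one,
    smul_eq_mul] at hint
  have h2 : IntegrableOn (fun y : ℝ => y ^ (-1 : ℝ)) (Ioo 0 σ) := by
    refine IntegrableOn.congr_fun (hint.const_mul c⁻¹) (fun y hy => ?_) measurableSet_Ioo
    have hy0 : 0 < y := hy.1
    have h3 : y ^ (-1 : ℝ) = y * y ^ (-2 : ℝ) := by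
      rw [show (-1 : ℝ) = 1 + -2 by norm_num, Real.rpow_add hy0, Real.rpow_one]
    rw [h3]
    field_simp
  rw [intervalIntegral.integrableOn_Ioo_rpow_iff hσ] at h2
  exact lt_irrefl _ h2

/-- Near an isolated blow-up point `p`, if `u n` is locally bounded below elsewhere, then `u n` is
bounded below by the potential of `F n` up to a constant. The annular mollifier of a point close to
`p` only sees values of `u n` at points away from `p`. -/
lemma exists_ae_potential_le {Ω : Set Plane} {C : ℝ} {u F φ : ℕ → Plane → ℝ}
    (h : ∀ n, IsAdmissible Ω C (u n) (F n) (φ n)) {b : RadialProfile}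
    (hb : ∀ t, t ≤ 1 / 4 → b.toFun t = 0) {W : Set Plane}
    (hlb : LocUniformBddBelow W u) {p : Plane} {δ : ℝ} (hδ : 0 < δ)
    (hpΩ : Metric.closedBall p (2 * δ) ⊆ Ω) (hpW : Metric.closedBall p (2 * δ) \ {p} ⊆ W) :
    ∃ M : ℝ, ∀ n, ∀ᵐ x ∂(volume.restrict (Metric.ball p (δ / 8))),
      IntegrableOn (fun y => logKernel δ (x - y) * F n y) Ω ∧
      (∫ y in Ω, b.kernel δ (x - y) * F n y) - M ≤ u n x := by
  set A : Set Plane := Metric.closedBall p (2 * δ) \ Metric.ball p (δ / 8) with hA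
  have hAc : IsCompact A := (isCompact_closedBall _ _).diff Metric.isOpen_ball
  have hAW : A ⊆ W := fun y hy => hpW ⟨hy.1, by
    rintro rfl
    exact hy.2 (Metric.mem_ball_self (by positivity))⟩
  obtain ⟨m, hm⟩ := hlb A hAc hAW
  refine ⟨C * logMass δ - m, fun n => ?_⟩
  have hmA : ∀ᵐ y ∂(volume.restrict Ω), y ∈ A → m ≤ u n y :=
    ae_restrict_of_ae ((ae_restrict_iff' hAc.measurableSet).1 (hm n))
  filter_upwards [ae_restrict_of_ae_restrict_of_subset
      (Metric.ball_subset_ball (by linarith : δ / 8 ≤ δ)) ((h n).ae_abs_sub_le b hpΩ),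
    ae_restrict_mem measurableSet_ball] with x hx hxp
  obtain ⟨h1, h2⟩ := hx δ hδ le_rfl
  refine ⟨h1, ?_⟩
  have hxp' := Metric.mem_ball.1 hxp
  have hxsub : Metric.closedBall x δ ⊆ Metric.closedBall p (2 * δ) :=
    Metric.closedBall_subset_closedBall' (by linarith)
  have hcont : Continuous fun y => b.mollifier δ (x - y) :=
    (b.continuous_mollifier δ).comp (continuous_const.sub continuous_id)
  have h3 : m ≤ ∫ y in Ω, b.mollifier δ (x - y) * u n y := by
    calc m = ∫ y in Ω, b.mollifier δ (x - y) * m := by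
          rw [integral_mul_const, b.setIntegral_mollifier_eq_one hδ (hxsub.trans hpΩ), one_mul]
      _ ≤ _ := by
          refine integral_mono_ae
            (((b.integrable_mollifier hδ).comp_sub_left x).integrableOn.mul_const m)
            (integrable_mul_of_support_subset (h n).sol.1 hcont (isCompact_closedBall x δ)
              (hxsub.trans hpΩ) fun y hy => b.mollifier_eq_zero_of_notMem hδ hy).integrableOn ?_
          filter_upwards [hmA] with y hy
          by_cases hyx : y ∈ Metric.closedBall x δ
          · by_cases hyp : y ∈ Metric.ball p (δ / 8)
            · have h4 : b.mollifier δ (x - y) = 0 := by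
                rw [RadialProfile.mollifier, hb, mul_zero]
                rw [div_le_iff₀ (by positivity)]
                have h5 : ‖x - y‖ ≤ δ / 2 := by
                  rw [← dist_eq_norm]
                  have := dist_triangle x p y
                  rw [dist_comm p y] at this
                  linarith [Metric.mem_ball.1 hyp]
                calc ‖x - y‖ ^ 2 ≤ (δ / 2) ^ 2 := by gcongr
                  _ = 1 / 4 * δ ^ 2 := by ring
              rw [h4, zero_mul, zero_mul]
            · exact mul_le_mul_of_nonneg_left (hy ⟨hxsub hyx, hyp⟩) (b.mollifier_nonneg _ _)
          · rw [b.mollifier_eq_zero_of_notMem hδ hyx, zero_mul, zero_mul]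
  have := (abs_le.1 h2).1
  linarith

/-- At an atom of mass at least `4π` the limit of the potentials of `F n` is at least
`2 log (1 / ‖x - p‖)` up to a constant, and `‖x - p‖⁻²` is not integrable; hence, by Fatou's lemma,
the integrals of `exp (u n)` over balls around `p` diverge. -/
theorem tendsto_setLIntegral_exp {Ω : Set Plane} (hΩ : IsOpen Ω) {C : ℝ} {u F φ : ℕ → Plane → ℝ}
    (h : ∀ n, IsAdmissible Ω C (u n) (F n) (φ n)) {μ : Measure Plane} [IsFiniteMeasure μ]
    (hμ : ∀ η : Plane → ℝ, Continuous η → HasCompactSupport η → tsupport η ⊆ Ω →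
      Tendsto (fun j => ∫ x in Ω, F j x * η x) atTop (𝓝 (∫ x, η x ∂μ)))
    {S : Finset Plane} (hlb : LocUniformBddBelow (Ω \ S) u) {p : Plane} (hp : p ∈ Ω)
    (hpμ : 4 * Real.pi ≤ μ.real {p}) {ρ : ℝ} (hρ : 0 < ρ) :
    Tendsto (fun n => ∫⁻ x in Metric.ball p ρ, ENNReal.ofReal (Real.exp (u n x))) atTop (𝓝 ⊤) := by
  obtain ⟨b, hb⟩ := RadialProfile.exists_annular_profile
  have hSo : IsOpen (Ω \ ((S : Set Plane) \ {p})) :=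
    hΩ.sdiff ((S.finite_toSet.subset sdiff_subset).isClosed)
  obtain ⟨s, hs, hsΩ⟩ := Metric.nhds_basis_closedBall.mem_iff.1
    (hSo.mem_nhds (show p ∈ Ω \ ((S : Set Plane) \ {p}) from ⟨hp, fun h => h.2 rfl⟩))
  set δ := s / 2 with hδs
  have hδ : 0 < δ := by positivity
  have h2δ : Metric.closedBall p (2 * δ) ⊆ Ω \ ((S : Set Plane) \ {p}) := by
    rwa [show 2 * δ = s by rw [hδs]; ring]
  have hpΩ : Metric.closedBall p (2 * δ) ⊆ Ω := h2δ.trans sdiff_subset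
  obtain ⟨M, hM⟩ := exists_ae_potential_le h hb hlb hδ hpΩ
    (fun y hy => ⟨hpΩ hy.1, fun hyS => (h2δ hy.1).2 ⟨hyS, hy.2⟩⟩)
  have hpi := Real.pi_pos
  set σ := min ρ (δ / 8) with hσ
  have hσ0 : 0 < σ := by positivity
  set c := Real.exp (b.smoothLog 0 - M) * δ ^ 2 with hc
  have hc0 : 0 < c := by positivity
  have hσΩ : Metric.ball p σ ⊆ Ω := fun y hy => hpΩ (by
    rw [Metric.mem_closedBall]
    have := min_le_right ρ (δ / 8)
    linarith [Metric.mem_ball.1 hy])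
  have hlim : ∀ᵐ x ∂(volume.restrict (Metric.ball p σ)), ENNReal.ofReal (c * ‖x - p‖ ^ (-2 : ℝ)) ≤
      liminf (fun n => ENNReal.ofReal (Real.exp (u n x))) atTop := by
    have hne : ∀ᵐ x ∂(volume.restrict (Metric.ball p σ)), x ≠ p :=
      ae_restrict_of_ae (by simp [ae_iff, measure_singleton])
    filter_upwards [ae_all_iff.2 fun n => ae_restrict_of_ae_restrict_of_subset
      (Metric.ball_subset_ball (min_le_right ρ (δ / 8))) (hM n), hne,
      ae_restrict_mem measurableSet_ball] with x hx hxp hxσ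
    have hε : 0 < ‖x - p‖ := norm_pos_iff.2 (sub_ne_zero.2 hxp)
    have hxδ : ‖x - p‖ ≤ δ / 8 := by
      rw [← dist_eq_norm]
      exact (le_of_lt (Metric.mem_ball.1 hxσ)).trans (min_le_right _ _)
    have hεδ : ‖x - p‖ ≤ δ := by linarith
    have hxΩ : Metric.closedBall x δ ⊆ Ω :=
      (Metric.closedBall_subset_closedBall' (by rw [dist_eq_norm]; linarith)).trans hpΩ
    -- a continuous minorant of the kernel that agrees with it at `p`
    set g : Plane → ℝ := fun y =>
      max 0 (b.smoothPotential δ (x - y) - b.smoothPotential ‖x - p‖ (x - y)) with hg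
    have hgc : Continuous g := continuous_const.max (b.continuous_smoothPotential_sub _ _ x)
    have hgz : ∀ y, y ∉ Metric.closedBall x δ → g y = 0 := fun y hy => by
      simp only [hg, b.smoothPotential_sub_eq_zero_of_notMem hε hεδ hy, max_self]
    have hgsupp : tsupport g ⊆ Metric.closedBall x δ :=
      closure_minimal (fun y hy => by_contra fun hy' => hy (hgz y hy')) Metric.isClosed_closedBall
    have hgcs : HasCompactSupport g :=
      HasCompactSupport.of_support_subset_isCompact (isCompact_closedBall x δ)
        ((subset_tsupport g).trans hgsupp)
    have hg0 : ∀ y, 0 ≤ g y := fun y => le_max_left _ _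
    have hgk : ∀ y, y ≠ x → g y ≤ b.kernel δ (x - y) := fun y hy => by
      refine max_le (b.kernel_nonneg _ _) ?_
      rw [← b.kernel_sub_kernel hδ hε (sub_ne_zero.2 hy.symm)]
      linarith [b.kernel_nonneg ‖x - p‖ (x - y)]
    have hglim := hμ g hgc hgcs (hgsupp.trans hxΩ)
    have hgp : b.kernel δ (x - p) ≤ g p := by
      refine le_max_of_le_right ?_
      rw [b.kernel_of_ne hδ (sub_ne_zero.2 hxp), b.smoothPotential_of_le hε le_rfl]
    have hgμ : 4 * Real.pi * b.kernel δ (x - p) ≤ ∫ y, g y ∂μ := by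
      have hgi : Integrable g μ := hgc.integrable_of_hasCompactSupport hgcs
      calc 4 * Real.pi * b.kernel δ (x - p) ≤ μ.real {p} * g p := by
            gcongr
            exact b.kernel_nonneg _ _
        _ = ∫ y in {p}, g y ∂μ := by rw [integral_singleton, smul_eq_mul]
        _ ≤ ∫ y, g y ∂μ := setIntegral_le_integral hgi (Eventually.of_forall hg0)
    have hkl : b.smoothLog 0 - Real.log (‖x - p‖ ^ 2 / δ ^ 2) ≤
        4 * Real.pi * b.kernel δ (x - p) := by
      have h1 : (4 * Real.pi)⁻¹ * (b.smoothLog (‖x - p‖ ^ 2 / δ ^ 2) -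
          Real.log (‖x - p‖ ^ 2 / δ ^ 2)) ≤ b.kernel δ (x - p) := le_max_right _ _
      rw [inv_mul_le_iff₀ (by positivity)] at h1
      have := b.smoothLog_zero_le (s := ‖x - p‖ ^ 2 / δ ^ 2) (by positivity)
      linarith
    have hun : ∀ n, (∫ y in Ω, F n y * g y) - M ≤ u n x := by
      intro n
      obtain ⟨h1, h2⟩ := hx n
      refine le_trans (sub_le_sub_right ?_ M) h2
      have hneΩ : ∀ᵐ y ∂(volume.restrict Ω), y ≠ x :=
        ae_restrict_of_ae (by simp [ae_iff, measure_singleton])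
      refine integral_mono_of_nonneg ?_ ?_ ?_
      · filter_upwards [(h n).nonneg] with y hy
        exact mul_nonneg hy (hg0 y)
      · refine Integrable.mono h1 (((b.measurable_kernel δ).comp (measurable_const.sub
          measurable_id)).aestronglyMeasurable.mul (h n).integrableOn.aestronglyMeasurable)
          (Eventually.of_forall fun y => ?_)
        rw [norm_mul, norm_mul, Real.norm_of_nonneg (b.kernel_nonneg _ _),
          Real.norm_of_nonneg (logKernel_nonneg _ _)]
        exact mul_le_mul_of_nonneg_right (b.kernel_le hδ _) (norm_nonneg _)
      · filter_upwards [(h n).nonneg, hneΩ] with y hy hyx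
        rw [mul_comm]
        exact mul_le_mul_of_nonneg_right (hgk y hyx) hy
    have hval : c * ‖x - p‖ ^ (-2 : ℝ) =
        Real.exp (b.smoothLog 0 - Real.log (‖x - p‖ ^ 2 / δ ^ 2) - M) := by
      rw [hc, sub_right_comm, Real.exp_sub _ (Real.log _), Real.exp_log (by positivity),
        Real.rpow_neg hε.le, Real.rpow_two]
      field_simp
    have hexp : Tendsto (fun n => ENNReal.ofReal (Real.exp ((∫ y in Ω, F n y * g y) - M))) atTop
        (𝓝 (ENNReal.ofReal (Real.exp ((∫ y, g y ∂μ) - M)))) :=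
      (ENNReal.continuous_ofReal.comp Real.continuous_exp).continuousAt.tendsto.comp
        (hglim.sub_const M)
    calc ENNReal.ofReal (c * ‖x - p‖ ^ (-2 : ℝ))
        ≤ ENNReal.ofReal (Real.exp ((∫ y, g y ∂μ) - M)) := by
          rw [hval]
          refine ENNReal.ofReal_le_ofReal (Real.exp_le_exp.2 ?_)
          linarith
      _ = liminf (fun n => ENNReal.ofReal (Real.exp ((∫ y in Ω, F n y * g y) - M))) atTop :=
          hexp.liminf_eq.symm
      _ ≤ liminf (fun n => ENNReal.ofReal (Real.exp (u n x))) atTop :=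
          liminf_le_liminf (Eventually.of_forall fun n =>
            ENNReal.ofReal_le_ofReal (Real.exp_le_exp.2 (hun n)))
  have hmeas : ∀ n, AEMeasurable (fun x => ENNReal.ofReal (Real.exp (u n x)))
      (volume.restrict (Metric.ball p σ)) := fun n => by
    have h1 : AEMeasurable (u n) (volume.restrict Ω) :=
      (h n).sol.1.aestronglyMeasurable.aemeasurable
    exact (h1.mono_measure (Measure.restrict_mono hσΩ le_rfl)).exp.ennreal_ofReal
  have htop : liminf (fun n => ∫⁻ x in Metric.ball p σ, ENNReal.ofReal (Real.exp (u n x))) atTop =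
      ⊤ := by
    rw [← top_le_iff, ← setLIntegral_ball_norm_sub_rpow_eq_top hc0 hσ0 p]
    exact (lintegral_mono_ae hlim).trans (lintegral_liminf_le' hmeas)
  have hσt : Tendsto (fun n => ∫⁻ x in Metric.ball p σ, ENNReal.ofReal (Real.exp (u n x))) atTop
      (𝓝 ⊤) := tendsto_of_le_liminf_of_limsup_le htop.ge le_top
  exact tendsto_nhds_top_mono hσt (Eventually.of_forall fun n =>
    lintegral_mono_set (Metric.ball_subset_ball (min_le_left _ _)))

/-! ### The alternative -/

lemma ofReal_integral_le_lintegral_ofReal {α : Type*} [MeasurableSpace α] {μ : Measure α}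
    (f : α → ℝ) : ENNReal.ofReal (∫ x, f x ∂μ) ≤ ∫⁻ x, ENNReal.ofReal (f x) ∂μ := by
  by_cases hf : Integrable f μ
  · rw [integral_eq_lintegral_pos_part_sub_lintegral_neg_part hf]
    refine (ENNReal.ofReal_le_ofReal (sub_le_self _ ENNReal.toReal_nonneg)).trans ?_
    exact ENNReal.ofReal_toReal_le
  · rw [integral_undef hf]; simp

/-- The hypotheses on the coefficients yield the bounds used in the local analysis. -/
lemma isAdmissible_expTerm {Ω : Set Plane} (hΩo : IsOpen Ω) (hΩn : Ω.Nonempty)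
    (hΩb : Bornology.IsBounded Ω) (P : Measure ℝ) [IsProbabilityMeasure P]
    {V : ℝ → Plane → ℝ} {φ u : Plane → ℝ} {C : ℝ}
    (hφmeas : AEMeasurable φ (volume.restrict Ω))
    (hu : IsDistribSolution Ω u (fun x => expTerm P V u x + φ x))
    (hV : ∀ᵐ z ∂(P.prod (volume.restrict Ω)), 0 ≤ V z.1 z.2 ∧ V z.1 z.2 ≤ C)
    (hφ : ∀ᵐ x ∂(volume.restrict Ω), |φ x| ≤ C)
    (hmass : ∫⁻ x in Ω, ∫⁻ α in Icc (0 : ℝ) 1,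
      ENNReal.ofReal (V α x * Real.exp (α * u x)) ∂P ≤ ENNReal.ofReal C)
    (hpos : ∫⁻ x in Ω, ENNReal.ofReal (max (u x) 0) ≤ ENNReal.ofReal C) :
    IsAdmissible Ω C u (expTerm P V u) φ := by
  have : IsFiniteMeasure (volume.restrict Ω) := ⟨by
    rw [Measure.restrict_apply_univ]; exact hΩb.measure_lt_top⟩
  have hne : (ae (volume.restrict Ω)).NeBot := by
    rw [ae_neBot]
    intro h0
    rw [Measure.restrict_eq_zero] at h0
    exact (hΩo.measure_pos volume hΩn).ne' h0
  have hC : 0 ≤ C := by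
    obtain ⟨x, hx⟩ := hφ.exists
    exact (abs_nonneg _).trans hx
  have hφi : IntegrableOn φ Ω :=
    Integrable.of_bound hφmeas.aestronglyMeasurable C hφ
  have hVx : ∀ᵐ x ∂(volume.restrict Ω), ∀ᵐ α ∂P, 0 ≤ V α x ∧ V α x ≤ C := by
    refine Measure.ae_ae_of_ae_prod (p := fun z : Plane × ℝ => 0 ≤ V z.2 z.1 ∧ V z.2 z.1 ≤ C) ?_
    exact Measure.measurePreserving_swap.quasiMeasurePreserving.ae hV
  have hF0 : ∀ᵐ x ∂(volume.restrict Ω), 0 ≤ expTerm P V u x := by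
    filter_upwards [hVx] with x hx
    refine integral_nonneg_of_ae (ae_restrict_of_ae ?_)
    filter_upwards [hx] with α hα
    exact mul_nonneg hα.1 (Real.exp_pos _).le
  have hFe : ∀ᵐ x ∂(volume.restrict Ω), expTerm P V u x ≤ C * Real.exp (max (u x) 0) := by
    filter_upwards [hVx] with x hx
    have h1 : ‖expTerm P V u x‖ ≤ C * Real.exp (max (u x) 0) * P.real (Icc 0 1) := by
      refine norm_setIntegral_le_of_norm_le_const_ae' (measure_lt_top _ _) ?_
      filter_upwards [hx] with α hα hα01
      rw [Real.norm_of_nonneg (mul_nonneg hα.1 (Real.exp_pos _).le)]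
      refine mul_le_mul hα.2 (Real.exp_le_exp.2 ?_) (Real.exp_pos _).le hC
      rcases le_total (u x) 0 with h | h
      · exact (mul_nonpos_of_nonneg_of_nonpos hα01.1 h).trans (le_max_right _ _)
      · exact (mul_le_of_le_one_left h hα01.2).trans (le_max_left _ _)
    refine (le_abs_self _).trans (h1.trans ?_)
    exact mul_le_of_le_one_right (by positivity) measureReal_le_one
  have hFm : AEStronglyMeasurable (expTerm P V u) (volume.restrict Ω) := by
    refine (hu.2.1.aestronglyMeasurable.sub hφmeas.aestronglyMeasurable).congr
      (Eventually.of_forall fun x => ?_)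
    simp
  have hFl : ∫⁻ x in Ω, ENNReal.ofReal (expTerm P V u x) ≤ ENNReal.ofReal C :=
    (lintegral_mono fun x => ofReal_integral_le_lintegral_ofReal _).trans hmass
  have hFi : IntegrableOn (expTerm P V u) Ω :=
    ⟨hFm, (hasFiniteIntegral_iff_ofReal hF0).2 (hFl.trans_lt ENNReal.ofReal_lt_top)⟩
  have hu0 : ∀ᵐ x ∂(volume.restrict Ω), 0 ≤ max (u x) 0 :=
    Eventually.of_forall fun x => le_max_right _ _
  have hui : IntegrableOn (fun x => max (u x) 0) Ω :=
    ⟨(hu.1.aestronglyMeasurable.aemeasurable.max aemeasurable_const).aestronglyMeasurable,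
      (hasFiniteIntegral_iff_ofReal hu0).2 (hpos.trans_lt ENNReal.ofReal_lt_top)⟩
  refine ⟨hu, hF0, hFe, hFi, ?_, hφi, hφ, hui, ?_⟩
  · rw [← ENNReal.ofReal_le_ofReal_iff hC, ofReal_integral_eq_lintegral_ofReal hFi hF0]
    exact hFl
  · rw [← ENNReal.ofReal_le_ofReal_iff hC, ofReal_integral_eq_lintegral_ofReal hui hu0]
    exact hpos

lemma blowUpSet_eq_empty {Ω : Set Plane} (hΩ : IsOpen Ω) {u : ℕ → Plane → ℝ}
    (h : ∀ K, IsCompact K → K ⊆ Ω →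
      ∃ M : ℝ, ∀ᶠ n in atTop, ∀ᵐ x ∂(volume.restrict K), u n x ≤ M) : blowUpSet Ω u = ∅ := by
  rw [eq_empty_iff_forall_notMem]
  rintro p ⟨hp, hblow⟩
  obtain ⟨s, hs, hsΩ⟩ := Metric.nhds_basis_closedBall.mem_iff.1 (hΩ.mem_nhds hp)
  obtain ⟨M, hM⟩ := h _ (isCompact_closedBall p s) hsΩ
  obtain ⟨n, hn1, hn2⟩ := ((hblow s hs M).and hM).exists
  refine hn1 ?_
  filter_upwards [ae_restrict_of_ae_restrict_of_subset
    (inter_subset_left.trans Metric.ball_subset_closedBall) hn2] with x hx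
  exact not_lt.2 hx

lemma Converges.blowUpSet_eq_empty {Ω : Set Plane} (hΩ : IsOpen Ω) {u : ℕ → Plane → ℝ}
    (h : Converges Ω u) : blowUpSet Ω u = ∅ := by
  obtain ⟨u₀, hb, hlim⟩ := h
  refine BrezisMerle.blowUpSet_eq_empty hΩ fun K hK hKΩ => ?_
  obtain ⟨M, hM⟩ := hb K hK hKΩ
  refine ⟨M + 1, ?_⟩
  filter_upwards [hlim K hK hKΩ 1 one_pos] with n hn
  filter_upwards [hn, ae_restrict_mem hK.measurableSet] with x hx hxK
  linarith [(abs_lt.1 hx).2, (abs_le.1 (hM x hxK)).2]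

lemma TendstoLocUniformNegInfty.blowUpSet_eq_empty {Ω : Set Plane} (hΩ : IsOpen Ω)
    {u : ℕ → Plane → ℝ} (h : TendstoLocUniformNegInfty Ω u) : blowUpSet Ω u = ∅ := by
  refine BrezisMerle.blowUpSet_eq_empty hΩ fun K hK hKΩ => ⟨0, ?_⟩
  filter_upwards [h K hK hKΩ 0] with n hn
  filter_upwards [hn] with x hx using hx.le

lemma Concentrates.blowUpSet_ne_empty {Ω : Set Plane} {P : Measure ℝ} {V : ℕ → ℝ → Plane → ℝ}
    {u : ℕ → Plane → ℝ} (h : Concentrates Ω P V u) : blowUpSet Ω u ≠ ∅ := by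
  obtain ⟨S, m, r, hS, -, hSu, -⟩ := h
  rw [← hSu, ← nonempty_iff_ne_empty]
  exact hS

lemma Converges.not_tendsto_negInfty {Ω : Set Plane} (hΩ : IsOpen Ω) (hΩn : Ω.Nonempty)
    {u : ℕ → Plane → ℝ} (h : Converges Ω u) : ¬ TendstoLocUniformNegInfty Ω u := by
  intro h'
  obtain ⟨p, hp⟩ := hΩn
  obtain ⟨u₀, hb, hlim⟩ := h
  obtain ⟨s, hs, hsΩ⟩ := Metric.nhds_basis_closedBall.mem_iff.1 (hΩ.mem_nhds hp)
  have hK : IsCompact (Metric.closedBall p s) := isCompact_closedBall p s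
  obtain ⟨M, hM⟩ := hb _ hK hsΩ
  obtain ⟨n, hn1, hn2⟩ := ((hlim _ hK hsΩ 1 one_pos).and (h' _ hK hsΩ (-M - 1))).exists
  have hne : (ae (volume.restrict (Metric.closedBall p s))).NeBot := by
    rw [ae_neBot]
    intro h0
    rw [Measure.restrict_eq_zero] at h0
    exact (Metric.measure_closedBall_pos volume p hs).ne' h0
  obtain ⟨x, ⟨hx1, hx2⟩, hxK⟩ := ((hn1.and hn2).and (ae_restrict_mem hK.measurableSet)).exists
  linarith [(abs_lt.1 hx1).1, (abs_le.1 (hM x hxK)).1]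

/-- If the integrals of `exp (u n)` over a ball in `Ω` diverge, then so do the double integrals, since
`1` is an atom of `P`. -/
lemma tendsto_lintegral_exp_top {Ω : Set Plane} {P : Measure ℝ} [IsProbabilityMeasure P]
    (hP1 : 0 < P {1}) {u : ℕ → Plane → ℝ} {p : Plane} {ρ : ℝ} (hρ : Metric.ball p ρ ⊆ Ω)
    (h : Tendsto (fun n => ∫⁻ x in Metric.ball p ρ, ENNReal.ofReal (Real.exp (u n x))) atTop
      (𝓝 ⊤)) :
    Tendsto (fun n => ∫⁻ x in Ω, ∫⁻ α in Icc (0 : ℝ) 1,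
      ENNReal.ofReal (Real.exp (α * u n x)) ∂P) atTop (𝓝 ⊤) := by
  have h1 : Tendsto (fun n => (∫⁻ x in Metric.ball p ρ, ENNReal.ofReal (Real.exp (u n x))) * P {1})
      atTop (𝓝 ⊤) := by
    have := ENNReal.Tendsto.mul_const (b := P {1}) h (Or.inl ENNReal.top_ne_zero)
    rwa [ENNReal.top_mul hP1.ne'] at this
  refine tendsto_nhds_top_mono h1 (Eventually.of_forall fun n => ?_)
  change (∫⁻ x in Metric.ball p ρ, ENNReal.ofReal (Real.exp (u n x))) * P {1} ≤ _
  rw [← lintegral_mul_const' _ _ (measure_ne_top P _)]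
  refine (lintegral_mono fun x => ?_).trans (lintegral_mono_set hρ)
  have h2 := lintegral_mono_set (μ := P) (f := fun α => ENNReal.ofReal (Real.exp (α * u n x)))
    (show ({1} : Set ℝ) ⊆ Icc 0 1 by simp)
  rwa [lintegral_singleton, one_mul] at h2

end BrezisMerle

end

theorem mainTheorem10
    (Ω : Set BrezisMerle.Plane) (hΩo : IsOpen Ω) (hΩc : IsConnected Ω)
    (hΩb : Bornology.IsBounded Ω)
    (P : Measure ℝ) [IsProbabilityMeasure P]
    (hPsupp : P.support ⊆ Icc (0 : ℝ) 1) (hP1 : 0 < P {1})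
    (V : ℕ → ℝ → BrezisMerle.Plane → ℝ) (φ u : ℕ → BrezisMerle.Plane → ℝ) (C : ℝ)
    (hVmeas : ∀ n, AEMeasurable (fun z : ℝ × BrezisMerle.Plane => V n z.1 z.2)
      (P.prod (volume.restrict Ω)))
    (hφmeas : ∀ n, AEMeasurable (φ n) (volume.restrict Ω))
    (hu : ∀ n, BrezisMerle.IsDistribSolution Ω (u n)
      (fun x => BrezisMerle.expTerm P (V n) (u n) x + φ n x))
    (hV : ∀ n, ∀ᵐ z ∂(P.prod (volume.restrict Ω)), 0 ≤ V n z.1 z.2 ∧ V n z.1 z.2 ≤ C)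
    (hφ : ∀ n, ∀ᵐ x ∂(volume.restrict Ω), |φ n x| ≤ C)
    (hmass : ∀ n, ∫⁻ x in Ω, ∫⁻ α in Icc (0 : ℝ) 1,
      ENNReal.ofReal (V n α x * Real.exp (α * u n x)) ∂P ≤ ENNReal.ofReal C)
    (hpos : ∀ n, ∫⁻ x in Ω, ENNReal.ofReal (max (u n x) 0) ≤ ENNReal.ofReal C) :
    ∃ k : ℕ → ℕ, StrictMono k ∧
      BrezisMerle.ExactlyOne
        (BrezisMerle.Converges Ω (fun j => u (k j)))
        (BrezisMerle.TendstoLocUniformNegInfty Ω (fun j => u (k j)))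
        (BrezisMerle.Concentrates Ω P (fun j => V (k j)) (fun j => u (k j))) := by
  open BrezisMerle in
  have hadm : ∀ n, IsAdmissible Ω C (u n) (expTerm P (V n) (u n)) (φ n) := fun n =>
    isAdmissible_expTerm hΩo hΩc.nonempty hΩb P (hφmeas n) (hu n) (hV n) (hφ n) (hmass n) (hpos n)
  obtain ⟨k, μ, hk, hμfin, hμ⟩ := exists_weak_limit hΩb (fun n => (hadm n).nonneg)
    (fun n => (hadm n).integrableOn) (fun n => (hadm n).mass_le)
  have hadmk := fun j => hadm (k j)
  have hblow := blowUpSet_eq hΩo hΩb hadmk hμ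
  have hub : LocUniformBddAbove (Ω \ blowUpSet Ω fun j => u (k j)) fun j => u (k j) := by
    refine locUniformBddAbove_of_forall fun p hp => exists_ae_le_of_measure_lt hΩo hadmk hμ hp.1 ?_
    by_contra! hle
    exact hp.2 (hblow ▸ ⟨hp.1, hle⟩)
  rcases eq_or_ne (blowUpSet Ω fun j => u (k j)) ∅ with hS | hS
  · rw [hS, sdiff_empty] at hub
    rcases tendsto_negInfty_or_exists_bddBelow hΩo hΩc hadmk hub with hneg | ⟨k', hk', hlb⟩
    · exact ⟨k, hk, Or.inr (Or.inl ⟨fun h => h.not_tendsto_negInfty hΩo hΩc.nonempty hneg, hneg,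
        fun h => h.blowUpSet_ne_empty hS⟩)⟩
    · obtain ⟨k'', hk'', hconv⟩ := exists_converges hΩo (fun j => hadmk (k' j))
        (fun K hK hKΩ => (hub K hK hKΩ).imp fun M hM n => hM (k' n)) hlb
      exact ⟨fun j => k (k' (k'' j)), hk.comp (hk'.comp hk''), Or.inl ⟨hconv,
        hconv.not_tendsto_negInfty hΩo hΩc.nonempty,
        fun h => h.blowUpSet_ne_empty (hconv.blowUpSet_eq_empty hΩo)⟩⟩
  · refine ⟨k, hk, Or.inr (Or.inr ⟨fun h => hS (h.blowUpSet_eq_empty hΩo),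
      fun h => hS (h.blowUpSet_eq_empty hΩo), ?_⟩)⟩
    have hfin : (blowUpSet Ω fun j => u (k j)).Finite := by
      rw [hblow]
      -- a finite measure has finitely many atoms of mass at least `4π`
      have h1 := Measure.finite_const_le_meas_of_disjoint_iUnion μ
        (ε := ENNReal.ofReal (4 * Real.pi)) (by simpa using Real.pi_pos)
        (As := fun p : Plane => {p}) (fun p => measurableSet_singleton p)
        (fun p q hpq => disjoint_singleton.2 hpq) (measure_ne_top _ _)
      refine h1.subset fun p hp => ?_
      exact (ENNReal.ofReal_le_iff_le_toReal (measure_ne_top _ _)).2 hp.2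
    obtain ⟨S, hSeq⟩ := hfin.exists_finset_coe
    rw [← hSeq] at hub hS hblow
    have hSΩ : (S : Set Plane) ⊆ Ω := hblow ▸ fun p hp => hp.1
    have hSμ : ∀ p ∈ S, 4 * Real.pi ≤ μ.real {p} := fun p hp =>
      (hblow ▸ Finset.mem_coe.2 hp : p ∈ {p | p ∈ Ω ∧ 4 * Real.pi ≤ μ.real {p}}).2
    have hSn : S.Nonempty := Finset.coe_nonempty.1 (nonempty_iff_ne_empty.2 hS)
    have hW : IsOpen (Ω \ (S : Set Plane)) := hΩo.sdiff S.finite_toSet.isClosed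
    refine ⟨S, fun p => μ.real {p},
      fun x => ((μ.restrict (Ω \ (S : Set Plane))).rnDeriv volume x).toReal, hSn, hSΩ, hSeq, hSμ,
      Measure.integrable_toReal_rnDeriv.integrableOn,
      weakMeasureLimit_of_absolutelyContinuous hΩo hμ hSΩ
        (restrict_absolutelyContinuous hΩb hadmk hμ hW sdiff_subset hub), ?_, fun hlb => ?_⟩
    · intro K hK hKW
      obtain ⟨M, hM⟩ := hub K hK hKW
      refine ⟨max M 0, fun n => ?_⟩
      filter_upwards [hM n] with x hx
      exact max_le_max hx le_rfl
    · have hdiv : ∀ p ∈ S, ∀ ρ : ℝ, 0 < ρ → Tendsto (fun j => ∫⁻ x in Metric.ball p ρ,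
          ENNReal.ofReal (Real.exp (u (k j) x))) atTop (𝓝 ⊤) := fun p hp ρ hρ =>
        tendsto_setLIntegral_exp hΩo hadmk hμ hlb (hSΩ hp) (hSμ p hp) hρ
      refine ⟨fun p hp ρ hρ _ => hdiv p hp ρ hρ, ?_⟩
      obtain ⟨p, hp⟩ := hSn
      obtain ⟨ρ, hρ, hρΩ⟩ := Metric.isOpen_iff.1 hΩo p (hSΩ hp)
      exact tendsto_lintegral_exp_top hP1 hρΩ (hdiv p hp ρ hρ)
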